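/- Let $M$ be a (Hausdorff, finite-dimensional) real-analytic manifold without boundary and $p\in M$. Call a continuous map $\gamma$ from $[0,1]$ to $M$ (or to $[0,1]$) *piecewise analytic* if there is a subdivision $0=t_0<\dots<t_r=1$ such that each restriction $\gamma|_{[t_{i-1},t_i]}$ is real-analytic up to the end points. Let $\Omega^{\mathrm{pa}}(M,p)$ be the set of piecewise-analytic $\gamma:[0,1]\to M$ with $\gamma(0)=\gamma(1)=p$. Two loops $\gamma_0,\gamma_1\in\Omega^{\mathrm{pa}}(M,p)$ are *thin homotopic* if there is a continuous map $\eta:[0,1]^2\to M$ with $\eta(0,\cdot)=\gamma_0$, $\eta(1,\cdot)=\gamma_1$ and $\eta(s,\cdot)\in\Omega^{\mathrm{pa}}(M,p)$ for all $s$, which is real-analytic on each closed polygon of some finite polygonal paving of $[0,1]^2$, and which satisfies $\eta([0,1]^2)\subseteq\gamma_0([0,1])\cup\gamma_1([0,1])$. They are *thin equivalent* if they are related by a finite composition of thin homotopies of this kind (between loops in $\Omega^{\mathrm{pa}}(M,p)$). A *generalized reparametrization* of $\gamma\in\Omega^{\mathrm{pa}}(M,p)$ is a loop $\gamma\circ\phi$,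 where $\phi:[0,1]\to[0,1]$ is continuous and piecewise analytic with $\phi(0)=0$, $\phi(1)=1$ and $0<\phi(t)<1$ for $0<t<1$. A *retracing* relates a loop of the form $\alpha_2\cdot\beta^{-1}\cdot\beta\cdot\alpha_1$ (first $\alpha_1$, then $\beta$, then $\beta$ backwards, then $\alpha_2$) to the loop $\alpha_2\cdot\alpha_1$, where $\alpha_1,\alpha_2,\beta$ are piecewise-analytic paths in $M$ with $\alpha_1(0)=\alpha_2(1)=p$ and $\alpha_1(1)=\alpha_2(0)=\beta(0)$; here $\alpha_1$ or $\alpha_2$ (or both) may be omitted from both concatenations, the empty concatenation being the trivial (constant) loop at $p$. Two loops in $\Omega^{\mathrm{pa}}(M,p)$ are *retrace equivalent* if they are related by a finite sequence, within $\Omega^{\mathrm{pa}}(M,p)$, of retracings and generalized reparametrizations and their inverse operations. Then two loops $\gamma_0,\gamma_1\in\Omega^{\mathrm{pa}}(M,p)$ are thin equivalent if and only if they are retrace equivalent. -/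

import Mathlib

open scoped ContDiff Manifold unitInterval

namespace ThinLoops

/-- `f : ℝ → M`, regarded on `[0,1]`, is piecewise analytic: there is a subdivision
`0 = t₀ < ⋯ < t_r = 1` such that `f` is real-analytic on each closed interval `[t_{i-1}, t_i]`
(at an end point: `f` is locally the restriction of a convergent power series).
Here `M` is modelled on the real normed space `E`. -/
def PiecewiseAnalytic (E : Type*) [NormedAddCommGroup E] [NormedSpace ℝ E]
    {M : Type*} [TopologicalSpace M] [ChartedSpace E M] (f : ℝ → M) : Prop :=
  ∃ (r : ℕ) (t : Fin (r + 1) → ℝ), StrictMono t ∧ t 0 = 0 ∧ t (Fin.last r) = 1 ∧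
    ∀ i : Fin r, ContMDiffOn 𝓘(ℝ, ℝ) 𝓘(ℝ, E) ω f (Set.Icc (t i.castSucc) (t i.succ))

/-- A compact convex polygon in the plane, as a bounded intersection of finitely many closed
half-planes `a * x + b * y ≤ c`, each given by its triple `(a, b, c)`. -/
def IsConvexPolygon (P : Set (ℝ × ℝ)) : Prop :=
  IsCompact P ∧ ∃ S : Finset (ℝ × ℝ × ℝ),
    P = {x | ∀ c ∈ S, c.1 * x.1 + c.2.1 * x.2 ≤ c.2.2}

/-- A polygonal paving of the unit square: finitely many polygons with pairwise disjoint
interiors and union `[0,1]²`. (Restricting to convex polygons loses nothing, as every polygon is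
cut into convex ones. Polygons degenerated to segments or points may occur; those with nonempty
interior always cover the square already.) -/
def IsPolygonalPaving (C : Set (Set (ℝ × ℝ))) : Prop :=
  C.Finite ∧ (∀ P ∈ C, IsConvexPolygon P) ∧
    ⋃₀ C = Set.Icc (0 : ℝ) 1 ×ˢ Set.Icc (0 : ℝ) 1 ∧ C.PairwiseDisjoint interior

section

variable (E : Type*) [NormedAddCommGroup E] [NormedSpace ℝ E]
  {M : Type*} [TopologicalSpace M] [ChartedSpace E M]

/-- The set of piecewise-analytic loops in `M` based at `p`. -/
def PALoop (p : M) : Type _ := {γ : Path p p // PiecewiseAnalytic E γ.extend}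

/-- `η : [0,1]² → M` is piecewise analytic on some polygonal paving of the square: it is
real-analytic on each closed polygon of the paving. -/
def PiecewiseAnalyticSquare (η : I × I → M) : Prop :=
  ∃ C : Set (Set (ℝ × ℝ)), IsPolygonalPaving C ∧ ∀ P ∈ C,
    ContMDiffOn 𝓘(ℝ, ℝ × ℝ) 𝓘(ℝ, E) ω
      (fun x : ℝ × ℝ => η (Set.projIcc 0 1 zero_le_one x.1, Set.projIcc 0 1 zero_le_one x.2)) P

variable {E}

/-- Thin homotopy of piecewise-analytic based loops. A `Path.Homotopy` is a continuous map
`η` on the square with `η (0, ·) = γ₀`, `η (1, ·) = γ₁` and `η (s, 0) = η (s, 1) = p`. -/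
def ThinHomotopic {p : M} (γ₀ γ₁ : PALoop E p) : Prop :=
  ∃ η : Path.Homotopy γ₀.1 γ₁.1,
    (∀ s : I, PiecewiseAnalytic E (η.eval s).extend) ∧
    PiecewiseAnalyticSquare E η ∧
    Set.range η ⊆ Set.range γ₀.1 ∪ Set.range γ₁.1

/-- Thin equivalence: related by a finite chain of thin homotopies between piecewise-analytic
based loops. -/
def ThinEquivalent {p : M} (γ₀ γ₁ : PALoop E p) : Prop :=
  Relation.EqvGen ThinHomotopic γ₀ γ₁

/-- A piecewise-analytic generalized reparametrization of `[0,1]`: it need not be monotone. -/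
def IsGeneralizedReparametrization (φ : Path (0 : I) (1 : I)) : Prop :=
  PiecewiseAnalytic ℝ (fun t : ℝ => (φ.extend t : ℝ)) ∧
    ∀ t : I, 0 < t → t < 1 → 0 < φ t ∧ φ t < 1

/-- `γ' = γ ∘ φ` for a generalized reparametrization `φ`. -/
def IsReparametrizationOf {p : M} (γ' γ : PALoop E p) : Prop :=
  ∃ φ : Path (0 : I) (1 : I), IsGeneralizedReparametrization φ ∧ ∀ t : I, γ'.1 t = γ.1 (φ t)

variable (E) in
/-- `IsRetracing E γ' γ`: the loop `γ` is obtained from `γ'` by deleting one retraced path `β`,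
i.e. `γ'` runs through `α₁`, `β`, the inverse of `β`, and `α₂`, while `γ` runs through `α₁` and
`α₂`, all of them being piecewise-analytic paths. Either of the outer paths may be trivial and then
is absent from the concatenation; if both are, then `γ` is the trivial loop.
`Path.trans` traverses its first argument first, in the first half of `[0,1]`. -/
inductive IsRetracing {p : M} : Path p p → Path p p → Prop
  | middle {q r : M} (α₁ : Path p q) (β : Path q r) (α₂ : Path q p)
      (h₁ : PiecewiseAnalytic E α₁.extend) (hβ : PiecewiseAnalytic E β.extend)
      (h₂ : PiecewiseAnalytic E α₂.extend) :
      IsRetracing (α₁.trans (β.trans (β.symm.trans α₂))) (α₁.trans α₂)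
  | start {r : M} (β : Path p r) (α₂ : Path p p)
      (hβ : PiecewiseAnalytic E β.extend) (h₂ : PiecewiseAnalytic E α₂.extend) :
      IsRetracing (β.trans (β.symm.trans α₂)) α₂
  | finish {r : M} (α₁ : Path p p) (β : Path p r)
      (h₁ : PiecewiseAnalytic E α₁.extend) (hβ : PiecewiseAnalytic E β.extend) :
      IsRetracing (α₁.trans (β.trans β.symm)) α₁
  | whole {r : M} (β : Path p r) (hβ : PiecewiseAnalytic E β.extend) :
      IsRetracing (β.trans β.symm) (Path.refl p)

/-- Retrace equivalence: related by a finite chain of retracings, generalized reparametrizations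
and their inverse operations, through piecewise-analytic based loops. -/
def RetraceEquivalent {p : M} (γ₀ γ₁ : PALoop E p) : Prop :=
  Relation.EqvGen (fun γ' γ : PALoop E p => IsReparametrizationOf γ' γ ∨ IsRetracing E γ'.1 γ.1)
    γ₀ γ₁

end

end ThinLoops

/-! Retracings and reparametrizations are realized by explicit thin homotopies. A retraced spur is
pulled in from its tip, and a reparametrization is deformed to the identity. The difficulty is that
the homotopy must be analytic on polygons: interpolating linearly between φ and the identity would
break along the curves where the interpolation meets a break of the loop. So φ is made affine on one
short interval at a time, where loop and φ are both analytic and no break is met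
(`thinHomotopic_straighten`). Adjacent affine pieces are then merged by a homotopy whose parameter
is piecewise affine in both variables (`thinHomotopic_straighten_straighten`).

For the converse, paths modulo retracing form a groupoid (`RetraceGroupoid`): two paths are
identified when they may be exchanged inside every loop at `p`. In it, a path of the form f ∘ ψ,
with ψ a path in the real line, depends only on f and the end points of ψ (`pathClass_map_eq`):
prolong ψ at both ends until it becomes a reparametrization of one long segment, and cancel the
additions. This says that an arc behaves like a tree.

Thinness confines the homotopy to the union of two piecewise-analytic curves. Near a point q this
union is contained in a star (`exists_isStar`): finitely many analytic arcs issuing from q, all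
parametrized by the same power of the squared distance to q in a chart. A point away from q then
determines its parameter, and by the identity theorem two arcs coincide or meet only in q. A
one-sided analytic germ inside a star runs along a single arc, after a substitution u = w^K that
makes its arc parameter an analytic function of w. Hence any path inside a star has the class of the
radial path to its start, reversed, followed by the radial path to its end (`IsStar.pathClass_eq`);
in particular its class depends only on its end points.

A Lebesgue number cuts the square into small rectangles, each mapped into one star, so the two ways
round each small rectangle have the same class. Pasting gives the same for the whole square. Its
sides s = 0 and s = 1 are the two loops, and its other sides are constant at `p`, so the two loops
have the same class, which for loops is retrace equivalence (`PathRel.loopRel`).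

One-sided analyticity at every point of the line (`OneSidedAnalytic`) replaces subdivisions
throughout: it is a local condition, stable under composition, and by compactness equivalent to
piecewise analyticity of paths. -/

namespace ThinLoops

open Set Filter Topology

/-! ### One-sided analytic curves -/

section OneSided

variable {E : Type*} [NormedAddCommGroup E] [NormedSpace ℝ E]
  {M : Type*} [TopologicalSpace M] [ChartedSpace E M]

variable (E) in
/-- `f : ℝ → M` is real-analytic from both sides at every point, the two one-sided germs at a
point being unrelated except for their common value. -/
def OneSidedAnalytic (f : ℝ → M) : Prop :=
  ∀ t, ContMDiffWithinAt 𝓘(ℝ, ℝ) 𝓘(ℝ, E) ω f (Ici t) t ∧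
    ContMDiffWithinAt 𝓘(ℝ, ℝ) 𝓘(ℝ, E) ω f (Iic t) t

theorem OneSidedAnalytic.continuous {f : ℝ → M} (hf : OneSidedAnalytic E f) : Continuous f :=
  continuous_iff_continuousAt.2 fun t => continuousAt_iff_continuous_left_right.2
    ⟨(hf t).2.continuousWithinAt, (hf t).1.continuousWithinAt⟩

theorem _root_.ContMDiff.oneSidedAnalytic {f : ℝ → M} (hf : ContMDiff 𝓘(ℝ, ℝ) 𝓘(ℝ, E) ω f) :
    OneSidedAnalytic E f :=
  fun t => ⟨(hf t).contMDiffWithinAt, (hf t).contMDiffWithinAt⟩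

theorem _root_.ContDiff.oneSidedAnalytic {f : ℝ → E} (hf : ContDiff ℝ ω f) :
    OneSidedAnalytic E f :=
  hf.contMDiff.oneSidedAnalytic

theorem oneSidedAnalytic_const (x : M) : OneSidedAnalytic E fun _ => x :=
  contMDiff_const.oneSidedAnalytic

theorem oneSidedAnalytic_id : OneSidedAnalytic ℝ fun t : ℝ => t :=
  contDiff_id.oneSidedAnalytic

/-- A one-sided analytic function at `t` is the restriction of an analytic one. -/
theorem exists_analyticAt_of_contMDiffWithinAt [CompleteSpace E] {f : ℝ → E} {s : Set ℝ} {t : ℝ}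
    (hts : t ∈ s) (hf : ContMDiffWithinAt 𝓘(ℝ, ℝ) 𝓘(ℝ, E) ω f s t) :
    ∃ g : ℝ → E, AnalyticAt ℝ g t ∧ f =ᶠ[𝓝[s] t] g := by
  rw [contMDiffWithinAt_iff_contDiffWithinAt, contDiffWithinAt_omega_iff_analyticWithinAt,
    analyticWithinAt_iff_exists_analyticAt, insert_eq_of_mem hts] at hf
  obtain ⟨g, hg, hga⟩ := hf
  exact ⟨g, hga, hg⟩

theorem _root_.AnalyticAt.contMDiffWithinAt [CompleteSpace E] {f g : ℝ → E} {s : Set ℝ} {t : ℝ}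
    (hg : AnalyticAt ℝ g t) (hts : t ∈ s) (h : f =ᶠ[𝓝[s] t] g) :
    ContMDiffWithinAt 𝓘(ℝ, ℝ) 𝓘(ℝ, E) ω f s t :=
  (hg.contDiffAt.contMDiffAt.contMDiffWithinAt).congr_of_eventuallyEq h (h.eq_of_nhdsWithin hts)

/-- An analytic function does not change sign on one side of a point. -/
theorem _root_.AnalyticAt.eventually_nonneg_or_nonpos {g : ℝ → ℝ} {t : ℝ}
    (hg : AnalyticAt ℝ g t) :
    ((∀ᶠ u in 𝓝[≥] t, g t ≤ g u) ∨ ∀ᶠ u in 𝓝[≥] t, g u ≤ g t) ∧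
    ((∀ᶠ u in 𝓝[≤] t, g t ≤ g u) ∨ ∀ᶠ u in 𝓝[≤] t, g u ≤ g t) := by
  have hsub : AnalyticAt ℝ (fun u => g u - g t) t := hg.sub analyticAt_const
  by_cases h0 : ∀ᶠ u in 𝓝 t, g u - g t = 0
  · exact ⟨.inl <| (h0.filter_mono nhdsWithin_le_nhds).mono fun u hu => by linarith,
      .inl <| (h0.filter_mono nhdsWithin_le_nhds).mono fun u hu => by linarith⟩
  -- If g - g(t) is not locally zero, it is (u - t)^n k(u) with k of constant sign near t. On the
  -- right the power is nonnegative; on the left its sign depends on the parity of n.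
  · obtain ⟨n, k, hk, hk0, hgk⟩ := hsub.exists_eventuallyEq_pow_smul_nonzero_iff.2 h0
    rcases lt_or_gt_of_ne hk0 with hneg | hpos
    · have hk' : ∀ᶠ u in 𝓝 t, k u < 0 := hk.continuousAt.eventually_lt_const hneg
      constructor
      · right
        filter_upwards [(hgk.and hk').filter_mono nhdsWithin_le_nhds, self_mem_nhdsWithin]
          with u hu (hut : t ≤ u)
        have : 0 ≤ (u - t) ^ n := pow_nonneg (by linarith) n
        have h1 := hu.1
        rw [smul_eq_mul] at h1
        nlinarith [hu.2]
      · rcases Nat.even_or_odd n with hn | hn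
        · right
          filter_upwards [(hgk.and hk').filter_mono nhdsWithin_le_nhds] with u hu
          have : 0 ≤ (u - t) ^ n := hn.pow_nonneg _
          have h1 := hu.1
          rw [smul_eq_mul] at h1
          nlinarith [hu.2]
        · left
          filter_upwards [(hgk.and hk').filter_mono nhdsWithin_le_nhds, self_mem_nhdsWithin]
            with u hu (hut : u ≤ t)
          have : (u - t) ^ n ≤ 0 := hn.pow_nonpos (by linarith)
          have h1 := hu.1
          rw [smul_eq_mul] at h1
          nlinarith [hu.2]
    · have hk' : ∀ᶠ u in 𝓝 t, 0 < k u := hk.continuousAt.eventually_const_lt hpos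
      constructor
      · left
        filter_upwards [(hgk.and hk').filter_mono nhdsWithin_le_nhds, self_mem_nhdsWithin]
          with u hu (hut : t ≤ u)
        have : 0 ≤ (u - t) ^ n := pow_nonneg (by linarith) n
        have h1 := hu.1
        rw [smul_eq_mul] at h1
        nlinarith [hu.2]
      · rcases Nat.even_or_odd n with hn | hn
        · left
          filter_upwards [(hgk.and hk').filter_mono nhdsWithin_le_nhds] with u hu
          have : 0 ≤ (u - t) ^ n := hn.pow_nonneg _
          have h1 := hu.1
          rw [smul_eq_mul] at h1
          nlinarith [hu.2]
        · right
          filter_upwards [(hgk.and hk').filter_mono nhdsWithin_le_nhds, self_mem_nhdsWithin]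
            with u hu (hut : u ≤ t)
          have : (u - t) ^ n ≤ 0 := hn.pow_nonpos (by linarith)
          have h1 := hu.1
          rw [smul_eq_mul] at h1
          nlinarith [hu.2]

theorem OneSidedAnalytic.eventually_le_or_ge {φ : ℝ → ℝ} (hφ : OneSidedAnalytic ℝ φ) (t : ℝ) :
    ((∀ᶠ u in 𝓝[≥] t, φ t ≤ φ u) ∨ ∀ᶠ u in 𝓝[≥] t, φ u ≤ φ t) ∧
    ((∀ᶠ u in 𝓝[≤] t, φ t ≤ φ u) ∨ ∀ᶠ u in 𝓝[≤] t, φ u ≤ φ t) := by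
  obtain ⟨g, hg, hgφ⟩ := exists_analyticAt_of_contMDiffWithinAt self_mem_Ici (hφ t).1
  obtain ⟨g', hg', hgφ'⟩ := exists_analyticAt_of_contMDiffWithinAt self_mem_Iic (hφ t).2
  have e := hgφ.eq_of_nhdsWithin self_mem_Ici
  have e' := hgφ'.eq_of_nhdsWithin self_mem_Iic
  constructor
  · refine hg.eventually_nonneg_or_nonpos.1.imp (fun h => ?_) fun h => ?_ <;>
    · filter_upwards [h, hgφ] with u h1 h2
      rwa [h2, e]
  · refine hg'.eventually_nonneg_or_nonpos.2.imp (fun h => ?_) fun h => ?_ <;>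
    · filter_upwards [h, hgφ'] with u h1 h2
      rwa [h2, e']

theorem _root_.ContMDiffWithinAt.comp_of_eventually {f : ℝ → M} {φ : ℝ → ℝ} {s u : Set ℝ} {t : ℝ}
    (hf : ContMDiffWithinAt 𝓘(ℝ, ℝ) 𝓘(ℝ, E) ω f u (φ t))
    (hφ : ContMDiffWithinAt 𝓘(ℝ, ℝ) 𝓘(ℝ, ℝ) ω φ s t) (h : ∀ᶠ x in 𝓝[s] t, φ x ∈ u) :
    ContMDiffWithinAt 𝓘(ℝ, ℝ) 𝓘(ℝ, E) ω (fun x => f (φ x)) s t :=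
  (ContMDiffWithinAt.comp t hf (hφ.mono (inter_subset_left (t := φ ⁻¹' u)))
    inter_subset_right).mono_of_mem_nhdsWithin (inter_mem self_mem_nhdsWithin h)

/-- On each side of t the values of φ stay on one side of φ t, so only one of the two germs of f at
φ t is used. For merely smooth φ, oscillation around φ t would destroy this. -/
theorem OneSidedAnalytic.comp {f : ℝ → M} {φ : ℝ → ℝ} (hf : OneSidedAnalytic E f)
    (hφ : OneSidedAnalytic ℝ φ) : OneSidedAnalytic E fun t => f (φ t) := by
  intro t
  constructor
  · rcases (hφ.eventually_le_or_ge t).1 with h | h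
    · exact (hf (φ t)).1.comp_of_eventually (hφ t).1 h
    · exact (hf (φ t)).2.comp_of_eventually (hφ t).1 h
  · rcases (hφ.eventually_le_or_ge t).2 with h | h
    · exact (hf (φ t)).1.comp_of_eventually (hφ t).2 h
    · exact (hf (φ t)).2.comp_of_eventually (hφ t).2 h

theorem OneSidedAnalytic.add {f g : ℝ → ℝ} (hf : OneSidedAnalytic ℝ f)
    (hg : OneSidedAnalytic ℝ g) : OneSidedAnalytic ℝ fun t => f t + g t :=
  fun t => ⟨(hf t).1.add (hg t).1, (hf t).2.add (hg t).2⟩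

theorem OneSidedAnalytic.sub {f g : ℝ → ℝ} (hf : OneSidedAnalytic ℝ f)
    (hg : OneSidedAnalytic ℝ g) : OneSidedAnalytic ℝ fun t => f t - g t :=
  fun t => ⟨(hf t).1.sub (hg t).1, (hf t).2.sub (hg t).2⟩

theorem OneSidedAnalytic.mul {f g : ℝ → ℝ} (hf : OneSidedAnalytic ℝ f)
    (hg : OneSidedAnalytic ℝ g) : OneSidedAnalytic ℝ fun t => f t * g t :=
  fun t => ⟨(hf t).1.mul (hg t).1, (hf t).2.mul (hg t).2⟩

theorem OneSidedAnalytic.if_le {f g : ℝ → M} {c : ℝ} (hf : OneSidedAnalytic E f)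
    (hg : OneSidedAnalytic E g) (h : f c = g c) :
    OneSidedAnalytic E fun t => if t ≤ c then f t else g t := by
  have hle : ∀ t, t ≤ c → (if t ≤ c then f t else g t) = f t := fun t ht => if_pos ht
  have hge : ∀ t, c ≤ t → (if t ≤ c then f t else g t) = g t := fun t ht => by
    rcases ht.eq_or_lt with rfl | ht
    · rw [if_pos le_rfl, h]
    · rw [if_neg (not_le.2 ht)]
  intro t
  constructor
  · rcases lt_or_ge t c with ht | ht
    · exact (hf t).1.congr_of_eventuallyEq
        (((eventually_le_nhds ht).filter_mono nhdsWithin_le_nhds).mono hle) (hle t ht.le)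
    · exact (hg t).1.congr (fun u hu => hge u (ht.trans hu)) (hge t ht)
  · rcases lt_or_ge c t with ht | ht
    · exact (hg t).2.congr_of_eventuallyEq
        (((eventually_ge_nhds ht).filter_mono nhdsWithin_le_nhds).mono hge) (hge t ht.le)
    · exact (hf t).2.congr (fun u hu => hle u (le_trans hu ht)) (hle t ht)

theorem oneSidedAnalytic_const_mul (c : ℝ) : OneSidedAnalytic ℝ fun t : ℝ => c * t :=
  (oneSidedAnalytic_const c).mul oneSidedAnalytic_id

/-- The absolute value yields maxima and minima, hence the clamps, tents and hinges from which all
later homotopies and reparametrizations are built. -/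
theorem oneSidedAnalytic_abs : OneSidedAnalytic ℝ fun t : ℝ => |t| := by
  have := (oneSidedAnalytic_const_mul (-1)).if_le (c := 0) oneSidedAnalytic_id (by simp)
  convert this using 2 with t
  split_ifs with h
  · rw [abs_of_nonpos h]; ring
  · rw [abs_of_pos (not_le.1 h)]

theorem OneSidedAnalytic.max {f g : ℝ → ℝ} (hf : OneSidedAnalytic ℝ f)
    (hg : OneSidedAnalytic ℝ g) : OneSidedAnalytic ℝ fun t => Max.max (f t) (g t) := by
  have := ((oneSidedAnalytic_const (E := ℝ) (2⁻¹ : ℝ)).mul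
    ((hf.add hg).add (oneSidedAnalytic_abs.comp (hf.sub hg))))
  convert this using 2 with t
  rcases le_total (f t) (g t) with h | h
  · rw [max_eq_right h, abs_of_nonpos (by linarith)]; ring
  · rw [max_eq_left h, abs_of_nonneg (by linarith)]; ring

theorem OneSidedAnalytic.min {f g : ℝ → ℝ} (hf : OneSidedAnalytic ℝ f)
    (hg : OneSidedAnalytic ℝ g) : OneSidedAnalytic ℝ fun t => Min.min (f t) (g t) := by
  have := (hf.add hg).sub (hf.max hg)
  convert this using 2 with t
  linarith [min_add_max (f t) (g t)]

/-- The retraction of the line onto `[0,1]`. -/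
def clamp (t : ℝ) : ℝ := Max.max 0 (Min.min 1 t)

theorem clamp_eq_projIcc (t : ℝ) : clamp t = (projIcc 0 1 zero_le_one t : ℝ) := rfl

theorem oneSidedAnalytic_clamp : OneSidedAnalytic ℝ clamp :=
  (oneSidedAnalytic_const 0).max ((oneSidedAnalytic_const 1).min oneSidedAnalytic_id)

theorem clamp_mem (t : ℝ) : clamp t ∈ Icc (0 : ℝ) 1 :=
  ⟨le_max_left _ _, max_le zero_le_one (min_le_left _ _)⟩

theorem extend_clamp {X : Type*} [TopologicalSpace X] {x y : X} (γ : Path x y) (t : ℝ) :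
    γ.extend (clamp t) = γ.extend t := by
  rw [clamp_eq_projIcc, Path.extend_extends']; rfl

end OneSided

end ThinLoops

/-! ### Interval induction, and the passage between piecewise and one-sided analyticity -/

namespace ThinLoops

open Set Filter Topology

/-- A relation between the end points of intervals that is additive and holds for all short
intervals ending at a given point holds for every interval. -/
theorem interval_induction {P : ℝ → ℝ → Prop} {a b : ℝ} (hab : a ≤ b) (refl : P a a)
    (trans : ∀ x y z, a ≤ x → x ≤ y → y ≤ z → z ≤ b → P x y → P y z → P x z)
    (right : ∀ x ∈ Ico a b, ∀ᶠ y in 𝓝[>] x, P x y)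
    (left : ∀ x ∈ Ioc a b, ∀ᶠ y in 𝓝[<] x, P y x) : P a b := by
  set s : Set ℝ := {x | x ∈ Icc a b ∧ P a x} with hs
  have has : a ∈ s := ⟨⟨le_rfl, hab⟩, refl⟩
  have hbdd : BddAbove s := ⟨b, fun x hx => hx.1.2⟩
  -- The supremum c of the points reached from a is itself reached, by `left`; it cannot lie below
  -- b, by `right`.
  set c := sSup s with hc
  have hac : a ≤ c := le_csSup hbdd has
  have hcb : c ≤ b := csSup_le ⟨a, has⟩ fun x hx => hx.1.2
  have hcs : P a c := by
    rcases hac.eq_or_lt with h | h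
    · rwa [← h]
    · obtain ⟨l, hl, hlP⟩ := mem_nhdsLT_iff_exists_Ioo_subset.1 (left c ⟨h, hcb⟩)
      obtain ⟨y, hy, hly⟩ := exists_lt_of_lt_csSup ⟨a, has⟩ (show l < sSup s from hl)
      rcases (le_csSup hbdd hy).eq_or_lt with h' | h'
      · rw [hc, ← h']; exact hy.2
      · exact trans a y c le_rfl hy.1.1 h'.le hcb hy.2 (hlP ⟨hly, h'⟩)
  rcases hcb.eq_or_lt with h | h
  · rwa [← h]
  · obtain ⟨y, hy, hyP⟩ := ((Ioo_mem_nhdsGT h |> Filter.Eventually.and (right c ⟨hac, h⟩)).exists)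
    exact absurd (le_csSup hbdd ⟨⟨hac.trans hyP.1.le, hyP.2.le⟩,
      trans a c y le_rfl hac hyP.1.le hyP.2.le hcs hy⟩) (not_le.2 hyP.1)

section

variable {E : Type*} [NormedAddCommGroup E] [NormedSpace ℝ E]
  {M : Type*} [TopologicalSpace M] [ChartedSpace E M]

theorem exists_mem_Ico_of_subdivision {r : ℕ} {t : Fin (r + 1) → ℝ} {x : ℝ} (h0 : t 0 ≤ x)
    (h1 : x < t (Fin.last r)) : ∃ i : Fin r, t i.castSucc ≤ x ∧ x < t i.succ := by
  by_contra! h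
  exact h1.not_ge ((fun i => Fin.induction h0 h i : ∀ i, t i ≤ x) _)

theorem exists_mem_Ioc_of_subdivision {r : ℕ} {t : Fin (r + 1) → ℝ} {x : ℝ} (h0 : t 0 < x)
    (h1 : x ≤ t (Fin.last r)) : ∃ i : Fin r, t i.castSucc < x ∧ x ≤ t i.succ := by
  by_contra! h
  exact h1.not_gt ((fun i => Fin.induction h0 h i : ∀ i, t i < x) _)

/-- Each side of an interior point lies in some closed piece. Outside `[0,1]` the extension is
constant, which supplies the outer germs at 0 and 1. -/
theorem PiecewiseAnalytic.oneSidedAnalytic {x y : M} {γ : Path x y}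
    (h : PiecewiseAnalytic E γ.extend) : OneSidedAnalytic E γ.extend := by
  obtain ⟨r, t, -, ht0, ht1, hf⟩ := h
  intro u
  constructor
  · rcases lt_or_ge u 0 with hu | hu
    · exact contMDiffWithinAt_const.congr_of_eventuallyEq
        (((eventually_le_nhds hu).filter_mono nhdsWithin_le_nhds).mono
          fun v hv => γ.extend_of_le_zero hv) (γ.extend_of_le_zero hu.le)
    rcases le_or_gt 1 u with hu1 | hu1
    · exact contMDiffWithinAt_const.congr (fun v hv => γ.extend_of_one_le (hu1.trans hv))
        (γ.extend_of_one_le hu1)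
    obtain ⟨i, hi, hi'⟩ := exists_mem_Ico_of_subdivision (ht0.le.trans hu) (hu1.trans_eq ht1.symm)
    exact (hf i u ⟨hi, hi'.le⟩).mono_of_mem_nhdsWithin (mem_of_superset (Icc_mem_nhdsGE hi')
      (Icc_subset_Icc_left hi))
  · rcases le_or_gt u 0 with hu | hu
    · exact contMDiffWithinAt_const.congr (fun v hv => γ.extend_of_le_zero (le_trans hv hu))
        (γ.extend_of_le_zero hu)
    rcases lt_or_ge 1 u with hu1 | hu1
    · exact contMDiffWithinAt_const.congr_of_eventuallyEq
        (((eventually_ge_nhds hu1).filter_mono nhdsWithin_le_nhds).mono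
          fun v hv => γ.extend_of_one_le hv) (γ.extend_of_one_le hu1.le)
    obtain ⟨i, hi, hi'⟩ := exists_mem_Ioc_of_subdivision (ht0.trans_lt hu) (hu1.trans_eq ht1.symm)
    exact (hf i u ⟨hi.le, hi'⟩).mono_of_mem_nhdsWithin (mem_of_superset (Icc_mem_nhdsLE hi)
      (Icc_subset_Icc_right hi'))

/-- A one-sided convergent power series at x makes f analytic in the two-sided sense at nearby
points on that side, so breaks are isolated. -/
theorem OneSidedAnalytic.eventually_contMDiffAt [IsManifold 𝓘(ℝ, E) ω M] {f : ℝ → M}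
    (hf : OneSidedAnalytic E f) (x : ℝ) :
    ∀ᶠ y in 𝓝[≠] x, ContMDiffAt 𝓘(ℝ, ℝ) 𝓘(ℝ, E) ω f y := by
  rw [← Iio_union_Ioi, nhdsWithin_union, eventually_sup]
  constructor
  · have := (contMDiffWithinAt_iff_contMDiffWithinAt_nhdsWithin (by simp)).1 (hf x).2
    rw [insert_eq_of_mem self_mem_Iic] at this
    filter_upwards [this.filter_mono (nhdsWithin_mono _ Iio_subset_Iic_self), self_mem_nhdsWithin]
      with y hy hyx
    exact hy.contMDiffAt (Iic_mem_nhds hyx)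
  · have := (contMDiffWithinAt_iff_contMDiffWithinAt_nhdsWithin (by simp)).1 (hf x).1
    rw [insert_eq_of_mem self_mem_Ici] at this
    filter_upwards [this.filter_mono (nhdsWithin_mono _ Ioi_subset_Ici_self), self_mem_nhdsWithin]
      with y hy hyx
    exact hy.contMDiffAt (Ici_mem_nhds hyx)

theorem OneSidedAnalytic.finite_not_contMDiffAt [IsManifold 𝓘(ℝ, E) ω M] {f : ℝ → M}
    (hf : OneSidedAnalytic E f) (a b : ℝ) :
    (Icc a b ∩ {x | ¬ ContMDiffAt 𝓘(ℝ, ℝ) 𝓘(ℝ, E) ω f x}).Finite := by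
  refine isCompact_Icc.induction_on
    (p := fun s => (s ∩ {x | ¬ ContMDiffAt 𝓘(ℝ, ℝ) 𝓘(ℝ, E) ω f x}).Finite) (by simp)
    (fun s t hst ht => ht.subset (inter_subset_inter_left _ hst))
    (fun s t hs ht => by rw [union_inter_distrib_right]; exact hs.union ht) fun x _ => ?_
  have := hf.eventually_contMDiffAt x
  rw [eventually_nhdsWithin_iff] at this
  refine ⟨_, mem_nhdsWithin_of_mem_nhds this, (finite_singleton x).subset fun y hy => ?_⟩
  by_contra hyx
  exact hy.2 (hy.1 hyx)

/-- One-sided analyticity gives a subdivision into finitely many analytic pieces. -/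
theorem OneSidedAnalytic.piecewiseAnalytic [IsManifold 𝓘(ℝ, E) ω M] {f : ℝ → M}
    (hf : OneSidedAnalytic E f) : PiecewiseAnalytic E f := by
  classical
  set S : Finset ℝ := insert 0 (insert 1 (hf.finite_not_contMDiffAt 0 1).toFinset) with hS
  have hS01 : ∀ x ∈ S, x ∈ Icc (0 : ℝ) 1 := by
    intro x hx
    simp only [hS, Finset.mem_insert, Finite.mem_toFinset] at hx
    rcases hx with rfl | rfl | hx
    · simp
    · simp
    · exact hx.1
  have h0 : (0 : ℝ) ∈ S := by simp [hS]
  have h1 : (1 : ℝ) ∈ S := by simp [hS]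
  have hcard : 0 < S.card := Finset.card_pos.2 ⟨0, h0⟩
  obtain ⟨r, hr⟩ : ∃ r, S.card = r + 1 := ⟨S.card - 1, by omega⟩
  refine ⟨r, S.orderEmbOfFin hr, (S.orderEmbOfFin hr).strictMono, ?_, ?_, ?_⟩
  · have := S.orderEmbOfFin_zero hr (Nat.succ_pos r)
    refine this.trans (le_antisymm (Finset.min'_le _ _ h0) ?_)
    exact (hS01 _ (Finset.min'_mem _ _)).1
  · have := S.orderEmbOfFin_last hr (Nat.succ_pos r)
    refine this.trans (le_antisymm ?_ (Finset.le_max' _ _ h1))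
    exact (hS01 _ (Finset.max'_mem _ _)).2
  · intro i x hx
    -- The subdivision consists of 0, 1 and the breaks in increasing order. A point of `S` in a
    -- closed piece is one of its two ends, where the one-sided germ suffices; any other point of
    -- the piece is no break.
    by_cases hxS : x ∈ S
    · obtain ⟨j, rfl⟩ : x ∈ range (S.orderEmbOfFin hr) := by
        rw [Finset.range_orderEmbOfFin]; exact hxS
      have hj1 := (S.orderEmbOfFin hr).le_iff_le.1 hx.1
      have hj2 := (S.orderEmbOfFin hr).le_iff_le.1 hx.2
      rcases hj1.eq_or_lt with h | h
      · rw [← h]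
        exact (hf _).1.mono Icc_subset_Ici_self
      · have : j = i.succ := le_antisymm hj2 (Fin.castSucc_lt_iff_succ_le.1 h)
        rw [this]
        exact (hf _).2.mono Icc_subset_Iic_self
    · have hx01 : x ∈ Icc (0 : ℝ) 1 :=
        ⟨(hS01 _ (S.orderEmbOfFin_mem hr _)).1.trans hx.1,
          hx.2.trans (hS01 _ (S.orderEmbOfFin_mem hr _)).2⟩
      by_contra hcon
      refine hxS ?_
      simp only [hS, Finset.mem_insert, Finite.mem_toFinset]
      exact .inr (.inr ⟨hx01, fun h => hcon h.contMDiffWithinAt⟩)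

theorem extend_trans {X : Type*} [TopologicalSpace X] {x y z : X} (α : Path x y) (β : Path y z)
    (t : ℝ) : (α.trans β).extend t =
      if t ≤ 1 / 2 then α.extend (2 * t) else β.extend (2 * t - 1) := by
  split_ifs with h
  · exact α.extend_trans_of_le_half β h
  · exact α.extend_trans_of_half_le β (not_le.1 h).le

theorem oneSidedAnalytic_affine (a b : ℝ) : OneSidedAnalytic ℝ fun t : ℝ => a * t + b :=
  (oneSidedAnalytic_const_mul a).add (oneSidedAnalytic_const b)

theorem OneSidedAnalytic.trans {x y z : M} {α : Path x y} {β : Path y z}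
    (hα : OneSidedAnalytic E α.extend) (hβ : OneSidedAnalytic E β.extend) :
    OneSidedAnalytic E (α.trans β).extend := by
  have : ⇑(α.trans β).extend =
      fun t => if t ≤ 1 / 2 then α.extend (2 * t) else β.extend (2 * t + (-1)) :=
    funext fun t => extend_trans α β t
  rw [this]
  exact (hα.comp (oneSidedAnalytic_const_mul 2)).if_le (hβ.comp (oneSidedAnalytic_affine 2 (-1)))
    (by norm_num)

theorem OneSidedAnalytic.symm {x y : M} {α : Path x y} (hα : OneSidedAnalytic E α.extend) :
    OneSidedAnalytic E α.symm.extend := by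
  have : ⇑α.symm.extend = fun t => α.extend ((-1) * t + 1) :=
    funext fun t => by rw [α.extend_symm_apply]; congr 1; ring
  rw [this]
  exact hα.comp (oneSidedAnalytic_affine (-1) 1)

theorem oneSidedAnalytic_refl (x : M) : OneSidedAnalytic E (Path.refl x).extend := by
  rw [Path.refl_extend]; exact oneSidedAnalytic_const x

theorem path_ext_of_extend {X : Type*} [TopologicalSpace X] {x y : X} {α β : Path x y}
    (h : ∀ t ∈ Icc (0 : ℝ) 1, α.extend t = β.extend t) : α = β := by
  refine Path.ext (funext fun t => ?_)
  rw [← α.extend_extends', ← β.extend_extends']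
  exact h t t.2

/-- The extension of a path is constant outside `[0,1]`, so it is f precomposed with the clamp; a
formula for γ is therefore needed on `[0,1]` only. -/
theorem oneSidedAnalytic_extend {f : ℝ → M} (hf : OneSidedAnalytic E f) {x y : M} {γ : Path x y}
    (h : ∀ t ∈ Icc (0 : ℝ) 1, γ.extend t = f t) : OneSidedAnalytic E γ.extend := by
  have : ⇑γ.extend = fun t => f (clamp t) :=
    funext fun t => by rw [← extend_clamp, h _ (clamp_mem t)]
  rw [this]
  exact hf.comp oneSidedAnalytic_clamp

end

end ThinLoops

/-! ### Maps that are analytic on polygons -/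

namespace ThinLoops

open Set Filter Topology

/-- The intersection of the half-planes `a * x + b * y ≤ c` for `(a, b, c) ∈ S`. -/
def halfPlanes (S : Finset (ℝ × ℝ × ℝ)) : Set (ℝ × ℝ) :=
  {x | ∀ c ∈ S, c.1 * x.1 + c.2.1 * x.2 ≤ c.2.2}

/-- The closed unit square. -/
def square : Set (ℝ × ℝ) := Icc (0 : ℝ) 1 ×ˢ Icc (0 : ℝ) 1

theorem halfPlanes_empty : halfPlanes ∅ = univ := by simp [halfPlanes]

theorem halfPlanes_union [DecidableEq (ℝ × ℝ × ℝ)] (S T : Finset (ℝ × ℝ × ℝ)) :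
    halfPlanes (S ∪ T) = halfPlanes S ∩ halfPlanes T := by
  ext x
  simp only [halfPlanes, Finset.mem_union, mem_ofPred_eq, mem_inter_iff]
  exact ⟨fun h => ⟨fun c hc => h c (.inl hc), fun c hc => h c (.inr hc)⟩,
    fun h c hc => hc.elim (h.1 c) (h.2 c)⟩

theorem isClosed_halfPlanes (S : Finset (ℝ × ℝ × ℝ)) : IsClosed (halfPlanes S) := by
  simp only [halfPlanes, ofPred_forall]
  exact isClosed_biInter fun c _ => isClosed_le (by fun_prop) (by fun_prop)

theorem isCompact_square : IsCompact square := isCompact_Icc.prod isCompact_Icc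

theorem square_eq_halfPlanes : square =
    halfPlanes {((-1 : ℝ), (0 : ℝ), (0 : ℝ)), (1, 0, 1), (0, -1, 0), (0, 1, 1)} := by
  ext x
  simp only [square, halfPlanes, mem_prod, mem_Icc, Finset.mem_insert, Finset.mem_singleton,
    mem_ofPred_eq, forall_eq_or_imp, forall_eq]
  constructor
  · rintro ⟨⟨h1, h2⟩, h3, h4⟩
    exact ⟨by linarith, by linarith, by linarith, by linarith⟩
  · rintro ⟨h1, h2, h3, h4⟩
    exact ⟨⟨by linarith, by linarith⟩, by linarith, by linarith⟩

section

variable (E : Type*) [NormedAddCommGroup E] [NormedSpace ℝ E]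
  {M : Type*} [TopologicalSpace M] [ChartedSpace E M]

/-- `H` is analytic on each piece of a decomposition of `A` by finitely many polygons. -/
def PolyAnalyticOn (H : ℝ × ℝ → M) (A : Set (ℝ × ℝ)) : Prop :=
  ∃ F : Finset (Finset (ℝ × ℝ × ℝ)), A ⊆ ⋃ S ∈ F, halfPlanes S ∧
    ∀ S ∈ F, ContMDiffOn 𝓘(ℝ, ℝ × ℝ) 𝓘(ℝ, E) ω H (A ∩ halfPlanes S)

variable {E}

theorem PolyAnalyticOn.of_contMDiffOn {H : ℝ × ℝ → M} {A : Set (ℝ × ℝ)}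
    (h : ContMDiffOn 𝓘(ℝ, ℝ × ℝ) 𝓘(ℝ, E) ω H A) : PolyAnalyticOn E H A :=
  ⟨{∅}, by simp [halfPlanes_empty], by simpa [halfPlanes_empty] using h⟩

/-- The pieces of `PolyAnalyticOn` may overlap and `A` is arbitrary, so it is enough to add the new
half-plane, or its opposite, to every polygon on its side. Homotopies can thus be checked by
successive cuts along lines. -/
theorem PolyAnalyticOn.split {H : ℝ × ℝ → M} {A : Set (ℝ × ℝ)} (a b c : ℝ)
    (h₁ : PolyAnalyticOn E H (A ∩ {x | a * x.1 + b * x.2 ≤ c}))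
    (h₂ : PolyAnalyticOn E H (A ∩ {x | c ≤ a * x.1 + b * x.2})) : PolyAnalyticOn E H A := by
  classical
  obtain ⟨F₁, hA₁, hF₁⟩ := h₁
  obtain ⟨F₂, hA₂, hF₂⟩ := h₂
  have e₁ : halfPlanes {(a, b, c)} = {x | a * x.1 + b * x.2 ≤ c} := by simp [halfPlanes]
  have e₂ : halfPlanes {(-a, -b, -c)} = {x | c ≤ a * x.1 + b * x.2} := by
    ext x
    simp only [halfPlanes, Finset.mem_singleton, forall_eq, mem_ofPred_eq]
    constructor <;> intro h <;> linarith
  refine ⟨F₁.image (fun S => {(a, b, c)} ∪ S) ∪ F₂.image (fun S => {(-a, -b, -c)} ∪ S), ?_, ?_⟩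
  · intro x hx
    rcases le_total (a * x.1 + b * x.2) c with h | h
    · obtain ⟨S, hS, hxS⟩ := mem_iUnion₂.1 (hA₁ ⟨hx, h⟩)
      refine mem_iUnion₂.2 ⟨_, Finset.mem_union_left _ (Finset.mem_image_of_mem _ hS), ?_⟩
      rw [halfPlanes_union, e₁]
      exact ⟨h, hxS⟩
    · obtain ⟨S, hS, hxS⟩ := mem_iUnion₂.1 (hA₂ ⟨hx, h⟩)
      refine mem_iUnion₂.2 ⟨_, Finset.mem_union_right _ (Finset.mem_image_of_mem _ hS), ?_⟩
      rw [halfPlanes_union, e₂]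
      exact ⟨h, hxS⟩
  · intro S hS
    rcases Finset.mem_union.1 hS with hS | hS <;> obtain ⟨T, hT, rfl⟩ := Finset.mem_image.1 hS
    · rw [halfPlanes_union, e₁, ← inter_assoc]
      exact hF₁ T hT
    · rw [halfPlanes_union, e₂, ← inter_assoc]
      exact hF₂ T hT

/-- A path composed with an affine function is analytic on polygons. -/
theorem PolyAnalyticOn.of_affine [IsManifold 𝓘(ℝ, E) ω M] {H : ℝ × ℝ → M} {f : ℝ → M}
    (hf : OneSidedAnalytic E f) (a b d : ℝ) {A : Set (ℝ × ℝ)} (hA : A ⊆ square)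
    (hH : ∀ x ∈ A, H x = f (a * x.1 + b * x.2 + d)) : PolyAnalyticOn E H A := by
  classical
  set h : ℝ × ℝ → ℝ := fun x => a * x.1 + b * x.2 + d with hh
  have hhs : ContMDiff 𝓘(ℝ, ℝ × ℝ) 𝓘(ℝ, ℝ) ω h :=
    (show ContDiff ℝ ω h by fun_prop).contMDiff
  -- `B` contains every break of f whose level line of `h` may still cross `A`. Each induction step
  -- cuts along one of these lines; once none is left, `A` lies on one side of each break, and the
  -- germ of f on that side is enough.
  have key : ∀ (B : Finset ℝ) (A : Set (ℝ × ℝ)), (∀ x ∈ A, H x = f (h x)) →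
      (∀ v, ¬ ContMDiffAt 𝓘(ℝ, ℝ) 𝓘(ℝ, E) ω f v → v ∉ B →
        (∀ x ∈ A, h x ≤ v) ∨ ∀ x ∈ A, v ≤ h x) → PolyAnalyticOn E H A := by
    intro B
    induction B using Finset.induction_on with
    | empty =>
      intro A hHA hA
      refine .of_contMDiffOn fun x hx => ?_
      refine ContMDiffWithinAt.congr (f := fun x => f (h x)) ?_ hHA (hHA x hx)
      by_cases hv : ContMDiffAt 𝓘(ℝ, ℝ) 𝓘(ℝ, E) ω f (h x)
      · exact (hv.comp x (hhs x)).contMDiffWithinAt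
      · rcases hA _ hv (by simp) with h' | h'
        · exact ContMDiffWithinAt.comp x (hf (h x)).2 (hhs x).contMDiffWithinAt h'
        · exact ContMDiffWithinAt.comp x (hf (h x)).1 (hhs x).contMDiffWithinAt h'
    | insert w B _ ih =>
      intro A hHA hA
      refine .split a b (w - d) (ih _ (fun x hx => hHA x hx.1) fun v hv hvB => ?_)
        (ih _ (fun x hx => hHA x hx.1) fun v hv hvB => ?_)
      · by_cases hvw : v = w
        · refine .inl fun x hx => ?_
          have := hx.2
          simp only [mem_ofPred_eq] at this
          simp only [hh, hvw]; linarith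
        · exact (hA v hv (by simp [hvw, hvB])).imp (fun h' x hx => h' x hx.1)
            fun h' x hx => h' x hx.1
      · by_cases hvw : v = w
        · refine .inr fun x hx => ?_
          have := hx.2
          simp only [mem_ofPred_eq] at this
          simp only [hh, hvw]; linarith
        · exact (hA v hv (by simp [hvw, hvB])).imp (fun h' x hx => h' x hx.1)
            fun h' x hx => h' x hx.1
  obtain ⟨m, hm⟩ := isCompact_square.bddBelow_image hhs.continuous.continuousOn
  obtain ⟨m', hm'⟩ := isCompact_square.bddAbove_image hhs.continuous.continuousOn
  refine key (hf.finite_not_contMDiffAt m m').toFinset A hH fun v hv hvB => ?_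
  rw [Finite.mem_toFinset] at hvB
  by_cases h1 : m ≤ v
  · refine .inl fun x hx => (hm' (mem_image_of_mem h (hA hx))).trans ?_
    by_contra h2
    exact hvB ⟨⟨h1, (not_le.1 h2).le⟩, hv⟩
  · exact .inr fun x hx => (not_le.1 h1).le.trans (hm (mem_image_of_mem h (hA hx)))

theorem PolyAnalyticOn.continuousOn {H : ℝ × ℝ → M} {A : Set (ℝ × ℝ)}
    (hH : PolyAnalyticOn E H A) (hA : IsClosed A) : ContinuousOn H A := by
  classical
  obtain ⟨F, hAF, hF⟩ := hH
  have : ∀ G ⊆ F, ContinuousOn H (⋃ S ∈ G, A ∩ halfPlanes S) := by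
    intro G
    induction G using Finset.induction_on with
    | empty => simp
    | insert T G _ ih =>
      intro hG
      rw [Finset.set_biUnion_insert]
      refine ContinuousOn.union_of_isClosed (hF T (hG (Finset.mem_insert_self _ _))).continuousOn
        (ih fun S hS => hG (Finset.mem_insert_of_mem hS)) (hA.inter (isClosed_halfPlanes T)) ?_
      exact isClosed_biUnion_finset fun S _ => hA.inter (isClosed_halfPlanes S)
  refine (this F subset_rfl).mono fun x hx => ?_
  obtain ⟨S, hS, hxS⟩ := mem_iUnion₂.1 (hAF hx)
  exact mem_iUnion₂.2 ⟨S, hS, hx, hxS⟩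

/-- Along a segment, a function that is analytic on polygons is analytic to the right. -/
theorem PolyAnalyticOn.segment_right {H : ℝ × ℝ → M} {A : Set (ℝ × ℝ)}
    (hH : PolyAnalyticOn E H A) {a b c d : ℝ}
    (hA : ∀ u ∈ Icc (0 : ℝ) 1, (a * u + b, c * u + d) ∈ A) {u : ℝ} (hu : u ∈ Ico (0 : ℝ) 1) :
    ContMDiffWithinAt 𝓘(ℝ, ℝ) 𝓘(ℝ, E) ω (fun u => H (a * u + b, c * u + d)) (Ici u) u := by
  obtain ⟨F, hAF, hF⟩ := hH
  set x : ℝ → ℝ × ℝ := fun u => (a * u + b, c * u + d) with hx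
  have hxs : ContMDiff 𝓘(ℝ, ℝ) 𝓘(ℝ, ℝ × ℝ) ω x :=
    (show ContDiff ℝ ω x by fun_prop).contMDiff
  have hev : ∀ᶠ v in 𝓝[>] u, v ∈ Icc (0 : ℝ) 1 := by
    filter_upwards [Ioo_mem_nhdsGT hu.2] with v hv
    exact ⟨hu.1.trans hv.1.le, hv.2.le⟩
  have hfr : ∃ᶠ v in 𝓝[>] u, ∃ S ∈ F, x v ∈ halfPlanes S :=
    (hev.mono fun v hv => by simpa using hAF (hA v hv)).frequently
  -- By the pigeonhole principle, one of the finitely many polygons is met at parameters v > u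
  -- arbitrarily close to u. Being closed it contains the point at u, and being convex it contains a
  -- whole segment starting there.
  obtain ⟨S, hS, hfrS⟩ : ∃ S ∈ F, ∃ᶠ v in 𝓝[>] u, x v ∈ halfPlanes S := by
    by_contra! hcon
    refine hfr ?_
    have : ∀ᶠ v in 𝓝[>] u, ∀ S ∈ F, x v ∉ halfPlanes S :=
      (Filter.eventually_all_finset F).2 fun S hS => hcon S hS
    exact this.mono fun v hv ⟨S, hS, h⟩ => hv S hS h
  have huS : x u ∈ halfPlanes S := by
    have hcl : IsClosed (x ⁻¹' halfPlanes S) := (isClosed_halfPlanes S).preimage hxs.continuous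
    exact hcl.mem_of_frequently_of_tendsto hfrS
      (tendsto_id.mono_left nhdsWithin_le_nhds)
  obtain ⟨v, hvS, hv⟩ := (hfrS.and_eventually (hev.and self_mem_nhdsWithin)).exists
  have huv : u < v := hv.2
  have hmaps : MapsTo x (Icc u v) (A ∩ halfPlanes S) := by
    intro w hw
    refine ⟨hA w ⟨hu.1.trans hw.1, hw.2.trans hv.1.2⟩, fun k hk => ?_⟩
    have h1 := huS k hk
    have h2 := hvS k hk
    simp only [hx] at h1 h2 ⊢
    set θ := (w - u) / (v - u) with hθ
    have hθ0 : 0 ≤ θ := div_nonneg (by linarith [hw.1]) (by linarith)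
    have hθ1 : θ ≤ 1 := (div_le_one (by linarith)).2 (by linarith [hw.2])
    have hwθ : w = u + θ * (v - u) := by
      rw [hθ, div_mul_cancel₀ _ (by linarith)]; ring
    rw [hwθ]
    have := add_le_add (mul_le_mul_of_nonneg_left h1 (by linarith : 0 ≤ 1 - θ))
      (mul_le_mul_of_nonneg_left h2 hθ0)
    linarith
  have := (hF S hS).comp (hxs.contMDiffOn (s := Icc u v)) hmaps
  exact (this u ⟨le_rfl, huv.le⟩).mono_of_mem_nhdsWithin (Icc_mem_nhdsGE huv)

theorem PolyAnalyticOn.segment {H : ℝ × ℝ → M} {A : Set (ℝ × ℝ)}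
    (hH : PolyAnalyticOn E H A) {a b c d : ℝ}
    (hA : ∀ u ∈ Icc (0 : ℝ) 1, (a * u + b, c * u + d) ∈ A) {x y : M} {γ : Path x y}
    (hγ : ∀ u ∈ Icc (0 : ℝ) 1, γ.extend u = H (a * u + b, c * u + d)) :
    OneSidedAnalytic E γ.extend := by
  have hR : ∀ {x y : M} (γ : Path x y) (a b c d : ℝ)
      (_ : ∀ u ∈ Icc (0 : ℝ) 1, (a * u + b, c * u + d) ∈ A)
      (_ : ∀ u ∈ Icc (0 : ℝ) 1, γ.extend u = H (a * u + b, c * u + d)) (u : ℝ),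
      ContMDiffWithinAt 𝓘(ℝ, ℝ) 𝓘(ℝ, E) ω γ.extend (Ici u) u := by
    intro x y γ a b c d hA hγ u
    rcases lt_or_ge u 0 with hu | hu
    · exact contMDiffWithinAt_const.congr_of_eventuallyEq
        (((eventually_le_nhds hu).filter_mono nhdsWithin_le_nhds).mono
          fun v hv => γ.extend_of_le_zero hv) (γ.extend_of_le_zero hu.le)
    rcases le_or_gt 1 u with hu1 | hu1
    · exact contMDiffWithinAt_const.congr (fun v hv => γ.extend_of_one_le (hu1.trans hv))
        (γ.extend_of_one_le hu1)
    refine (hH.segment_right hA ⟨hu, hu1⟩).congr_of_eventuallyEq ?_ (hγ u ⟨hu, hu1.le⟩)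
    filter_upwards [Icc_mem_nhdsGE hu1] with v hv using hγ v ⟨hu.trans hv.1, hv.2⟩
  intro u
  refine ⟨hR γ a b c d hA hγ u, ?_⟩
  -- Analyticity from the left is analyticity from the right of the reversed segment.
  have h := hR γ.symm (-a) (a + b) (-c) (c + d)
    (fun u hu => by
      have := hA (1 - u) ⟨by linarith [hu.2], by linarith [hu.1]⟩
      convert this using 2 <;> ring)
    (fun u hu => by
      rw [Path.extend_symm_apply, hγ (1 - u) ⟨by linarith [hu.2], by linarith [hu.1]⟩]
      congr 2 <;> ring) (1 - u)
  have h2 : ContMDiffWithinAt 𝓘(ℝ, ℝ) 𝓘(ℝ, E) ω (fun v => γ.symm.extend (1 - v)) (Iic u) u := by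
    refine h.comp_of_eventually (φ := fun v => 1 - v) ?_ ?_
    · exact (show ContDiff ℝ ω fun v : ℝ => 1 - v by fun_prop).contMDiff.contMDiffAt.contMDiffWithinAt
    · filter_upwards [self_mem_nhdsWithin] with v (hv : v ≤ u)
      simp only [mem_Ici]; linarith
  refine h2.congr (fun v _ => ?_) ?_ <;> rw [Path.extend_symm_apply] <;> congr 1 <;> ring

/-- A strict inequality holds in the interior of a nondegenerate half-plane. -/
theorem lt_of_mem_interior {a b c : ℝ} (hab : (a, b) ≠ 0) {P : Set (ℝ × ℝ)}
    (hP : ∀ x ∈ P, a * x.1 + b * x.2 ≤ c) {x : ℝ × ℝ} (hx : x ∈ interior P) :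
    a * x.1 + b * x.2 < c := by
  -- Moving by δ along the normal (a, b) raises the linear form by δ (a² + b²), so an interior point
  -- cannot lie on the boundary line.
  have hcont : ContinuousAt (fun δ : ℝ => (x.1 + δ * a, x.2 + δ * b)) 0 := by fun_prop
  have : ∀ᶠ δ in 𝓝[>] (0 : ℝ), (x.1 + δ * a, x.2 + δ * b) ∈ P :=
    (hcont.eventually (by simpa using mem_interior_iff_mem_nhds.1 hx)).filter_mono
      nhdsWithin_le_nhds
  obtain ⟨δ, hδ, hδ0⟩ := (this.and self_mem_nhdsWithin).exists
  have h1 := hP _ hδ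
  have h2 : 0 < a ^ 2 + b ^ 2 := by
    by_contra h
    have ha : a = 0 := by nlinarith [sq_nonneg a, sq_nonneg b]
    have hb : b = 0 := by nlinarith [sq_nonneg a, sq_nonneg b]
    exact hab (by simp [ha, hb])
  have h3 := mul_pos (show (0 : ℝ) < δ from hδ0) h2
  simp only at h1
  nlinarith

theorem dense_line_compl {a b c : ℝ} (hab : (a, b) ≠ 0) :
    Dense {x : ℝ × ℝ | a * x.1 + b * x.2 ≠ c} := by
  have : interior {x : ℝ × ℝ | a * x.1 + b * x.2 = c} = ∅ := by
    refine eq_empty_of_forall_notMem fun x hx => ?_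
    exact (lt_of_mem_interior hab (fun y hy => le_of_eq hy) hx).ne
      (show x ∈ {x : ℝ × ℝ | a * x.1 + b * x.2 = c} from interior_subset hx)
  exact interior_eq_empty_iff_dense_compl.1 this

/-- The overlapping polygons are refined to a paving by the arrangement of all their boundary lines:
a cell is given by choosing a side of each line. Only cells with interior points are kept. They
cover the square because the points off all lines are dense, and two different choices of sides give
cells separated by a line. -/
theorem PolyAnalyticOn.piecewiseAnalyticSquare {H : ℝ × ℝ → M} (hH : PolyAnalyticOn E H square)
    {η : I × I → M} (hη : ∀ x : I × I, η x = H (x.1, x.2)) : PiecewiseAnalyticSquare E η := by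
  classical
  obtain ⟨F, hAF, hF⟩ := hH
  -- Triples with a = b = 0 impose a condition independent of the point and bound no half-plane, so
  -- they give no line of the arrangement.
  set L : Finset (ℝ × ℝ × ℝ) := (F.biUnion id).filter fun c => (c.1, c.2.1) ≠ 0 with hL
  set Q : Finset (ℝ × ℝ × ℝ) :=
    {((-1 : ℝ), (0 : ℝ), (0 : ℝ)), (1, 0, 1), (0, -1, 0), (0, 1, 1)} with hQ
  set cell : Finset (ℝ × ℝ × ℝ) → Set (ℝ × ℝ) := fun s =>
    {x | x ∈ square ∧ (∀ c ∈ L, c ∈ s → c.1 * x.1 + c.2.1 * x.2 ≤ c.2.2) ∧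
      ∀ c ∈ L, c ∉ s → c.2.2 ≤ c.1 * x.1 + c.2.1 * x.2} with hcell
  have hpoly : ∀ s, IsConvexPolygon (cell s) := by
    intro s
    have hS : cell s = halfPlanes (Q ∪ (L.filter (· ∈ s) ∪
        (L.filter (· ∉ s)).image fun c => (-c.1, -c.2.1, -c.2.2))) := by
      rw [halfPlanes_union, halfPlanes_union, hQ, ← square_eq_halfPlanes]
      ext x
      simp only [hcell, halfPlanes, mem_ofPred_eq, mem_inter_iff, Finset.mem_filter,
        Finset.mem_image, and_imp, forall_exists_index]
      refine and_congr_right fun _ => and_congr_right fun _ => ?_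
      constructor
      · rintro h c d hd hds rfl
        have := h d hd hds
        simp only; linarith
      · intro h c hc hcs
        have := h _ c hc hcs rfl
        simp only at this; linarith
    refine ⟨?_, _, hS⟩
    rw [hS]
    refine isCompact_square.of_isClosed_subset (isClosed_halfPlanes _) ?_
    rw [← hS]
    exact fun x hx => hx.1
  have hfin : {P | ∃ s ∈ L.powerset, (interior (cell s)).Nonempty ∧ P = cell s}.Finite :=
    (L.powerset.finite_toSet.image cell).subset (by
      rintro P ⟨s, hs, -, rfl⟩
      exact mem_image_of_mem _ hs)
  refine ⟨{P | ∃ s ∈ L.powerset, (interior (cell s)).Nonempty ∧ P = cell s},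
    ⟨hfin, ?_, ?_, ?_⟩, ?_⟩
  · rintro P ⟨s, -, -, rfl⟩
    exact hpoly s
  · refine subset_antisymm (sUnion_subset ?_) ?_
    · rintro P ⟨s, -, -, rfl⟩
      exact fun x hx => hx.1
    · have hcl : IsClosed (⋃₀ {P | ∃ s ∈ L.powerset, (interior (cell s)).Nonempty ∧
          P = cell s}) := by
        rw [sUnion_eq_biUnion]
        refine hfin.isClosed_biUnion ?_
        rintro P ⟨s, -, -, rfl⟩
        exact (hpoly s).1.isClosed
      have hopen : ∀ c ∈ (L : Set (ℝ × ℝ × ℝ)),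
          IsOpen {x : ℝ × ℝ | c.1 * x.1 + c.2.1 * x.2 ≠ c.2.2} :=
        fun c _ => isOpen_ne_fun (by fun_prop) (by fun_prop)
      have hd : Dense (⋂ c ∈ (L : Set (ℝ × ℝ × ℝ)),
          {x : ℝ × ℝ | c.1 * x.1 + c.2.1 * x.2 ≠ c.2.2}) :=
        dense_biInter_of_isOpen hopen (L.finite_toSet.countable)
          fun c hc => dense_line_compl (Finset.mem_filter.1 hc).2
      have hU : IsOpen (Ioo (0 : ℝ) 1 ×ˢ Ioo (0 : ℝ) 1) := isOpen_Ioo.prod isOpen_Ioo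
      have h1 := hd.open_subset_closure_inter hU
      have h2 : closure (Ioo (0 : ℝ) 1 ×ˢ Ioo (0 : ℝ) 1) = Icc (0 : ℝ) 1 ×ˢ Icc (0 : ℝ) 1 := by
        rw [closure_prod_eq, closure_Ioo zero_ne_one]
      rw [← h2]
      refine closure_minimal (h1.trans (closure_minimal ?_ hcl)) hcl
      rintro x ⟨hx, hxL⟩
      have hxL' : ∀ c ∈ L, c.1 * x.1 + c.2.1 * x.2 ≠ c.2.2 := fun c hc => mem_iInter₂.1 hxL c hc
      set s := L.filter fun c => c.1 * x.1 + c.2.1 * x.2 ≤ c.2.2 with hs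
      have hint : x ∈ interior (cell s) := by
        rw [mem_interior_iff_mem_nhds]
        have e1 : ∀ᶠ y in 𝓝 x, y ∈ square :=
          mem_of_superset (hU.mem_nhds hx) (prod_mono Ioo_subset_Icc_self Ioo_subset_Icc_self)
        have e2 : ∀ᶠ y in 𝓝 x, ∀ c ∈ L, (c ∈ s → c.1 * y.1 + c.2.1 * y.2 ≤ c.2.2) ∧
            (c ∉ s → c.2.2 ≤ c.1 * y.1 + c.2.1 * y.2) := by
          refine (Filter.eventually_all_finset L).2 fun c hc => ?_
          have hct : ContinuousAt (fun y : ℝ × ℝ => c.1 * y.1 + c.2.1 * y.2) x := by fun_prop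
          rcases lt_or_gt_of_ne (hxL' c hc) with h | h
          · filter_upwards [hct.eventually_lt_const h] with y hy
            exact ⟨fun _ => hy.le, fun hcs => absurd (Finset.mem_filter.2 ⟨hc, h.le⟩) hcs⟩
          · filter_upwards [hct.eventually_const_lt h] with y hy
            exact ⟨fun hcs => absurd (Finset.mem_filter.1 hcs).2 (not_le.2 h), fun _ => hy.le⟩
        filter_upwards [e1, e2] with y hy hy2
        exact ⟨hy, fun c hc => (hy2 c hc).1, fun c hc => (hy2 c hc).2⟩
      exact ⟨cell s, ⟨s, Finset.mem_powerset.2 (Finset.filter_subset _ _), ⟨x, hint⟩, rfl⟩,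
        interior_subset hint⟩
  · have main : ∀ s t : Finset (ℝ × ℝ × ℝ), ∀ c ∈ L, c ∈ s → c ∉ t →
        Disjoint (interior (cell s)) (interior (cell t)) := by
      intro s t c hc hs ht
      refine disjoint_left.2 fun x hx hx' => ?_
      have h1 := lt_of_mem_interior (Finset.mem_filter.1 hc).2
        (fun y (hy : y ∈ cell s) => hy.2.1 c hc hs) hx
      have h2 := (interior_subset hx').2.2 c hc ht
      exact h1.not_ge h2
    rintro P ⟨s, hs, -, rfl⟩ P' ⟨t, ht, -, rfl⟩ hne
    obtain ⟨c, hc⟩ : ∃ c, ¬ (c ∈ s ↔ c ∈ t) := by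
      by_contra! h
      exact hne (congrArg cell (Finset.ext h))
    by_cases hcs : c ∈ s
    · exact main s t c (Finset.mem_powerset.1 hs hcs) hcs (by tauto)
    · have hct : c ∈ t := by tauto
      exact (main t s c (Finset.mem_powerset.1 ht hct) hct hcs).symm
  · rintro P ⟨s, hs, ⟨x, hx⟩, rfl⟩
    obtain ⟨S, hS, hxS⟩ := mem_iUnion₂.1 (hAF (interior_subset hx).1)
    -- A polygon containing one interior point of the cell contains the cell: a constraint of `S`
    -- imposed in reverse on the cell would be strictly violated at that point.
    have hsub : cell s ⊆ square ∩ halfPlanes S := by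
      refine fun y hy => ⟨hy.1, fun c hc => ?_⟩
      by_cases hc0 : (c.1, c.2.1) = 0
      · have h := hxS c hc
        rw [(Prod.ext_iff.1 hc0).1, show c.2.1 = 0 from (Prod.ext_iff.1 hc0).2] at h ⊢
        simpa using h
      · have hcL : c ∈ L := Finset.mem_filter.2 ⟨Finset.mem_biUnion.2 ⟨S, hS, hc⟩, hc0⟩
        by_cases hcs : c ∈ s
        · exact hy.2.1 c hcL hcs
        · have h1 := lt_of_mem_interior (a := -c.1) (b := -c.2.1) (c := -c.2.2)
            (by
              intro h
              have h1 := (Prod.ext_iff.1 h).1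
              have h2 := (Prod.ext_iff.1 h).2
              simp only [Prod.fst_zero, Prod.snd_zero, neg_eq_zero] at h1 h2
              exact hc0 (Prod.ext h1 h2))
            (fun y (hy : y ∈ cell s) => by
              have := hy.2.2 c hcL hcs
              linarith) hx
          have h2 := hxS c hc
          linarith
    refine ((hF S hS).mono hsub).congr fun y hy => ?_
    rw [hη]
    have h1 := hy.1.1
    have h2 := hy.1.2
    congr 1
    ext
    · exact congrArg Subtype.val (projIcc_of_mem zero_le_one h1)
    · exact congrArg Subtype.val (projIcc_of_mem zero_le_one h2)

theorem PiecewiseAnalyticSquare.polyAnalyticOn {η : I × I → M}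
    (h : PiecewiseAnalyticSquare E η) :
    PolyAnalyticOn E (fun x : ℝ × ℝ =>
      η (projIcc 0 1 zero_le_one x.1, projIcc 0 1 zero_le_one x.2)) square := by
  classical
  obtain ⟨C, ⟨hfin, hpoly, hunion, -⟩, hC⟩ := h
  choose! S hS using fun P hP => (hpoly P hP).2
  refine ⟨hfin.toFinset.image S, ?_, ?_⟩
  · intro x hx
    obtain ⟨P, hP, hxP⟩ := (hunion.symm ▸ hx : x ∈ ⋃₀ C)
    refine mem_iUnion₂.2 ⟨S P, Finset.mem_image_of_mem _ (hfin.mem_toFinset.2 hP), ?_⟩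
    rw [hS P hP] at hxP
    exact hxP
  · intro T hT
    obtain ⟨P, hP, rfl⟩ := Finset.mem_image.1 hT
    refine (hC P (hfin.mem_toFinset.1 hP)).mono ?_
    conv_rhs => rw [hS P (hfin.mem_toFinset.1 hP)]
    exact inter_subset_right

end

end ThinLoops

/-! ### Retrace equivalence implies thin equivalence -/

namespace ThinLoops

open Set Filter Topology

section

variable {E : Type*} [NormedAddCommGroup E] [NormedSpace ℝ E]
  {M : Type*} [TopologicalSpace M] [ChartedSpace E M] {p : M}

theorem PALoop.oneSidedAnalytic (γ : PALoop E p) : OneSidedAnalytic E γ.1.extend :=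
  γ.2.oneSidedAnalytic

theorem PALoop.ext_of_extend {γ γ' : PALoop E p}
    (h : ∀ t ∈ Icc (0 : ℝ) 1, γ.1.extend t = γ'.1.extend t) : γ = γ' :=
  Subtype.ext (path_ext_of_extend h)

variable [IsManifold 𝓘(ℝ, E) ω M]

/-- The intermediate loops are restrictions of H to segments, hence piecewise analytic without
further hypotheses; continuity follows as well, since the pieces are closed. -/
theorem thinHomotopic_of_polyAnalyticOn {H : ℝ × ℝ → M} (hH : PolyAnalyticOn E H square)
    {γ₀ γ₁ : PALoop E p} (h0 : ∀ t ∈ Icc (0 : ℝ) 1, H (0, t) = γ₀.1.extend t)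
    (h1 : ∀ t ∈ Icc (0 : ℝ) 1, H (1, t) = γ₁.1.extend t)
    (hs0 : ∀ s ∈ Icc (0 : ℝ) 1, H (s, 0) = p) (hs1 : ∀ s ∈ Icc (0 : ℝ) 1, H (s, 1) = p)
    (hr : ∀ s ∈ Icc (0 : ℝ) 1, ∀ t ∈ Icc (0 : ℝ) 1, H (s, t) ∈ range γ₀.1 ∪ range γ₁.1) :
    ThinHomotopic γ₀ γ₁ := by
  have hcont : Continuous fun x : I × I => H (x.1, x.2) :=
    (hH.continuousOn isCompact_square.isClosed).comp_continuous (by fun_prop)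
      fun x => ⟨x.1.2, x.2.2⟩
  let η : Path.Homotopy γ₀.1 γ₁.1 :=
    { toFun := fun x => H (x.1, x.2)
      continuous_toFun := hcont
      map_zero_left := fun t => by
        simpa using h0 t t.2
      map_one_left := fun t => by
        simpa using h1 t t.2
      prop' := by
        intro s t ht
        rcases ht with rfl | rfl
        · simpa using hs0 s s.2
        · simpa using hs1 s s.2 }
  have hη : ∀ x : I × I, η x = H (x.1, x.2) := fun x => rfl
  refine ⟨η, fun s => ?_, hH.piecewiseAnalyticSquare hη, ?_⟩
  · refine (hH.segment (a := 0) (b := s) (c := 1) (d := 0) (fun u hu => ⟨?_, ?_⟩)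
      fun u hu => ?_).piecewiseAnalytic
    · simp
    · simpa using hu
    · rw [Path.extend_apply _ hu]
      change H _ = H _
      simp
  · rintro _ ⟨x, rfl⟩
    exact hr _ x.1.2 _ x.2.2

/-- `ψ` with its restriction to `[a,b]` replaced by the affine function with the same end values. -/
noncomputable def straighten (ψ : ℝ → ℝ) (a b t : ℝ) : ℝ :=
  if t ≤ a then ψ t else if t ≤ b then ψ a + (ψ b - ψ a) * ((t - a) / (b - a)) else ψ t

theorem straighten_of_le {ψ : ℝ → ℝ} {a b t : ℝ} (h : t ≤ a) : straighten ψ a b t = ψ t :=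
  if_pos h

theorem straighten_of_ge {ψ : ℝ → ℝ} {a b t : ℝ} (_hab : a ≤ b) (h : b ≤ t) :
    straighten ψ a b t = ψ t := by
  unfold straighten
  split_ifs with h1 h2
  · rfl
  · obtain rfl := le_antisymm h h2
    rw [div_self (by linarith)]; ring
  · rfl

theorem straighten_of_mem {ψ : ℝ → ℝ} {a b t : ℝ} (h : t ∈ Icc a b) :
    straighten ψ a b t = ψ a + (ψ b - ψ a) * ((t - a) / (b - a)) := by
  unfold straighten
  split_ifs with h1 h2
  · rw [le_antisymm h1 h.1]; simp
  · rfl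
  · exact absurd h.2 h2

theorem straighten_self (ψ : ℝ → ℝ) (a : ℝ) : straighten ψ a a = ψ :=
  funext fun t => by
    rcases le_total t a with h | h
    · exact straighten_of_le h
    · exact straighten_of_ge le_rfl h

theorem OneSidedAnalytic.straighten {ψ : ℝ → ℝ} (hψ : OneSidedAnalytic ℝ ψ) {a b : ℝ}
    (hab : a ≤ b) : OneSidedAnalytic ℝ (straighten ψ a b) := by
  rcases hab.eq_or_lt with rfl | hab
  · rwa [straighten_self]
  have hlin : OneSidedAnalytic ℝ fun t => ψ a + (ψ b - ψ a) * ((t - a) / (b - a)) :=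
    ContDiff.oneSidedAnalytic (by fun_prop)
  refine hψ.if_le (hlin.if_le hψ ?_) ?_
  · rw [div_self (by linarith)]; ring
  · rw [if_pos hab.le]; simp

/-- A reparametrization is onto. -/
theorem extend_mem_range_comp {X : Type*} [TopologicalSpace X] {x y : X} {γ γ' : Path x y}
    {φ : ℝ → ℝ} (hφ : Continuous φ) (h0 : φ 0 = 0) (h1 : φ 1 = 1)
    (h : ∀ t ∈ Icc (0 : ℝ) 1, γ'.extend t = γ.extend (φ t)) (u : ℝ) :
    γ.extend u ∈ range γ' := by
  have := intermediate_value_Icc zero_le_one hφ.continuousOn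
  rw [h0, h1] at this
  obtain ⟨t, ht, htu⟩ := this (clamp_mem u)
  refine ⟨⟨t, ht⟩, ?_⟩
  rw [← Path.extend_extends' γ', h t ht, htu, extend_clamp]

/-- Deforming a reparametrization linearly on an interval on which both it and the loop are
analytic. -/
theorem thinHomotopic_straighten {γ : PALoop E p} {ψ : ℝ → ℝ} (hψ : OneSidedAnalytic ℝ ψ)
    (hψ0 : ψ 0 = 0) (hψ1 : ψ 1 = 1) {a b : ℝ} (ha : 0 ≤ a) (hab : a < b) (hb : b ≤ 1) {u v : ℝ}
    (hψab : ContMDiffOn 𝓘(ℝ, ℝ) 𝓘(ℝ, ℝ) ω ψ (Icc a b)) (hmaps : MapsTo ψ (Icc a b) (Icc u v))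
    (hγ : ContMDiffOn 𝓘(ℝ, ℝ) 𝓘(ℝ, E) ω γ.1.extend (Icc u v)) {γ₀ γ₁ : PALoop E p}
    (h₀ : ∀ t ∈ Icc (0 : ℝ) 1, γ₀.1.extend t = γ.1.extend (ψ t))
    (h₁ : ∀ t ∈ Icc (0 : ℝ) 1, γ₁.1.extend t = γ.1.extend (straighten ψ a b t)) :
    ThinHomotopic γ₀ γ₁ := by
  -- Linear interpolation between ψ and its straightening. Over `[a, b]` both take values in the
  -- convex set `[u, v]`, where the loop is analytic, so the interpolation never meets a break;
  -- elsewhere it does not move.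
  set H : ℝ × ℝ → M := fun x =>
    γ.1.extend ((1 - x.1) * ψ x.2 + x.1 * straighten ψ a b x.2) with hH
  have hout : ∀ s t, t ≤ a ∨ b ≤ t → H (s, t) = γ.1.extend (ψ t) := by
    rintro s t (h | h)
    · simp only [hH, straighten_of_le h]; congr 1; ring
    · simp only [hH, straighten_of_ge hab.le h]; congr 1; ring
  have hcomp := γ.oneSidedAnalytic.comp hψ
  refine thinHomotopic_of_polyAnalyticOn (H := H) ?_ ?_ ?_ ?_ ?_ ?_
  · refine .split 0 1 a (.of_affine hcomp 0 1 0 inter_subset_left fun x hx => ?_)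
      (.split 0 1 b (.of_contMDiffOn ?_) (.of_affine hcomp 0 1 0
        (inter_subset_left.trans inter_subset_left) fun x hx => ?_))
    · have h2 : 0 * x.1 + 1 * x.2 ≤ a := hx.2
      rw [hout x.1 x.2 (.inl (by linarith))]; simp
    · have hx2 : ∀ x ∈ square ∩ {x | a ≤ 0 * x.1 + 1 * x.2} ∩ {x | 0 * x.1 + 1 * x.2 ≤ b},
          x.2 ∈ Icc a b := by
        rintro x ⟨⟨-, h1⟩, h2⟩
        have h1 : a ≤ 0 * x.1 + 1 * x.2 := h1
        have h2 : 0 * x.1 + 1 * x.2 ≤ b := h2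
        exact ⟨by linarith, by linarith⟩
      refine ContMDiffOn.congr (f := fun x : ℝ × ℝ => γ.1.extend ((1 - x.1) * ψ x.2 +
        x.1 * (ψ a + (ψ b - ψ a) * ((x.2 - a) / (b - a))))) ?_ fun x hx => ?_
      · refine hγ.comp (f := fun x : ℝ × ℝ => (1 - x.1) * ψ x.2 +
          x.1 * (ψ a + (ψ b - ψ a) * ((x.2 - a) / (b - a)))) ?_ ?_
        · have h2 : ContDiffOn ℝ ω (fun x : ℝ × ℝ => ψ x.2)
              (square ∩ {x | a ≤ 0 * x.1 + 1 * x.2} ∩ {x | 0 * x.1 + 1 * x.2 ≤ b}) :=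
            (contMDiffOn_iff_contDiffOn.1 hψab).comp (contDiff_snd.contDiffOn) hx2
          refine contMDiffOn_iff_contDiffOn.2 (ContDiffOn.add (ContDiffOn.mul ?_ h2) ?_)
          · exact ContDiff.contDiffOn (by fun_prop)
          · exact ContDiff.contDiffOn (by fun_prop)
        · intro x hx
          have h01 : x.1 ∈ Icc (0 : ℝ) 1 := hx.1.1.1
          have h2 := hx2 x hx
          have hθ : (x.2 - a) / (b - a) ∈ Icc (0 : ℝ) 1 :=
            ⟨div_nonneg (by linarith [h2.1]) (by linarith),
              (div_le_one (by linarith)).2 (by linarith [h2.2])⟩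
          refine (convex_Icc u v) (hmaps h2) ?_ (by linarith [h01.2]) h01.1 (by ring)
          have := (convex_Icc u v) (hmaps ⟨le_rfl, hab.le⟩) (hmaps ⟨hab.le, le_rfl⟩)
            (by linarith [hθ.2] : 0 ≤ 1 - (x.2 - a) / (b - a)) hθ.1 (by ring)
          convert this using 1
          simp only [smul_eq_mul]; ring
      · simp only [hH, straighten_of_mem (hx2 x hx)]
    · have h2 : b ≤ 0 * x.1 + 1 * x.2 := hx.2
      rw [hout x.1 x.2 (.inr (by linarith))]; simp
  · intro t ht
    rw [h₀ t ht]; simp [hH]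
  · intro t ht
    rw [h₁ t ht]; simp [hH]
  · intro s hs
    rw [hout s 0 (.inl ha), hψ0, Path.extend_zero]
  · intro s hs
    rw [hout s 1 (.inr hb), hψ1, Path.extend_one]
  · intro s _ t _
    exact .inl (extend_mem_range_comp hψ.continuous hψ0 hψ1 h₀ _)

/-- Replacing two adjacent affine pieces of a reparametrization by a single one. -/
theorem thinHomotopic_straighten_straighten {γ : PALoop E p} {ψ : ℝ → ℝ}
    (hψ : OneSidedAnalytic ℝ ψ) (hψ0 : ψ 0 = 0) (hψ1 : ψ 1 = 1) {a b c : ℝ} (ha : 0 ≤ a)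
    (hab : a < b) (hbc : b < c) (hc : c ≤ 1) {γ₀ γ₁ : PALoop E p}
    (h₀ : ∀ t ∈ Icc (0 : ℝ) 1,
      γ₀.1.extend t = γ.1.extend (straighten (straighten ψ a b) b c t))
    (h₁ : ∀ t ∈ Icc (0 : ℝ) 1, γ₁.1.extend t = γ.1.extend (straighten ψ a c t)) :
    ThinHomotopic γ₀ γ₁ := by
  have hac := hab.trans hbc
  -- The broken line exceeds the chord over `[a, c]` by d times the tent `T`, which is 0 at a and c
  -- and 1 at b.
  set d := ψ b - straighten ψ a c b with hd
  set T : ℝ → ℝ := fun t => min ((t - a) / (b - a)) ((c - t) / (c - b)) with hT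
  have hTa : ∀ t, t ≤ a → T t ≤ 0 := fun t ht =>
    (min_le_left _ _).trans (div_nonpos_of_nonpos_of_nonneg (by linarith) (by linarith))
  have hTc : ∀ t, c ≤ t → T t ≤ 0 := fun t ht =>
    (min_le_right _ _).trans (div_nonpos_of_nonpos_of_nonneg (by linarith) (by linarith))
  have hTl : ∀ t, t ≤ b → T t = (t - a) / (b - a) := fun t ht => by
    have h1 : (t - a) / (b - a) ≤ 1 := (div_le_one (by linarith)).2 (by linarith)
    have h2 : 1 ≤ (c - t) / (c - b) := (one_le_div (by linarith)).2 (by linarith)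
    exact min_eq_left (h1.trans h2)
  have hTr : ∀ t, b ≤ t → T t = (c - t) / (c - b) := fun t ht => by
    have h1 : 1 ≤ (t - a) / (b - a) := (one_le_div (by linarith)).2 (by linarith)
    have h2 : (c - t) / (c - b) ≤ 1 := (div_le_one (by linarith)).2 (by linarith)
    exact min_eq_right (h2.trans h1)
  have hT1 : ∀ t, T t ≤ 1 := fun t => by
    rcases le_total t b with h | h
    · rw [hTl t h]; exact (div_le_one (by linarith)).2 (by linarith)
    · rw [hTr t h]; exact (div_le_one (by linarith)).2 (by linarith)
  -- The tent is lowered by s and cut off at 0, rather than multiplied by 1 - s. This keeps the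
  -- parameter piecewise affine in (s, t) over `[a, c]`, so that the breaks of the loop are met
  -- along straight lines.
  set h : ℝ × ℝ → ℝ := fun x => straighten ψ a c x.2 + d * max 0 (T x.2 - x.1) with hh
  have hbroken : ∀ t, h (0, t) = straighten (straighten ψ a b) b c t := by
    intro t
    simp only [hh, sub_zero]
    rcases le_or_gt t a with ht | ht
    · rw [max_eq_left (hTa t ht), straighten_of_le ht, straighten_of_le (ht.trans hab.le),
        straighten_of_le ht]; ring
    rcases le_or_gt c t with ht' | ht'
    · rw [max_eq_left (hTc t ht'), straighten_of_ge hac.le ht', straighten_of_ge hbc.le ht',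
        straighten_of_ge hab.le (hbc.le.trans ht')]; ring
    rw [straighten_of_mem ⟨ht.le, ht'.le⟩, hd, straighten_of_mem ⟨hab.le, hbc.le⟩]
    have e1 : b - a ≠ 0 := by linarith
    have e2 : c - b ≠ 0 := by linarith
    have e3 : c - a ≠ 0 := by linarith
    rcases le_total t b with h | h
    · rw [hTl t h, max_eq_right (div_nonneg (by linarith) (by linarith)), straighten_of_le h,
        straighten_of_mem ⟨ht.le, h⟩]
      field_simp; ring
    · rw [hTr t h, max_eq_right (div_nonneg (by linarith) (by linarith)),
        straighten_of_mem ⟨h, ht'.le⟩, straighten_of_ge hab.le le_rfl,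
        straighten_of_ge hab.le hbc.le]
      field_simp; ring
  have hout : ∀ s, 0 ≤ s → ∀ t, t ≤ a ∨ c ≤ t → h (s, t) = ψ t := by
    rintro s hs t (ht | ht)
    · simp only [hh]
      rw [max_eq_left (by linarith [hTa t ht]), straighten_of_le ht]; ring
    · simp only [hh]
      rw [max_eq_left (by linarith [hTc t ht]), straighten_of_ge hac.le ht]; ring
  have hcomp := γ.oneSidedAnalytic.comp hψ
  refine thinHomotopic_of_polyAnalyticOn (H := fun x => γ.1.extend (h x)) ?_ ?_ ?_ ?_ ?_ ?_
  · have hlow : ∀ A ⊆ square, (∀ x ∈ A, x.2 ∈ Icc a c) → (∀ x ∈ A, T x.2 ≤ x.1) →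
        PolyAnalyticOn E (fun x => γ.1.extend (h x)) A := by
      intro A hA hA2 hAT
      refine .of_affine γ.oneSidedAnalytic 0 ((ψ c - ψ a) / (c - a))
        (ψ a - (ψ c - ψ a) / (c - a) * a) hA fun x hx => ?_
      simp only [hh]
      rw [straighten_of_mem (hA2 x hx), max_eq_left (by linarith [hAT x hx])]
      congr 1; ring
    have hlin : ∀ A ⊆ square, (∀ x ∈ A, x.2 ∈ Icc a c) → ∀ k l : ℝ,
        (∀ x ∈ A, T x.2 = k * x.2 + l) → PolyAnalyticOn E (fun x => γ.1.extend (h x)) A := by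
      intro A hA hA2 k l hkl
      refine .split (-1) k (-l) (hlow _ (inter_subset_left.trans hA) (fun x hx => hA2 x hx.1)
        fun x hx => ?_) ?_
      · have h2 : -1 * x.1 + k * x.2 ≤ -l := hx.2
        rw [hkl x hx.1]; linarith
      · refine .of_affine γ.oneSidedAnalytic (-d) ((ψ c - ψ a) / (c - a) + d * k)
          (ψ a - (ψ c - ψ a) / (c - a) * a + d * l) (inter_subset_left.trans hA) fun x hx => ?_
        have h2 : -l ≤ -1 * x.1 + k * x.2 := hx.2
        simp only [hh]
        rw [straighten_of_mem (hA2 x hx.1), hkl x hx.1, max_eq_right (by linarith)]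
        congr 1; ring
    refine .split 0 1 a (.of_affine hcomp 0 1 0 inter_subset_left fun x hx => ?_)
      (.split 0 1 c (.split 0 1 b ?_ ?_) (.of_affine hcomp 0 1 0
        (inter_subset_left.trans inter_subset_left) fun x hx => ?_))
    · have h2 : 0 * x.1 + 1 * x.2 ≤ a := hx.2
      rw [hout x.1 hx.1.1.1 x.2 (.inl (by linarith))]; simp
    · refine hlin _ (fun x hx => hx.1.1.1) (fun x hx => ?_) (1 / (b - a)) (-a / (b - a))
        fun x hx => ?_
      · have h1 : a ≤ 0 * x.1 + 1 * x.2 := hx.1.1.2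
        have h2 : 0 * x.1 + 1 * x.2 ≤ c := hx.1.2
        exact ⟨by linarith, by linarith⟩
      · have h1 : 0 * x.1 + 1 * x.2 ≤ b := hx.2
        rw [hTl _ (by linarith)]; ring
    · refine hlin _ (fun x hx => hx.1.1.1) (fun x hx => ?_) (-1 / (c - b)) (c / (c - b))
        fun x hx => ?_
      · have h1 : a ≤ 0 * x.1 + 1 * x.2 := hx.1.1.2
        have h2 : 0 * x.1 + 1 * x.2 ≤ c := hx.1.2
        exact ⟨by linarith, by linarith⟩
      · have h1 : b ≤ 0 * x.1 + 1 * x.2 := hx.2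
        rw [hTr _ (by linarith)]; ring
    · have h2 : c ≤ 0 * x.1 + 1 * x.2 := hx.2
      rw [hout x.1 hx.1.1.1.1 x.2 (.inr (by linarith))]; simp
  · intro t ht
    rw [h₀ t ht, hbroken]
  · intro t ht
    rw [h₁ t ht]
    simp only [hh]
    rw [max_eq_left (by linarith [hT1 t]), mul_zero, add_zero]
  · intro s hs
    rw [hout s hs.1 0 (.inl ha), hψ0, Path.extend_zero]
  · intro s hs
    rw [hout s hs.1 1 (.inr hc), hψ1, Path.extend_one]
  · intro s _ t _
    refine .inl (extend_mem_range_comp (γ := γ.1)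
      ((hψ.straighten hab.le).straighten hbc.le).continuous ?_ ?_ h₀ _)
    · rw [straighten_of_le (ha.trans hab.le), straighten_of_le ha, hψ0]
    · rw [straighten_of_ge hbc.le hc, straighten_of_ge hab.le (hbc.le.trans hc), hψ1]

/-- Only the end values of φ matter: values outside `[0,1]` are absorbed by the constant extension
of the loop. -/
theorem exists_palCompLoop (γ : PALoop E p) {φ : ℝ → ℝ} (hφ : OneSidedAnalytic ℝ φ)
    (h0 : φ 0 = 0) (h1 : φ 1 = 1) :
    ∃ γ' : PALoop E p, ∀ t ∈ Icc (0 : ℝ) 1, γ'.1.extend t = γ.1.extend (φ t) := by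
  have hc := γ.oneSidedAnalytic.comp hφ
  let γ' : Path p p := Path.ofLine hc.continuous.continuousOn
    (by rw [h0, Path.extend_zero]) (by rw [h1, Path.extend_one])
  have h : ∀ t ∈ Icc (0 : ℝ) 1, γ'.extend t = γ.1.extend (φ t) := fun t ht => by
    rw [Path.extend_apply _ ht]; rfl
  exact ⟨⟨γ', (oneSidedAnalytic_extend hc h).piecewiseAnalytic⟩, h⟩

theorem _root_.ContMDiffWithinAt.eventually_contMDiffOn_Icc_right {F : Type*} [NormedAddCommGroup F]
    [NormedSpace ℝ F] {N : Type*} [TopologicalSpace N] [ChartedSpace F N]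
    [IsManifold 𝓘(ℝ, F) ω N] {f : ℝ → N} {t : ℝ}
    (h : ContMDiffWithinAt 𝓘(ℝ, ℝ) 𝓘(ℝ, F) ω f (Ici t) t) :
    ∀ᶠ u in 𝓝[>] t, ContMDiffOn 𝓘(ℝ, ℝ) 𝓘(ℝ, F) ω f (Icc t u) := by
  obtain ⟨s, hs, hfs⟩ := (contMDiffWithinAt_iff_contMDiffOn_nhds (by simp)).1 h
  rw [insert_eq_of_mem self_mem_Ici] at hs
  obtain ⟨u, hu, hus⟩ := (mem_nhdsGE_iff_exists_Icc_subset).1 hs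
  filter_upwards [Ioo_mem_nhdsGT (show t < u from hu)] with v hv
  exact hfs.mono ((Icc_subset_Icc_right hv.2.le).trans hus)

theorem _root_.ContMDiffWithinAt.eventually_contMDiffOn_Icc_left {F : Type*} [NormedAddCommGroup F]
    [NormedSpace ℝ F] {N : Type*} [TopologicalSpace N] [ChartedSpace F N]
    [IsManifold 𝓘(ℝ, F) ω N] {f : ℝ → N} {t : ℝ}
    (h : ContMDiffWithinAt 𝓘(ℝ, ℝ) 𝓘(ℝ, F) ω f (Iic t) t) :
    ∀ᶠ u in 𝓝[<] t, ContMDiffOn 𝓘(ℝ, ℝ) 𝓘(ℝ, F) ω f (Icc u t) := by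
  obtain ⟨s, hs, hfs⟩ := (contMDiffWithinAt_iff_contMDiffOn_nhds (by simp)).1 h
  rw [insert_eq_of_mem self_mem_Iic] at hs
  obtain ⟨u, hu, hus⟩ := (mem_nhdsLE_iff_exists_Icc_subset).1 hs
  filter_upwards [Ioo_mem_nhdsLT (show u < t from hu)] with v hv
  exact hfs.mono ((Icc_subset_Icc_left hv.1.le).trans hus)

/-- Reparametrizing a loop does not change its thin equivalence class. -/
theorem thinEquivalent_of_comp {γ γ' : PALoop E p} {φ : ℝ → ℝ} (hφ : OneSidedAnalytic ℝ φ)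
    (hφ0 : φ 0 = 0) (hφ1 : φ 1 = 1)
    (h : ∀ t ∈ Icc (0 : ℝ) 1, γ'.1.extend t = γ.1.extend (φ t)) : ThinEquivalent γ' γ := by
  -- Straightening over `[a, b]` preserves the class for every ψ that agrees with φ there and is
  -- arbitrary elsewhere. This freedom makes the property additive: `[b, c]` is treated after `[a,
  -- b]` has already been straightened.
  let P : ℝ → ℝ → Prop := fun a b => ∀ ψ, OneSidedAnalytic ℝ ψ → ψ 0 = 0 → ψ 1 = 1 →
    (∀ t ∈ Icc a b, ψ t = φ t) → ∀ γ₀ γ₁ : PALoop E p,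
    (∀ t ∈ Icc (0 : ℝ) 1, γ₀.1.extend t = γ.1.extend (ψ t)) →
    (∀ t ∈ Icc (0 : ℝ) 1, γ₁.1.extend t = γ.1.extend (straighten ψ a b t)) →
    ThinEquivalent γ₀ γ₁
  have hP0 : ∀ a, P a a := by
    intro a ψ _ _ _ _ γ₀ γ₁ h₀ h₁
    rw [straighten_self] at h₁
    rw [PALoop.ext_of_extend fun t ht => (h₀ t ht).trans (h₁ t ht).symm]
    exact .refl _
  have local_step : ∀ a b u v, 0 ≤ a → a < b → b ≤ 1 →
      ContMDiffOn 𝓘(ℝ, ℝ) 𝓘(ℝ, ℝ) ω φ (Icc a b) → MapsTo φ (Icc a b) (Icc u v) →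
      ContMDiffOn 𝓘(ℝ, ℝ) 𝓘(ℝ, E) ω γ.1.extend (Icc u v) → P a b := by
    intro a b u v ha hab hb hφab hmaps hγ ψ hψ hψ0 hψ1 hψφ γ₀ γ₁ h₀ h₁
    exact .rel _ _ (thinHomotopic_straighten hψ hψ0 hψ1 ha hab hb (hφab.congr hψφ)
      (hmaps.congr fun t ht => (hψφ t ht).symm) hγ h₀ h₁)
  have key : P 0 1 := by
    refine interval_induction zero_le_one (hP0 0) ?_ ?_ ?_
    · intro a b c ha hab hbc hc h1 h2
      rcases hab.eq_or_lt with rfl | hab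
      · exact h2
      rcases hbc.eq_or_lt with rfl | hbc
      · exact h1
      intro ψ hψ hψ0 hψ1 hψφ γ₀ γ₁ h₀ h₁
      have e0 : straighten ψ a b 0 = 0 := by rw [straighten_of_le ha, hψ0]
      have e1 : straighten ψ a b 1 = 1 := by rw [straighten_of_ge hab.le (hbc.le.trans hc), hψ1]
      have hψ' := hψ.straighten hab.le
      obtain ⟨γ₂, h₂⟩ := exists_palCompLoop γ hψ' e0 e1
      obtain ⟨γ₃, h₃⟩ := exists_palCompLoop γ (hψ'.straighten hbc.le)
        (by rw [straighten_of_le (ha.trans hab.le), e0]) (by rw [straighten_of_ge hbc.le hc, e1])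
      refine (h1 ψ hψ hψ0 hψ1 (fun t ht => hψφ t ⟨ht.1, ht.2.trans hbc.le⟩) _ _ h₀ h₂).trans _ _ _
        ((h2 _ hψ' e0 e1 (fun t ht => ?_) _ _ h₂ h₃).trans _ _ _ (.rel _ _ ?_))
      · rw [straighten_of_ge hab.le ht.1, hψφ t ⟨hab.le.trans ht.1, ht.2⟩]
      · exact thinHomotopic_straighten_straighten hψ hψ0 hψ1 ha hab hbc hc h₃ h₁
    · intro a ha
      -- Whether φ stays above or below φ a just after a decides on which side of φ a an interval of
      -- analyticity of the loop is taken.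
      rcases (hφ.eventually_le_or_ge a).1 with hs | hs
      · obtain ⟨v, hv, hav⟩ := ((γ.oneSidedAnalytic (φ a)).1.eventually_contMDiffOn_Icc_right.and
          self_mem_nhdsWithin).exists
        have hlt : ∀ᶠ t in 𝓝[≥] a, φ a ≤ φ t ∧ φ t ≤ v :=
          hs.and ((hφ.continuous.tendsto a).eventually_le_const hav |>.filter_mono
            nhdsWithin_le_nhds)
        obtain ⟨w, hw, haw⟩ := (mem_nhdsGE_iff_exists_Icc_subset).1 hlt
        filter_upwards [(hφ a).1.eventually_contMDiffOn_Icc_right,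
          Ioo_mem_nhdsGT (lt_min ha.2 hw)] with b hb hb'
        exact local_step a b (φ a) v ha.1 hb'.1 (hb'.2.le.trans (min_le_left _ _)) hb
          (fun t ht => haw ⟨ht.1, ht.2.trans (hb'.2.le.trans (min_le_right _ _))⟩) hv
      · obtain ⟨v, hv, hav⟩ := ((γ.oneSidedAnalytic (φ a)).2.eventually_contMDiffOn_Icc_left.and
          self_mem_nhdsWithin).exists
        have hlt : ∀ᶠ t in 𝓝[≥] a, v ≤ φ t ∧ φ t ≤ φ a :=
          ((hφ.continuous.tendsto a).eventually_const_le hav |>.filter_mono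
            nhdsWithin_le_nhds).and hs
        obtain ⟨w, hw, haw⟩ := (mem_nhdsGE_iff_exists_Icc_subset).1 hlt
        filter_upwards [(hφ a).1.eventually_contMDiffOn_Icc_right,
          Ioo_mem_nhdsGT (lt_min ha.2 hw)] with b hb hb'
        exact local_step a b v (φ a) ha.1 hb'.1 (hb'.2.le.trans (min_le_left _ _)) hb
          (fun t ht => haw ⟨ht.1, ht.2.trans (hb'.2.le.trans (min_le_right _ _))⟩) hv
    · intro b hb
      rcases (hφ.eventually_le_or_ge b).2 with hs | hs
      · obtain ⟨v, hv, hav⟩ := ((γ.oneSidedAnalytic (φ b)).1.eventually_contMDiffOn_Icc_right.and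
          self_mem_nhdsWithin).exists
        have hlt : ∀ᶠ t in 𝓝[≤] b, φ b ≤ φ t ∧ φ t ≤ v :=
          hs.and ((hφ.continuous.tendsto b).eventually_le_const hav |>.filter_mono
            nhdsWithin_le_nhds)
        obtain ⟨w, hw, haw⟩ := (mem_nhdsLE_iff_exists_Icc_subset).1 hlt
        filter_upwards [(hφ b).2.eventually_contMDiffOn_Icc_left,
          Ioo_mem_nhdsLT (max_lt hb.1 hw)] with a ha ha'
        exact local_step a b (φ b) v ((le_max_left _ _).trans ha'.1.le) ha'.2 hb.2 ha
          (fun t ht => haw ⟨((le_max_right _ _).trans ha'.1.le).trans ht.1, ht.2⟩) hv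
      · obtain ⟨v, hv, hav⟩ := ((γ.oneSidedAnalytic (φ b)).2.eventually_contMDiffOn_Icc_left.and
          self_mem_nhdsWithin).exists
        have hlt : ∀ᶠ t in 𝓝[≤] b, v ≤ φ t ∧ φ t ≤ φ b :=
          ((hφ.continuous.tendsto b).eventually_const_le hav |>.filter_mono
            nhdsWithin_le_nhds).and hs
        obtain ⟨w, hw, haw⟩ := (mem_nhdsLE_iff_exists_Icc_subset).1 hlt
        filter_upwards [(hφ b).2.eventually_contMDiffOn_Icc_left,
          Ioo_mem_nhdsLT (max_lt hb.1 hw)] with a ha ha'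
        exact local_step a b v (φ b) ((le_max_left _ _).trans ha'.1.le) ha'.2 hb.2 ha
          (fun t ht => haw ⟨((le_max_right _ _).trans ha'.1.le).trans ht.1, ht.2⟩) hv
  -- Straightening φ over all of `[0,1]` gives the identity.
  refine key φ hφ hφ0 hφ1 (fun _ _ => rfl) γ' γ h fun t ht => ?_
  rw [straighten_of_mem ht, hφ0, hφ1]
  congr 1; ring

/-- Contracting a retraced piece `[m - a, m + b]` of a loop. -/
theorem thinEquivalent_of_retrace {γ' γ : PALoop E p} {m a b : ℝ} (ha : 0 ≤ a) (hb : 0 ≤ b)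
    (hma : 0 ≤ m - a) (hmb : m + b ≤ 1) {φ : ℝ → ℝ} (hφ : OneSidedAnalytic ℝ φ) (hφ0 : φ 0 = 0)
    (hφ1 : φ 1 = 1)
    (hretrace : ∀ s ∈ Icc (0 : ℝ) 1, γ'.1.extend (m - s * a) = γ'.1.extend (m + s * b))
    (hl : ∀ t ∈ Icc (0 : ℝ) 1, t ≤ m - a → γ'.1.extend t = γ.1.extend (φ t))
    (hm : ∀ t ∈ Icc (m - a) (m + b), γ'.1.extend (m - a) = γ.1.extend (φ t))
    (hr : ∀ t ∈ Icc (0 : ℝ) 1, m + b ≤ t → γ'.1.extend t = γ.1.extend (φ t)) :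
    ThinEquivalent γ' γ := by
  have hγ' := γ'.oneSidedAnalytic
  set g := γ'.1.extend with hg
  -- At stage s the loop stops at time m - s a, waits, and resumes at time m + s b; by `hretrace` it
  -- is at the same point at both times. The spur is thus cut off from its tip at m down to its
  -- foot. The breaks of the construction lie on the lines t = m - s a, t = m and t = m + s b.
  set H : ℝ × ℝ → M := fun x =>
    if x.2 ≤ m then g (min x.2 (m - x.1 * a)) else g (max x.2 (m + x.1 * b)) with hH
  have hHr : ∀ s ∈ Icc (0 : ℝ) 1, ∀ t, m ≤ t → H (s, t) = g (max t (m + s * b)) := by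
    intro s hs t ht
    simp only [hH]
    split_ifs with h
    · obtain rfl := le_antisymm h ht
      rw [min_eq_right (by nlinarith [hs.1]), max_eq_right (by nlinarith [hs.1]), hretrace s hs]
    · rfl
  have hHl : ∀ s t, t ≤ m → H (s, t) = g (min t (m - s * a)) := fun s t ht => if_pos ht
  have hg1 : g 1 = p := Path.extend_one _
  have hg0 : g 0 = p := Path.extend_zero _
  obtain ⟨γ₁, h₁⟩ := exists_palCompLoop γ hφ hφ0 hφ1
  refine (Relation.EqvGen.rel _ _ ?_ : ThinEquivalent γ' γ₁).trans _ _ _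
    (thinEquivalent_of_comp hφ hφ0 hφ1 h₁)
  refine thinHomotopic_of_polyAnalyticOn (H := H) ?_ ?_ ?_ ?_ ?_ ?_
  · refine .split 0 1 m (.split a 1 m ?_ ?_) (.split (-b) 1 m ?_ ?_)
    · refine .of_affine hγ' 0 1 0 (fun x hx => hx.1.1) fun x hx => ?_
      have h1 : 0 * x.1 + 1 * x.2 ≤ m := hx.1.2
      have h2 : a * x.1 + 1 * x.2 ≤ m := hx.2
      rw [hHl x.1 x.2 (by linarith), min_eq_left (by linarith)]; simp
    · refine .of_affine hγ' (-a) 0 m (fun x hx => hx.1.1) fun x hx => ?_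
      have h1 : 0 * x.1 + 1 * x.2 ≤ m := hx.1.2
      have h2 : m ≤ a * x.1 + 1 * x.2 := hx.2
      rw [hHl x.1 x.2 (by linarith), min_eq_right (by linarith)]; congr 1; ring
    · refine .of_affine hγ' b 0 m (fun x hx => hx.1.1) fun x hx => ?_
      have h1 : m ≤ 0 * x.1 + 1 * x.2 := hx.1.2
      have h2 : -b * x.1 + 1 * x.2 ≤ m := hx.2
      rw [hHr x.1 hx.1.1.1 x.2 (by linarith), max_eq_right (by linarith)]; congr 1; ring
    · refine .of_affine hγ' 0 1 0 (fun x hx => hx.1.1) fun x hx => ?_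
      have h1 : m ≤ 0 * x.1 + 1 * x.2 := hx.1.2
      have h2 : m ≤ -b * x.1 + 1 * x.2 := hx.2
      rw [hHr x.1 hx.1.1.1 x.2 (by linarith), max_eq_left (by linarith)]; simp
  · intro t ht
    rcases le_total t m with h | h
    · rw [hHl 0 t h, min_eq_left (by linarith)]
    · rw [hHr 0 (by simp) t h, max_eq_left (by linarith)]
  · intro t ht
    rw [h₁ t ht]
    rcases le_total t m with h | h
    · rw [hHl 1 t h, one_mul]
      rcases le_total t (m - a) with h' | h'
      · rw [min_eq_left h', hl t ht h']
      · rw [min_eq_right h', hm t ⟨h', by linarith⟩]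
    · rw [hHr 1 (by simp) t h, one_mul]
      rcases le_total t (m + b) with h' | h'
      · rw [max_eq_right h', ← hm t ⟨by linarith, h'⟩]
        simpa using (hretrace 1 (by simp)).symm
      · rw [max_eq_left h', hr t ht h']
  · intro s hs
    rw [hHl s 0 (by linarith), min_eq_left (by nlinarith [hs.1, hs.2]), hg0]
  · intro s hs
    rw [hHr s hs 1 (by linarith), max_eq_left (by nlinarith [hs.1, hs.2]), hg1]
  · intro s _ t _
    left
    have hr : ∀ u, g u ∈ range γ'.1 := fun u => by
      rw [← γ'.1.extend_range]; exact mem_range_self u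
    simp only [hH]
    split_ifs <;> exact hr _

/-- The constants are read off from the halvings in `Path.trans`: m is the time of the tip of the
retraced path, and a and b are the durations of the way out and the way back. The function φ waits
on `[m - a, m + b]` and matches the speeds of the outer paths elsewhere. When both outer paths are
absent the target loop is constant and the identity serves. -/
theorem thinEquivalent_of_isRetracing {γ' γ : PALoop E p} (h : IsRetracing E γ'.1 γ.1) :
    ThinEquivalent γ' γ := by
  obtain ⟨γ', hγ'⟩ := γ'
  obtain ⟨γ, hγ⟩ := γ
  simp only at h
  cases h with
  | middle α₁ β α₂ h₁ hβ h₂ =>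
    refine thinEquivalent_of_retrace (m := 3 / 4) (a := 1 / 4) (b := 1 / 8)
      (φ := fun t => max (min t (1 / 2)) (4 * t + (-3))) (by norm_num) (by norm_num)
      (by norm_num) (by norm_num) ?_ (by norm_num) (by norm_num) ?_ ?_ ?_ ?_
    · exact (oneSidedAnalytic_id.min (oneSidedAnalytic_const _)).max (oneSidedAnalytic_affine _ _)
    · intro s hs
      simp only
      rw [Path.extend_trans_of_half_le _ _ (by linarith [hs.2]),
        Path.extend_trans_of_le_half _ _ (by linarith [hs.1]),
        Path.extend_trans_of_half_le _ _ (by linarith [hs.1]),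
        Path.extend_trans_of_half_le _ _ (by linarith [hs.1]),
        Path.extend_trans_of_le_half _ _ (by linarith [hs.2]), Path.extend_symm_apply]
      congr 1; ring
    · intro t ht ht'
      simp only
      rw [min_eq_left (by linarith), max_eq_left (by linarith),
        Path.extend_trans_of_le_half _ _ (by linarith),
        Path.extend_trans_of_le_half _ _ (by linarith)]
    · intro t ht
      simp only
      rw [min_eq_right (by linarith [ht.1]), max_eq_left (by linarith [ht.2]),
        Path.extend_trans_of_le_half _ _ (by norm_num),
        Path.extend_trans_of_le_half _ _ (by norm_num)]
      norm_num
    · intro t ht ht'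
      simp only
      rw [min_eq_right (by linarith), max_eq_right (by linarith),
        Path.extend_trans_of_half_le _ _ (by linarith),
        Path.extend_trans_of_half_le _ _ (by linarith),
        Path.extend_trans_of_half_le _ _ (by linarith),
        Path.extend_trans_of_half_le _ _ (by linarith)]
      congr 1; ring
  | start β _ hβ h₂ =>
    refine thinEquivalent_of_retrace (m := 1 / 2) (a := 1 / 2) (b := 1 / 4)
      (φ := fun t => max 0 (4 * t + (-3))) (by norm_num) (by norm_num)
      (by norm_num) (by norm_num) ?_ (by norm_num) (by norm_num) ?_ ?_ ?_ ?_
    · exact (oneSidedAnalytic_const _).max (oneSidedAnalytic_affine _ _)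
    · intro s hs
      simp only
      rw [Path.extend_trans_of_le_half _ _ (by linarith [hs.1]),
        Path.extend_trans_of_half_le _ _ (by linarith [hs.1]),
        Path.extend_trans_of_le_half _ _ (by linarith [hs.2]), Path.extend_symm_apply]
      congr 1; ring
    · intro t ht ht'
      obtain rfl : t = 0 := by linarith [ht.1]
      simp only
      norm_num
    · intro t ht
      simp only
      rw [max_eq_left (by linarith [ht.2])]
      norm_num
    · intro t ht ht'
      simp only
      rw [max_eq_right (by linarith), Path.extend_trans_of_half_le _ _ (by linarith),
        Path.extend_trans_of_half_le _ _ (by linarith)]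
      congr 1; ring
  | finish _ β h₁ hβ =>
    refine thinEquivalent_of_retrace (m := 3 / 4) (a := 1 / 4) (b := 1 / 4)
      (φ := fun t => min 1 (2 * t)) (by norm_num) (by norm_num)
      (by norm_num) (by norm_num) ?_ (by norm_num) (by norm_num) ?_ ?_ ?_ ?_
    · exact (oneSidedAnalytic_const _).min (oneSidedAnalytic_const_mul _)
    · intro s hs
      simp only
      rw [Path.extend_trans_of_half_le _ _ (by linarith [hs.2]),
        Path.extend_trans_of_le_half _ _ (by linarith [hs.1]),
        Path.extend_trans_of_half_le _ _ (by linarith [hs.1]),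
        Path.extend_trans_of_half_le _ _ (by linarith [hs.1]), Path.extend_symm_apply]
      congr 1; ring
    · intro t ht ht'
      simp only
      rw [min_eq_right (by linarith), Path.extend_trans_of_le_half _ _ (by linarith)]
    · intro t ht
      simp only
      rw [min_eq_left (by linarith [ht.1]), Path.extend_trans_of_le_half _ _ (by norm_num)]
      norm_num
    · intro t ht ht'
      obtain rfl : t = 1 := by linarith [ht.2]
      simp only
      norm_num
  | whole β hβ =>
    refine thinEquivalent_of_retrace (m := 1 / 2) (a := 1 / 2) (b := 1 / 2)
      (φ := fun t => t) (by norm_num) (by norm_num)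
      (by norm_num) (by norm_num) oneSidedAnalytic_id rfl rfl ?_ ?_ ?_ ?_
    · intro s hs
      simp only
      rw [Path.extend_trans_of_le_half _ _ (by linarith [hs.1]),
        Path.extend_trans_of_half_le _ _ (by linarith [hs.1]), Path.extend_symm_apply]
      congr 1; ring
    · intro t ht ht'
      obtain rfl : t = 0 := by linarith [ht.1]
      simp
    · intro t ht
      simp
    · intro t ht ht'
      obtain rfl : t = 1 := by linarith [ht.2]
      simp

theorem thinEquivalent_of_isReparametrizationOf {γ' γ : PALoop E p}
    (h : IsReparametrizationOf γ' γ) : ThinEquivalent γ' γ := by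
  obtain ⟨φ, hφ, hγ⟩ := h
  have hext : ∀ t, ((φ.extend t : I) : ℝ) =
      (φ.map continuous_subtype_val : Path (0 : ℝ) 1).extend t := fun t => rfl
  have hpa : OneSidedAnalytic ℝ fun t => ((φ.extend t : I) : ℝ) :=
    PiecewiseAnalytic.oneSidedAnalytic (γ := (φ.map continuous_subtype_val : Path (0 : ℝ) 1)) hφ.1
  refine thinEquivalent_of_comp hpa (by simp) (by simp) fun t ht => ?_
  rw [Path.extend_apply _ ht, hγ, Path.extend_extends', Path.extend_apply _ ht]

theorem RetraceEquivalent.thinEquivalent {γ₀ γ₁ : PALoop E p} (h : RetraceEquivalent γ₀ γ₁) :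
    ThinEquivalent γ₀ γ₁ := by
  induction h with
  | rel _ _ h => exact h.elim thinEquivalent_of_isReparametrizationOf thinEquivalent_of_isRetracing
  | refl _ => exact .refl _
  | symm _ _ _ ih => exact ih.symm
  | trans _ _ _ _ _ ih₁ ih₂ => exact ih₁.trans _ _ _ ih₂

end

end ThinLoops

/-! ### Retrace equivalence of paths inside loops -/

namespace ThinLoops

open Set Filter Topology

section

variable {E : Type*} [NormedAddCommGroup E] [NormedSpace ℝ E]
  {M : Type*} [TopologicalSpace M] [ChartedSpace E M] {p : M}

variable (E) in
/-- Retrace equivalence of loops that are not bundled with their piecewise analyticity. -/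
def LoopRel (γ γ' : Path p p) : Prop :=
  ∃ h h', RetraceEquivalent (⟨γ, h⟩ : PALoop E p) ⟨γ', h'⟩

theorem LoopRel.symm {γ γ' : Path p p} : LoopRel E γ γ' → LoopRel E γ' γ :=
  fun ⟨h, h', e⟩ => ⟨h', h, Relation.EqvGen.symm _ _ e⟩

theorem LoopRel.trans {γ γ' γ'' : Path p p} : LoopRel E γ γ' → LoopRel E γ' γ'' → LoopRel E γ γ'' :=
  fun ⟨h, _, e⟩ ⟨_, h', e'⟩ => ⟨h, h', Relation.EqvGen.trans _ _ _ e e'⟩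

variable (E p) in
/-- Two paths are related if exchanging them in a loop based at `p` does not change its retrace
equivalence class. -/
def PathRel {x y : M} (α β : Path x y) : Prop :=
  ∀ (a : Path p x) (b : Path y p), OneSidedAnalytic E a.extend → OneSidedAnalytic E b.extend →
    LoopRel E ((a.trans α).trans b) ((a.trans β).trans b)

theorem PathRel.symm {x y : M} {α β : Path x y} (h : PathRel E p α β) : PathRel E p β α :=
  fun a b ha hb => (h a b ha hb).symm

theorem PathRel.trans {x y : M} {α β γ : Path x y} (h : PathRel E p α β) (h' : PathRel E p β γ) :
    PathRel E p α γ :=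
  fun a b ha hb => (h a b ha hb).trans (h' a b ha hb)

variable [IsManifold 𝓘(ℝ, E) ω M]

theorem loopRel_refl {γ : Path p p} (h : OneSidedAnalytic E γ.extend) : LoopRel E γ γ :=
  ⟨h.piecewiseAnalytic, h.piecewiseAnalytic, .refl _⟩

theorem PathRel.refl {x y : M} {α : Path x y} (h : OneSidedAnalytic E α.extend) :
    PathRel E p α α :=
  fun _ _ ha hb => loopRel_refl ((ha.trans h).trans hb)

theorem loopRel_of_comp {γ γ' : Path p p} (hγ : OneSidedAnalytic E γ.extend) {φ : ℝ → ℝ}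
    (hφ : OneSidedAnalytic ℝ φ) (hφ0 : φ 0 = 0) (hφ1 : φ 1 = 1)
    (hφ01 : ∀ t, 0 < t → t < 1 → 0 < φ t ∧ φ t < 1)
    (h : ∀ t ∈ Icc (0 : ℝ) 1, γ'.extend t = γ.extend (φ t)) : LoopRel E γ' γ := by
  have hmem : ∀ t ∈ Icc (0 : ℝ) 1, φ t ∈ Icc (0 : ℝ) 1 := by
    intro t ht
    rcases ht.1.eq_or_lt with rfl | h0
    · simp [hφ0]
    rcases ht.2.eq_or_lt with rfl | h1
    · simp [hφ1]
    exact ⟨(hφ01 t h0 h1).1.le, (hφ01 t h0 h1).2.le⟩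
  have hγ' : OneSidedAnalytic E γ'.extend := oneSidedAnalytic_extend (hγ.comp hφ) h
  let Φ : Path (0 : I) 1 :=
    { toFun := fun t => ⟨φ t, hmem t t.2⟩
      continuous_toFun := (hφ.continuous.comp continuous_subtype_val).subtype_mk _
      source' := Subtype.ext hφ0
      target' := Subtype.ext hφ1 }
  refine ⟨hγ'.piecewiseAnalytic, hγ.piecewiseAnalytic, .rel _ _ (.inl ⟨Φ, ⟨?_, ?_⟩, ?_⟩)⟩
  · refine OneSidedAnalytic.piecewiseAnalytic ?_
    have : (fun t => ((Φ.extend t : I) : ℝ)) = fun t => φ (clamp t) := by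
      funext t
      rw [← extend_clamp, Path.extend_apply _ (clamp_mem t)]; rfl
    rw [this]
    exact hφ.comp oneSidedAnalytic_clamp
  · intro t h0 h1
    exact hφ01 t h0 h1
  · intro t
    have := h t t.2
    rw [Path.extend_extends'] at this
    rw [this, Path.extend_apply _ (hmem t t.2)]; rfl

/-- With paths a and b on both sides, φ acts only in the middle quarter of the loop, where the total
reparametrization takes values between 1/4 and 1/2. So the requirement of staying strictly between 0
and 1 is automatic, φ may return to its end values, and overshooting is repaired by clamping. -/
theorem PathRel.of_comp {x y : M} {α β : Path x y} (hα : OneSidedAnalytic E α.extend) {φ : ℝ → ℝ}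
    (hφ : OneSidedAnalytic ℝ φ) (hφ0 : φ 0 ≤ 0) (hφ1 : 1 ≤ φ 1)
    (h : ∀ t ∈ Icc (0 : ℝ) 1, β.extend t = α.extend (φ t)) : PathRel E p β α := by
  intro a b ha hb
  have hψ := oneSidedAnalytic_clamp.comp hφ
  set ψ : ℝ → ℝ := fun t => clamp (φ t) with hψdef
  have hψ0 : ψ 0 = 0 := by simp only [hψdef, clamp]; exact max_eq_left ((min_le_right _ _).trans hφ0)
  have hψ1 : ψ 1 = 1 := by simp only [hψdef, clamp]; rw [min_eq_left hφ1]; norm_num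
  have hψ' : ∀ t ∈ Icc (0 : ℝ) 1, β.extend t = α.extend (ψ t) := fun t ht => by
    rw [h t ht, ← extend_clamp]
  have hmem : ∀ t, ψ t ∈ Icc (0 : ℝ) 1 := fun t => clamp_mem _
  set χ : ℝ → ℝ := fun t => if t ≤ 1 / 4 then t else if t ≤ 1 / 2 then
    4⁻¹ * ψ (4 * t + (-1)) + 1 / 4 else t with hχ
  have hχa : OneSidedAnalytic ℝ χ := by
    refine oneSidedAnalytic_id.if_le (OneSidedAnalytic.if_le ?_ oneSidedAnalytic_id ?_) ?_
    · exact (oneSidedAnalytic_affine 4⁻¹ (1 / 4)).comp (hψ.comp (oneSidedAnalytic_affine 4 (-1)))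
    · norm_num [hψ1]
    · norm_num [hψ0]
  refine loopRel_of_comp ((ha.trans hα).trans hb) hχa (by norm_num [hχ]) (by norm_num [hχ]) ?_ ?_
  · intro t h0 h1
    have h2 := hmem (4 * t + (-1))
    simp only [hχ]
    split_ifs
    · exact ⟨h0, h1⟩
    · exact ⟨by linarith [h2.1], by linarith [h2.2]⟩
    · exact ⟨h0, h1⟩
  · intro t ht
    have h2 := hmem (4 * t + (-1))
    simp only [hχ]
    rcases le_or_gt t (1 / 4) with h4 | h4
    · rw [if_pos h4]
      simp only [extend_trans]
      rw [if_pos (by linarith), if_pos (by linarith), if_pos (by linarith), if_pos (by linarith)]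
    rcases le_or_gt t (1 / 2) with h3 | h3
    · rw [if_neg (not_le.2 h4), if_pos h3]
      simp only [extend_trans]
      rw [if_pos h3, if_neg (by linarith), if_pos (by linarith [h2.2]),
        hψ' _ ⟨by linarith, by linarith⟩]
      -- The first branch occurs exactly when ψ takes the value 0: there the concatenation is at
      -- time 1/4, which `Path.trans` assigns to a instead of α.
      split_ifs with h5
      · have : ψ (4 * t + -1) = 0 := by linarith [h2.1]
        have e : ψ (2 * (2 * t) - 1) = 0 := by rw [← this]; congr 1; ring
        rw [e, this]
        norm_num
      · congr 1
        have e : ψ (2 * (2 * t) - 1) = ψ (4 * t + -1) := by congr 1; ring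
        rw [e]; ring
    · rw [if_neg (not_le.2 h4), if_neg (not_le.2 h3)]
      simp only [extend_trans]
      rw [if_neg (not_le.2 h3), if_neg (not_le.2 h3)]

/-- Piecewise affine reparametrizations below are written as linear combinations of hinges: the
coefficient at c is the jump of the slope at c. -/
theorem oneSidedAnalytic_hinge (c : ℝ) : OneSidedAnalytic ℝ fun t : ℝ => max 0 (t - c) :=
  (oneSidedAnalytic_const 0).max (oneSidedAnalytic_id.sub (oneSidedAnalytic_const c))

theorem hinge_of_le {t c : ℝ} (h : t ≤ c) : max 0 (t - c) = 0 := max_eq_left (by linarith)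

theorem hinge_of_ge {t c : ℝ} (h : c ≤ t) : max 0 (t - c) = t - c := max_eq_right (by linarith)

section ThreePaths

variable {X : Type*} [TopologicalSpace X] {w x y z : X} (α : Path w x) (β : Path x y)
  (γ : Path y z) {t : ℝ}

theorem extend_trans_trans_left (h : t ≤ 1 / 4) :
    ((α.trans β).trans γ).extend t = α.extend (4 * t) := by
  rw [Path.extend_trans_of_le_half _ _ (by linarith), Path.extend_trans_of_le_half _ _ (by linarith)]
  congr 1; ring

theorem extend_trans_trans_middle (h : 1 / 4 ≤ t) (h' : t ≤ 1 / 2) :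
    ((α.trans β).trans γ).extend t = β.extend (4 * t - 1) := by
  rw [Path.extend_trans_of_le_half _ _ (by linarith), Path.extend_trans_of_half_le _ _ (by linarith)]
  congr 1; ring

theorem extend_trans_trans'_middle (h : 1 / 2 ≤ t) (h' : t ≤ 3 / 4) :
    (α.trans (β.trans γ)).extend t = β.extend (4 * t - 2) := by
  rw [Path.extend_trans_of_half_le _ _ (by linarith), Path.extend_trans_of_le_half _ _ (by linarith)]
  congr 1; ring

theorem extend_trans_trans'_right (h : 3 / 4 ≤ t) :
    (α.trans (β.trans γ)).extend t = γ.extend (4 * t - 3) := by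
  rw [Path.extend_trans_of_half_le _ _ (by linarith), Path.extend_trans_of_half_le _ _ (by linarith)]
  congr 1; ring

end ThreePaths

/-- Rebracketing lets β be absorbed into the closing path b, to which `h` applies. Slopes 1, 2, 1/2
carry (a·(α·β))·b to (a·α)·(β·b). -/
theorem PathRel.trans_right {x y z : M} {α α' : Path x y} (hα : OneSidedAnalytic E α.extend)
    (hα' : OneSidedAnalytic E α'.extend) (h : PathRel E p α α') {β : Path y z}
    (hβ : OneSidedAnalytic E β.extend) : PathRel E p (α.trans β) (α'.trans β) := by
  intro a b ha hb
  have key : ∀ α : Path x y, OneSidedAnalytic E α.extend →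
      LoopRel E ((a.trans (α.trans β)).trans b) ((a.trans α).trans (β.trans b)) := by
    intro α hα
    refine loopRel_of_comp ((ha.trans hα).trans (hβ.trans hb))
      (φ := fun t => t + max 0 (t - 1 / 4) + (-3 / 2) * max 0 (t - 1 / 2)) ?_ (by norm_num)
      (by norm_num) ?_ ?_
    · exact (oneSidedAnalytic_id.add (oneSidedAnalytic_hinge _)).add
        ((oneSidedAnalytic_const_mul _).comp (oneSidedAnalytic_hinge _))
    · intro t h0 h1
      rcases le_total t (1 / 4) with h4 | h4
      · simp only [hinge_of_le h4, hinge_of_le (h4.trans (by norm_num : (1 : ℝ) / 4 ≤ 1 / 2))]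
        constructor <;> linarith
      rcases le_total t (1 / 2) with h2 | h2
      · simp only [hinge_of_ge h4, hinge_of_le h2]
        constructor <;> linarith
      · simp only [hinge_of_ge h4, hinge_of_ge h2]
        constructor <;> linarith
    · intro t ht
      rcases le_total t (1 / 4) with h4 | h4
      · simp only [hinge_of_le h4, hinge_of_le (h4.trans (by norm_num : (1 : ℝ) / 4 ≤ 1 / 2))]
        rw [extend_trans_trans_left _ _ _ h4, extend_trans_trans_left _ _ _ (by linarith)]
        congr 1; ring
      rcases le_total t (1 / 2) with h2 | h2
      · simp only [hinge_of_ge h4, hinge_of_le h2]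
        rw [extend_trans_trans_middle _ _ _ h4 h2]
        rcases le_total t (3 / 8) with h3 | h3
        · rw [Path.extend_trans_of_le_half _ _ (by linarith),
            extend_trans_trans_middle _ _ _ (by linarith) (by linarith)]
          congr 1; ring
        · rw [Path.extend_trans_of_half_le _ _ (by linarith),
            extend_trans_trans'_middle _ _ _ (by linarith) (by linarith)]
          congr 1; ring
      · simp only [hinge_of_ge h4, hinge_of_ge h2]
        rw [Path.extend_trans_of_half_le _ _ h2, extend_trans_trans'_right _ _ _ (by linarith)]
        congr 1; ring
  exact (key α hα).trans ((h a (β.trans b) ha (hβ.trans hb)).trans (key α' hα').symm)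

/-- Here α is absorbed into the opening path a; the rebracketing has slopes 1/2, 1, 2, 1. -/
theorem PathRel.trans_left {x y z : M} {α : Path x y} (hα : OneSidedAnalytic E α.extend)
    {β β' : Path y z} (hβ : OneSidedAnalytic E β.extend)
    (hβ' : OneSidedAnalytic E β'.extend) (h : PathRel E p β β') :
    PathRel E p (α.trans β) (α.trans β') := by
  intro a b ha hb
  have key : ∀ β : Path y z, OneSidedAnalytic E β.extend →
      LoopRel E ((a.trans (α.trans β)).trans b) (((a.trans α).trans β).trans b) := by
    intro β hβ
    refine loopRel_of_comp (((ha.trans hα).trans hβ).trans hb)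
      (φ := fun t => 1 / 2 * t + 1 / 2 * max 0 (t - 1 / 4) + max 0 (t - 3 / 8) +
        (-1) * max 0 (t - 1 / 2)) ?_ (by norm_num) (by norm_num) ?_ ?_
    · exact (((oneSidedAnalytic_const_mul _).add
        ((oneSidedAnalytic_const_mul _).comp (oneSidedAnalytic_hinge _))).add
        (oneSidedAnalytic_hinge _)).add
        ((oneSidedAnalytic_const_mul _).comp (oneSidedAnalytic_hinge _))
    · intro t h0 h1
      rcases le_total t (1 / 4) with h4 | h4
      · simp only [hinge_of_le h4, hinge_of_le (h4.trans (by norm_num : (1 : ℝ) / 4 ≤ 1 / 2)),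
          hinge_of_le (h4.trans (by norm_num : (1 : ℝ) / 4 ≤ 3 / 8))]
        constructor <;> linarith
      rcases le_total t (3 / 8) with h3 | h3
      · simp only [hinge_of_ge h4, hinge_of_le h3,
          hinge_of_le (h3.trans (by norm_num : (3 : ℝ) / 8 ≤ 1 / 2))]
        constructor <;> linarith
      rcases le_total t (1 / 2) with h2 | h2
      · simp only [hinge_of_ge h4, hinge_of_ge h3, hinge_of_le h2]
        constructor <;> linarith
      · simp only [hinge_of_ge h4, hinge_of_ge h3, hinge_of_ge h2]
        constructor <;> linarith
    · intro t ht
      rcases le_total t (1 / 4) with h4 | h4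
      · simp only [hinge_of_le h4, hinge_of_le (h4.trans (by norm_num : (1 : ℝ) / 4 ≤ 1 / 2)),
          hinge_of_le (h4.trans (by norm_num : (1 : ℝ) / 4 ≤ 3 / 8))]
        rw [extend_trans_trans_left _ _ _ h4, extend_trans_trans_left _ _ _ (by linarith),
          Path.extend_trans_of_le_half _ _ (by linarith)]
        congr 1; ring
      rcases le_total t (3 / 8) with h3 | h3
      · simp only [hinge_of_ge h4, hinge_of_le h3,
          hinge_of_le (h3.trans (by norm_num : (3 : ℝ) / 8 ≤ 1 / 2))]
        rw [extend_trans_trans_middle _ _ _ h4 (by linarith),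
          extend_trans_trans_left _ _ _ (by linarith), Path.extend_trans_of_le_half _ _ (by linarith),
          Path.extend_trans_of_half_le _ _ (by linarith)]
        congr 1; ring
      rcases le_total t (1 / 2) with h2 | h2
      · simp only [hinge_of_ge h4, hinge_of_ge h3, hinge_of_le h2]
        rw [extend_trans_trans_middle _ _ _ h4 h2,
          extend_trans_trans_middle _ _ _ (by linarith) (by linarith),
          Path.extend_trans_of_half_le _ _ (by linarith)]
        congr 1; ring
      · simp only [hinge_of_ge h4, hinge_of_ge h3, hinge_of_ge h2]
        rw [Path.extend_trans_of_half_le _ _ h2, Path.extend_trans_of_half_le _ _ (by linarith)]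
        congr 1; ring
  exact (key β hβ).trans ((h (a.trans α) b (ha.trans hα) hb).trans (key β' hβ').symm)

/-- After rebracketing, this is one retracing with both outer paths present. The constant path left
in the middle is removed by a reparametrization that waits at 1/2, an interior time, as is allowed.
-/
theorem PathRel.trans_symm_self {x y : M} {β : Path x y} (hβ : OneSidedAnalytic E β.extend) :
    PathRel E p (β.trans β.symm) (Path.refl x) := by
  intro a b ha hb
  have h1 : LoopRel E ((a.trans (β.trans β.symm)).trans b)
      (a.trans (β.trans (β.symm.trans b))) := by
    refine loopRel_of_comp (ha.trans (hβ.trans (hβ.symm.trans hb)))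
      (φ := fun t => 2 * t + (-1) * max 0 (t - 3 / 8) + (-3 / 4) * max 0 (t - 1 / 2)) ?_
      (by norm_num) (by norm_num) ?_ ?_
    · exact ((oneSidedAnalytic_const_mul _).add
        ((oneSidedAnalytic_const_mul _).comp (oneSidedAnalytic_hinge _))).add
        ((oneSidedAnalytic_const_mul _).comp (oneSidedAnalytic_hinge _))
    · intro t h0 h1
      rcases le_total t (3 / 8) with h3 | h3
      · simp only [hinge_of_le h3, hinge_of_le (h3.trans (by norm_num : (3 : ℝ) / 8 ≤ 1 / 2))]
        constructor <;> linarith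
      rcases le_total t (1 / 2) with h2 | h2
      · simp only [hinge_of_ge h3, hinge_of_le h2]
        constructor <;> linarith
      · simp only [hinge_of_ge h3, hinge_of_ge h2]
        constructor <;> linarith
    · intro t ht
      rcases le_total t (3 / 8) with h3 | h3
      · simp only [hinge_of_le h3, hinge_of_le (h3.trans (by norm_num : (3 : ℝ) / 8 ≤ 1 / 2))]
        rcases le_total t (1 / 4) with h4 | h4
        · rw [extend_trans_trans_left _ _ _ h4, Path.extend_trans_of_le_half _ _ (by linarith)]
          congr 1; ring
        · rw [extend_trans_trans_middle _ _ _ h4 (by linarith),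
            extend_trans_trans'_middle _ _ _ (by linarith) (by linarith),
            Path.extend_trans_of_le_half _ _ (by linarith)]
          congr 1; ring
      rcases le_total t (1 / 2) with h2 | h2
      · simp only [hinge_of_ge h3, hinge_of_le h2]
        rw [extend_trans_trans_middle _ _ _ (by linarith) h2,
          extend_trans_trans'_right _ _ _ (by linarith),
          Path.extend_trans_of_half_le _ _ (by linarith),
          Path.extend_trans_of_le_half _ _ (by linarith)]
        congr 1; ring
      · simp only [hinge_of_ge h3, hinge_of_ge h2]
        rw [Path.extend_trans_of_half_le _ _ h2, extend_trans_trans'_right _ _ _ (by linarith),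
          Path.extend_trans_of_half_le _ _ (by linarith)]
        congr 1; ring
  have h2 : LoopRel E (a.trans (β.trans (β.symm.trans b))) (a.trans b) :=
    ⟨(ha.trans (hβ.trans (hβ.symm.trans hb))).piecewiseAnalytic, (ha.trans hb).piecewiseAnalytic,
      .rel _ _ (.inr (.middle a β b ha.piecewiseAnalytic hβ.piecewiseAnalytic
        hb.piecewiseAnalytic))⟩
  have h3 : LoopRel E ((a.trans (Path.refl x)).trans b) (a.trans b) := by
    refine loopRel_of_comp (ha.trans hb)
      (φ := fun t => 2 * t + (-2) * max 0 (t - 1 / 4) + max 0 (t - 1 / 2)) ?_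
      (by norm_num) (by norm_num) ?_ ?_
    · exact ((oneSidedAnalytic_const_mul _).add
        ((oneSidedAnalytic_const_mul _).comp (oneSidedAnalytic_hinge _))).add
        (oneSidedAnalytic_hinge _)
    · intro t h0 h1
      rcases le_total t (1 / 4) with h4 | h4
      · simp only [hinge_of_le h4, hinge_of_le (h4.trans (by norm_num : (1 : ℝ) / 4 ≤ 1 / 2))]
        constructor <;> linarith
      rcases le_total t (1 / 2) with h2 | h2
      · simp only [hinge_of_ge h4, hinge_of_le h2]
        constructor <;> linarith
      · simp only [hinge_of_ge h4, hinge_of_ge h2]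
        constructor <;> linarith
    · intro t ht
      rcases le_total t (1 / 4) with h4 | h4
      · simp only [hinge_of_le h4, hinge_of_le (h4.trans (by norm_num : (1 : ℝ) / 4 ≤ 1 / 2))]
        rw [extend_trans_trans_left _ _ _ h4, Path.extend_trans_of_le_half _ _ (by linarith)]
        congr 1; ring
      rcases le_total t (1 / 2) with h2 | h2
      · simp only [hinge_of_ge h4, hinge_of_le h2]
        rw [extend_trans_trans_middle _ _ _ h4 h2, Path.extend_trans_of_le_half _ _ (by linarith),
          Path.extend_of_one_le a (by linarith)]
        rfl
      · simp only [hinge_of_ge h4, hinge_of_ge h2]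
        rw [Path.extend_trans_of_half_le _ _ h2, Path.extend_trans_of_half_le _ _ (by linarith)]
        congr 1; ring
  exact h1.trans (h2.trans h3.symm)

/-- Constant paths at `p` have to be attached at both ends of a loop. No reparametrization does
this, since it would wait at 0 or 1; instead a constant path is inserted as a retraced one at the
start and at the finish. -/
theorem PathRel.loopRel {α β : Path p p} (hα : OneSidedAnalytic E α.extend)
    (hβ : OneSidedAnalytic E β.extend) (h : PathRel E p α β) : LoopRel E α β := by
  have hr := oneSidedAnalytic_refl (E := E) p
  have hr' := hr.piecewiseAnalytic
  have key : ∀ α : Path p p, OneSidedAnalytic E α.extend →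
      LoopRel E α (((Path.refl p).trans α).trans (Path.refl p)) := by
    intro α hα
    have h1 : OneSidedAnalytic E (α.trans ((Path.refl p).trans (Path.refl p).symm)).extend :=
      hα.trans (hr.trans hr.symm)
    have h2 := hr.trans (hr.symm.trans h1)
    have e1 : LoopRel E (α.trans ((Path.refl p).trans (Path.refl p).symm)) α :=
      ⟨h1.piecewiseAnalytic, hα.piecewiseAnalytic,
        .rel _ _ (.inr (.finish α (Path.refl p) hα.piecewiseAnalytic hr'))⟩
    have e2 : LoopRel E ((Path.refl p).trans ((Path.refl p).symm.trans
        (α.trans ((Path.refl p).trans (Path.refl p).symm))))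
        (α.trans ((Path.refl p).trans (Path.refl p).symm)) :=
      ⟨h2.piecewiseAnalytic, h1.piecewiseAnalytic,
        .rel _ _ (.inr (.start (Path.refl p) _ hr' h1.piecewiseAnalytic))⟩
    refine e1.symm.trans (e2.symm.trans ?_)
    refine loopRel_of_comp ((hr.trans hα).trans hr)
      (φ := fun t => 1 / 3 * t + 5 / 3 * max 0 (t - 3 / 4) + 2 * max 0 (t - 7 / 8)) ?_
      (by norm_num) (by norm_num) ?_ ?_
    · exact ((oneSidedAnalytic_const_mul _).add
        ((oneSidedAnalytic_const_mul _).comp (oneSidedAnalytic_hinge _))).add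
        ((oneSidedAnalytic_const_mul _).comp (oneSidedAnalytic_hinge _))
    · intro t h0 h1
      rcases le_total t (3 / 4) with h4 | h4
      · simp only [hinge_of_le h4, hinge_of_le (h4.trans (by norm_num : (3 : ℝ) / 4 ≤ 7 / 8))]
        constructor <;> linarith
      rcases le_total t (7 / 8) with h2 | h2
      · simp only [hinge_of_ge h4, hinge_of_le h2]
        constructor <;> linarith
      · simp only [hinge_of_ge h4, hinge_of_ge h2]
        constructor <;> linarith
    · intro t ht
      rw [Path.refl_symm, Path.refl_trans_refl]
      rcases le_total t (3 / 4) with h4 | h4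
      · simp only [hinge_of_le h4, hinge_of_le (h4.trans (by norm_num : (3 : ℝ) / 4 ≤ 7 / 8))]
        rw [extend_trans_trans_left _ _ _ (by linarith)]
        rcases le_total t (1 / 2) with h2 | h2
        · rw [Path.extend_trans_of_le_half _ _ h2]; rfl
        · rw [extend_trans_trans'_middle _ _ _ h2 h4]; rfl
      rcases le_total t (7 / 8) with h2 | h2
      · simp only [hinge_of_ge h4, hinge_of_le h2]
        rw [extend_trans_trans_middle _ _ _ (by linarith) (by linarith),
          extend_trans_trans'_right _ _ _ h4, Path.extend_trans_of_le_half _ _ (by linarith)]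
        congr 1; ring
      · simp only [hinge_of_ge h4, hinge_of_ge h2]
        rw [Path.extend_trans_of_half_le _ (Path.refl p) (by linarith),
          extend_trans_trans'_right _ _ _ h4, Path.extend_trans_of_half_le _ _ (by linarith)]
        rfl
  exact (key α hα).trans ((h _ _ hr hr).trans (key β hβ).symm)

end

end ThinLoops

/-! ### The groupoid of paths modulo retracing -/

namespace ThinLoops

open Set Filter Topology CategoryTheory

section

variable {E : Type*} [NormedAddCommGroup E] [NormedSpace ℝ E]
  {M : Type*} [TopologicalSpace M] [ChartedSpace E M] [IsManifold 𝓘(ℝ, E) ω M]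

/-- The points of `M`, as objects of the groupoid of piecewise-analytic paths modulo the relation
`PathRel E p`. -/
@[nolint unusedArguments]
structure RetraceGroupoid (E : Type*) [NormedAddCommGroup E] [NormedSpace ℝ E]
    {M : Type*} [TopologicalSpace M] [ChartedSpace E M] (p : M) where
  /-- The underlying point. -/
  pt : M

/-- The relation `PathRel E p` on piecewise-analytic paths from `x` to `y`. -/
def pathSetoid (p x y : M) : Setoid {α : Path x y // OneSidedAnalytic E α.extend} where
  r α β := PathRel E p α.1 β.1
  iseqv := ⟨fun α => .refl α.2, fun h => h.symm, fun h h' => h.trans h'⟩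

variable {p : M}

theorem PathRel.trans_trans {x y z : M} {α α' : Path x y} {β β' : Path y z}
    (hα : OneSidedAnalytic E α.extend) (hα' : OneSidedAnalytic E α'.extend)
    (hβ : OneSidedAnalytic E β.extend) (hβ' : OneSidedAnalytic E β'.extend)
    (h : PathRel E p α α') (h' : PathRel E p β β') : PathRel E p (α.trans β) (α'.trans β') :=
  (h.trans_right hα hα' hβ).trans (h'.trans_left hα' hβ hβ')

theorem PathRel.refl_trans {x y : M} {α : Path x y} (hα : OneSidedAnalytic E α.extend) :
    PathRel E p ((Path.refl x).trans α) α := by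
  refine .of_comp hα (oneSidedAnalytic_affine 2 (-1)) (by norm_num) (by norm_num) fun t ht => ?_
  rcases le_total t (1 / 2) with h | h
  · rw [Path.extend_trans_of_le_half _ _ h, α.extend_of_le_zero (by linarith)]; rfl
  · rw [Path.extend_trans_of_half_le _ _ h]; rfl

theorem PathRel.trans_refl {x y : M} {α : Path x y} (hα : OneSidedAnalytic E α.extend) :
    PathRel E p (α.trans (Path.refl y)) α := by
  refine .of_comp hα (oneSidedAnalytic_const_mul 2) (by norm_num) (by norm_num) fun t ht => ?_
  rcases le_total t (1 / 2) with h | h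
  · rw [Path.extend_trans_of_le_half _ _ h]
  · rw [Path.extend_trans_of_half_le _ _ h, α.extend_of_one_le (by linarith)]; rfl

theorem PathRel.trans_assoc {w x y z : M} {α : Path w x} {β : Path x y} {γ : Path y z}
    (hα : OneSidedAnalytic E α.extend) (hβ : OneSidedAnalytic E β.extend)
    (hγ : OneSidedAnalytic E γ.extend) :
    PathRel E p ((α.trans β).trans γ) (α.trans (β.trans γ)) := by
  refine .of_comp (hα.trans (hβ.trans hγ))
    (φ := fun t => 2 * t + (-1) * max 0 (t - 1 / 4) + (-1 / 2) * max 0 (t - 1 / 2)) ?_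
    (by norm_num) (by norm_num) fun t ht => ?_
  · exact ((oneSidedAnalytic_const_mul _).add
        ((oneSidedAnalytic_const_mul _).comp (oneSidedAnalytic_hinge _))).add
        ((oneSidedAnalytic_const_mul _).comp (oneSidedAnalytic_hinge _))
  · rcases le_total t (1 / 4) with h4 | h4
    · simp only [hinge_of_le h4, hinge_of_le (h4.trans (by norm_num : (1 : ℝ) / 4 ≤ 1 / 2))]
      rw [extend_trans_trans_left _ _ _ h4, Path.extend_trans_of_le_half _ _ (by linarith)]
      congr 1; ring
    rcases le_total t (1 / 2) with h2 | h2
    · simp only [hinge_of_ge h4, hinge_of_le h2]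
      rw [extend_trans_trans_middle _ _ _ h4 h2,
        extend_trans_trans'_middle _ _ _ (by linarith) (by linarith)]
      congr 1; ring
    · simp only [hinge_of_ge h4, hinge_of_ge h2]
      rw [Path.extend_trans_of_half_le _ _ h2, extend_trans_trans'_right _ _ _ (by linarith)]
      congr 1; ring

noncomputable instance : Groupoid (RetraceGroupoid E p) where
  Hom x y := Quotient (pathSetoid (E := E) p x.pt y.pt)
  id x := Quotient.mk _ ⟨Path.refl x.pt, oneSidedAnalytic_refl x.pt⟩
  comp {x y z} := Quotient.map₂ (fun α β => ⟨α.1.trans β.1, α.2.trans β.2⟩)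
    fun α α' h β β' h' => PathRel.trans_trans α.2 α'.2 β.2 β'.2 h h'
  -- Inverses respect the relation by the usual group computation: α⁻¹ ~ α⁻¹(α'α'⁻¹) ~ (α⁻¹α')α'⁻¹ ~
  -- (α⁻¹α)α'⁻¹ ~ α'⁻¹.
  inv {x y} := Quotient.map (fun α => ⟨α.1.symm, α.2.symm⟩) fun α α' h => by
    have h1 := PathRel.trans_symm_self (p := p) α.2.symm
    have h2 := PathRel.trans_symm_self (p := p) α'.2
    simp only [Path.symm_symm] at h1
    have e1 := (PathRel.trans_refl (p := p) α.2.symm).symm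
    have e2 := (h2.symm).trans_left α.2.symm (oneSidedAnalytic_refl _) (α'.2.trans α'.2.symm)
    have e3 := (PathRel.trans_assoc (p := p) α.2.symm α'.2 α'.2.symm).symm
    have e4 := ((PathRel.symm h).trans_left α.2.symm α'.2 α.2).trans_right
      (α.2.symm.trans α'.2) (α.2.symm.trans α.2) α'.2.symm
    have e5 := h1.trans_right (α.2.symm.trans α.2) (oneSidedAnalytic_refl _) α'.2.symm
    exact e1.trans (e2.trans (e3.trans (e4.trans (e5.trans (PathRel.refl_trans α'.2.symm)))))
  id_comp := by
    rintro x y ⟨α⟩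
    exact Quotient.sound (PathRel.refl_trans α.2)
  comp_id := by
    rintro x y ⟨α⟩
    exact Quotient.sound (PathRel.trans_refl α.2)
  assoc := by
    rintro w x y z ⟨α⟩ ⟨β⟩ ⟨γ⟩
    exact Quotient.sound (PathRel.trans_assoc α.2 β.2 γ.2)
  comp_inv := by
    rintro x y ⟨α⟩
    exact Quotient.sound (PathRel.trans_symm_self α.2)
  inv_comp := by
    rintro x y ⟨α⟩
    have h := PathRel.trans_symm_self (p := p) α.2.symm
    simp only [Path.symm_symm] at h
    exact Quotient.sound h

variable (p) in
/-- The class of a piecewise-analytic path in the groupoid. -/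
def pathClass {x y : M} (α : Path x y) (hα : OneSidedAnalytic E α.extend) :
    (⟨x⟩ : RetraceGroupoid E p) ⟶ ⟨y⟩ :=
  Quotient.mk (pathSetoid (E := E) p x y) ⟨α, hα⟩

theorem pathClass_eq_iff {x y : M} {α β : Path x y} {hα : OneSidedAnalytic E α.extend}
    {hβ : OneSidedAnalytic E β.extend} :
    pathClass p α hα = pathClass p β hβ ↔ PathRel E p α β :=
  Quotient.eq (r := pathSetoid (E := E) (M := M) p x y)

theorem pathClass_trans {x y z : M} {α : Path x y} {β : Path y z}
    (hα : OneSidedAnalytic E α.extend) (hβ : OneSidedAnalytic E β.extend) :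
    pathClass p (α.trans β) (hα.trans hβ) = pathClass p α hα ≫ pathClass p β hβ := rfl

theorem pathClass_symm {x y : M} {α : Path x y} (hα : OneSidedAnalytic E α.extend) :
    pathClass p α.symm hα.symm = Groupoid.inv (pathClass p α hα) := rfl

theorem pathClass_refl (x : M) :
    pathClass p (Path.refl x) (oneSidedAnalytic_refl (E := E) x) = 𝟙 (⟨x⟩ : RetraceGroupoid E p) :=
  rfl

omit [IsManifold 𝓘(ℝ, E) ω M] in
theorem oneSidedAnalytic_map {f : ℝ → M} (hf : OneSidedAnalytic E f) {u v : ℝ} {ψ : Path u v}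
    (hψ : OneSidedAnalytic ℝ ψ.extend) :
    OneSidedAnalytic E (ψ.map hf.continuous).extend :=
  hf.comp hψ

/-- The affine path between two reals. -/
def linePath (a b : ℝ) : Path a b where
  toFun t := a + (b - a) * t
  continuous_toFun := by fun_prop
  source' := by simp
  target' := by simp

theorem linePath_extend {a b t : ℝ} (ht : t ∈ Icc (0 : ℝ) 1) :
    (linePath a b).extend t = a + (b - a) * t := by
  rw [Path.extend_apply _ ht]; rfl

theorem oneSidedAnalytic_linePath (a b : ℝ) : OneSidedAnalytic ℝ (linePath a b).extend :=
  oneSidedAnalytic_extend (f := fun t => a + (b - a) * t)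
    (ContDiff.oneSidedAnalytic (by fun_prop)) fun _ ht => linePath_extend ht

theorem linePath_mem {a b A B : ℝ} (ha : a ∈ Icc A B) (hb : b ∈ Icc A B) (t : I) :
    linePath a b t ∈ Icc A B := by
  have := (convex_Icc A B) ha hb (sub_nonneg.2 t.2.2) t.2.1 (by ring)
  convert this using 1
  change a + (b - a) * t = (1 - t) * a + t * b
  ring

/-- Paths that factor through the same paths in an interval with the same end points agree. -/
theorem pathClass_map_eq {f : ℝ → M} (hf : OneSidedAnalytic E f) {u v : ℝ} {ψ ψ' : Path u v}
    (hψ : OneSidedAnalytic ℝ ψ.extend) (hψ' : OneSidedAnalytic ℝ ψ'.extend) :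
    pathClass p (ψ.map hf.continuous) (oneSidedAnalytic_map hf hψ) =
      pathClass p (ψ'.map hf.continuous) (oneSidedAnalytic_map hf hψ') := by
  have hcpt : IsCompact (range ψ ∪ range ψ') :=
    (isCompact_range ψ.continuous).union (isCompact_range ψ'.continuous)
  obtain ⟨A, hA⟩ := hcpt.bddBelow
  obtain ⟨B, hB⟩ := hcpt.bddAbove
  have hu : u ∈ range ψ := ⟨0, ψ.source⟩
  have hv : v ∈ range ψ := ⟨1, ψ.target⟩
  have huA := hA (.inl hu)
  have huB := hB (.inl hu)
  have hvA := hA (.inl hv)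
  have hvB := hB (.inl hv)
  have hl := oneSidedAnalytic_linePath A u
  have hl' := oneSidedAnalytic_linePath v (B + 1)
  have hAB : A < B + 1 := by linarith
  -- Prolonged to start at A and end at B + 1, bounds for all its values, ψ becomes a
  -- reparametrization of the segment from A to B + 1. The prolonged class thus does not depend on
  -- ψ, and the added pieces cancel. The 1 keeps the segment nondegenerate, so that it can be
  -- rescaled to unit length.
  have key : ∀ ψ : Path u v, ∀ hψ : OneSidedAnalytic ℝ ψ.extend,
      (∀ t, ψ t ∈ Icc A (B + 1)) →
      (pathClass p ((linePath A u).map hf.continuous) (oneSidedAnalytic_map hf hl) ≫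
        pathClass p (ψ.map hf.continuous) (oneSidedAnalytic_map hf hψ)) ≫
        pathClass p ((linePath v (B + 1)).map hf.continuous) (oneSidedAnalytic_map hf hl') =
      pathClass p ((linePath A (B + 1)).map hf.continuous)
        (oneSidedAnalytic_map hf (oneSidedAnalytic_linePath _ _)) := by
    intro ψ hψ hmem
    rw [← pathClass_trans, ← pathClass_trans, pathClass_eq_iff]
    have e : (((linePath A u).map hf.continuous).trans (ψ.map hf.continuous)).trans
        ((linePath v (B + 1)).map hf.continuous) =
        (((linePath A u).trans ψ).trans (linePath v (B + 1))).map hf.continuous := by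
      rw [Path.map_trans, Path.map_trans]
    rw [e]
    set Φ := ((linePath A u).trans ψ).trans (linePath v (B + 1)) with hΦ
    have hΦa : OneSidedAnalytic ℝ Φ.extend := (hl.trans hψ).trans hl'
    have hΦm : ∀ t, Φ t ∈ Icc A (B + 1) := by
      intro t
      have : Φ t ∈ range Φ := mem_range_self t
      rw [hΦ, Path.trans_range, Path.trans_range] at this
      rcases this with (⟨s, hs⟩ | ⟨s, hs⟩) | ⟨s, hs⟩ <;> rw [hΦ, ← hs]
      · exact linePath_mem ⟨le_rfl, hAB.le⟩ ⟨huA, by linarith⟩ s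
      · exact hmem s
      · exact linePath_mem ⟨hvA, by linarith⟩ ⟨hAB.le, le_rfl⟩ s
    refine .of_comp (oneSidedAnalytic_map hf (oneSidedAnalytic_linePath _ _))
      (φ := fun t => (B + 1 - A)⁻¹ * (Φ.extend t - A))
      ((oneSidedAnalytic_const_mul _).comp (hΦa.sub (oneSidedAnalytic_const _))) ?_ ?_ ?_
    · simp
    · rw [Path.extend_one, inv_mul_cancel₀ (by linarith)]
    · intro t ht
      have h1 : Φ.extend t ∈ Icc A (B + 1) := by rw [Path.extend_apply _ ht]; exact hΦm _
      have hne : B + 1 - A ≠ 0 := by linarith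
      change f (Φ.extend t) = f ((linePath A (B + 1)).extend _)
      rw [linePath_extend, mul_inv_cancel_left₀ hne]
      · congr 1; ring
      · exact ⟨mul_nonneg (inv_nonneg.2 (by linarith)) (by linarith [h1.1]),
          by rw [inv_mul_le_iff₀ (by linarith)]; linarith [h1.2]⟩
  have h1 := key ψ hψ fun t => ⟨hA (.inl ⟨t, rfl⟩), (hB (.inl ⟨t, rfl⟩)).trans (by linarith)⟩
  have h2 := key ψ' hψ' fun t => ⟨hA (.inr ⟨t, rfl⟩), (hB (.inr ⟨t, rfl⟩)).trans (by linarith)⟩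
  have h3 := h1.trans h2.symm
  rwa [cancel_mono, cancel_epi] at h3

theorem pathClass_linePath_trans {f : ℝ → M} (hf : OneSidedAnalytic E f) (a b c : ℝ) :
    pathClass p ((linePath a b).map hf.continuous)
        (oneSidedAnalytic_map hf (oneSidedAnalytic_linePath a b)) ≫
      pathClass p ((linePath b c).map hf.continuous)
        (oneSidedAnalytic_map hf (oneSidedAnalytic_linePath b c)) =
      pathClass p ((linePath a c).map hf.continuous)
        (oneSidedAnalytic_map hf (oneSidedAnalytic_linePath a c)) := by
  rw [← pathClass_trans, ← pathClass_map_eq hf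
    ((oneSidedAnalytic_linePath a b).trans (oneSidedAnalytic_linePath b c))
    (oneSidedAnalytic_linePath a c)]
  congr 1
  rw [Path.map_trans]

end

end ThinLoops

/-! ### Branches of analytic curves at a point -/

namespace ThinLoops

open Set Filter Topology

section

variable {E : Type*} [NormedAddCommGroup E] [InnerProductSpace ℝ E]
  {M : Type*} [TopologicalSpace M] [ChartedSpace E M]

variable (E) in
/-- The squared distance to `q` in the preferred chart at `q`. -/
noncomputable def sqDist (q x : M) : ℝ :=
  ‖extChartAt 𝓘(ℝ, E) q x - extChartAt 𝓘(ℝ, E) q q‖ ^ 2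

theorem sqDist_nonneg (q x : M) : 0 ≤ sqDist E q x := sq_nonneg _

theorem sqDist_self (q : M) : sqDist E q q = 0 := by simp [sqDist]

theorem eq_of_sqDist_eq_zero {q x : M} (hx : x ∈ (chartAt E q).source)
    (h : sqDist E q x = 0) : x = q := by
  have h1 : extChartAt 𝓘(ℝ, E) q x = extChartAt 𝓘(ℝ, E) q q := by
    rw [sqDist, sq_eq_zero_iff, norm_eq_zero, sub_eq_zero] at h
    exact h
  exact (extChartAt 𝓘(ℝ, E) q).injOn (by rwa [extChartAt_source]) (mem_extChartAt_source q) h1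

variable [IsManifold 𝓘(ℝ, E) ω M]

theorem contMDiffAt_sqDist {q x : M} (hx : x ∈ (chartAt E q).source) :
    ContMDiffAt 𝓘(ℝ, E) 𝓘(ℝ, ℝ) ω (sqDist E q) x := by
  have h2 : ContDiff ℝ ω fun y : E => ‖y - extChartAt 𝓘(ℝ, E) q q‖ ^ 2 :=
    (contDiff_id.sub contDiff_const).norm_sq ℝ
  exact h2.contMDiff.contMDiffAt.comp x (contMDiffAt_extChartAt' hx)

theorem continuousAt_sqDist (q : M) : ContinuousAt (sqDist E q) q :=
  (contMDiffAt_sqDist (mem_chart_source E q)).continuousAt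

omit [IsManifold 𝓘(ℝ, E) ω M] in
/-- The identity principle for one-sided analytic curves. -/
theorem eventually_eq_of_frequently_eq [CompleteSpace E] [T2Space M] {h₁ h₂ : ℝ → M} {t : ℝ}
    (hh₁ : ContMDiffWithinAt 𝓘(ℝ, ℝ) 𝓘(ℝ, E) ω h₁ (Ici t) t)
    (hh₂ : ContMDiffWithinAt 𝓘(ℝ, ℝ) 𝓘(ℝ, E) ω h₂ (Ici t) t)
    (h : ∃ᶠ u in 𝓝[>] t, h₁ u = h₂ u) : ∀ᶠ u in 𝓝[≥] t, h₁ u = h₂ u := by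
  have hle : 𝓝[>] t ≤ 𝓝[≥] t := nhdsWithin_mono _ Ioi_subset_Ici_self
  have heq : h₁ t = h₂ t := by
    by_contra hne
    have hd := (hh₁.continuousWithinAt.tendsto.mono_left hle).prodMk_nhds
      (hh₂.continuousWithinAt.tendsto.mono_left hle)
    have := hd.eventually (isClosed_diagonal.isOpen_compl.mem_nhds
      (show (h₁ t, h₂ t) ∈ (diagonal M)ᶜ from hne))
    exact h (this.mono fun u hu e => hu e)
  have hsrc : ∀ {k : ℝ → M}, ContMDiffWithinAt 𝓘(ℝ, ℝ) 𝓘(ℝ, E) ω k (Ici t) t → k t = h₁ t →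
      ContMDiffWithinAt 𝓘(ℝ, ℝ) 𝓘(ℝ, E) ω (fun u => extChartAt 𝓘(ℝ, E) (h₁ t) (k u)) (Ici t) t ∧
      ∀ᶠ u in 𝓝[≥] t, k u ∈ (extChartAt 𝓘(ℝ, E) (h₁ t)).source := by
    intro k hk e
    constructor
    · refine ContMDiffAt.comp_contMDiffWithinAt (g := extChartAt 𝓘(ℝ, E) (h₁ t)) t ?_ hk
      rw [e]
      exact contMDiffAt_extChartAt
    · refine hk.continuousWithinAt.tendsto.eventually ?_
      rw [e]
      exact extChartAt_source_mem_nhds (h₁ t)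
  obtain ⟨c₁, s₁⟩ := hsrc hh₁ rfl
  obtain ⟨c₂, s₂⟩ := hsrc hh₂ heq.symm
  obtain ⟨g₁, hg₁, e₁⟩ := exists_analyticAt_of_contMDiffWithinAt self_mem_Ici c₁
  obtain ⟨g₂, hg₂, e₂⟩ := exists_analyticAt_of_contMDiffWithinAt self_mem_Ici c₂
  have hfr : ∃ᶠ u in 𝓝[≠] t, g₁ u = g₂ u := by
    refine Frequently.filter_mono (f := 𝓝[>] t) ?_
      (nhdsWithin_mono _ fun u (hu : t < u) => ne_of_gt hu)
    refine (h.and_eventually ((e₁.and e₂).filter_mono hle)).mono fun u hu => ?_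
    rw [← hu.2.1, ← hu.2.2]
    simp only [hu.1]
  have := (hg₁.frequently_eq_iff_eventually_eq hg₂).1 hfr
  filter_upwards [s₁, s₂, e₁, e₂, this.filter_mono nhdsWithin_le_nhds] with u a₁ a₂ b₁ b₂ b
  exact (extChartAt 𝓘(ℝ, E) (h₁ t)).injOn a₁ a₂ (by rw [b₁, b₂, b])

theorem _root_.AnalyticAt.rpow_const_of_pos {g : ℝ → ℝ} {t c : ℝ} (hg : AnalyticAt ℝ g t)
    (h : 0 < g t) : AnalyticAt ℝ (fun u => g u ^ c) t := by
  have := hg.contDiffAt (n := ω)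
  rw [← contDiffWithinAt_univ] at this
  rw [← analyticWithinAt_univ, ← contDiffWithinAt_omega_iff_analyticWithinAt]
  exact this.rpow_const_of_ne h.ne'

/-- The factorization of a nonnegative one-sided analytic function that is not locally zero. -/
theorem exists_eq_pow_mul_of_nonneg {f : ℝ → ℝ}
    (hf : ContMDiffWithinAt 𝓘(ℝ, ℝ) 𝓘(ℝ, ℝ) ω f (Ici 0) 0) (hf0 : ∀ᶠ u in 𝓝[≥] 0, 0 ≤ f u) :
    (∀ᶠ u in 𝓝[≥] 0, f u = 0) ∨ ∃ (m : ℕ) (g : ℝ → ℝ), AnalyticAt ℝ g 0 ∧ 0 < g 0 ∧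
      ∀ᶠ u in 𝓝[≥] 0, f u = u ^ m * g u := by
  obtain ⟨F, hF, hfF⟩ := exists_analyticAt_of_contMDiffWithinAt self_mem_Ici hf
  by_cases h0 : ∀ᶠ u in 𝓝 0, F u = 0
  · left
    filter_upwards [hfF, h0.filter_mono nhdsWithin_le_nhds] with u h1 h2
    rw [h1, h2]
  · right
    obtain ⟨m, g, hg, hg0, hgF⟩ := hF.exists_eventuallyEq_pow_smul_nonzero_iff.2 h0
    have heq : ∀ᶠ u in 𝓝[≥] 0, f u = u ^ m * g u := by
      filter_upwards [hfF, hgF.filter_mono nhdsWithin_le_nhds] with u h1 h2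
      rw [h1, h2]; simp
    refine ⟨m, g, hg, lt_of_le_of_ne ?_ hg0.symm, heq⟩
    have hle : 𝓝[>] (0 : ℝ) ≤ 𝓝[≥] 0 := nhdsWithin_mono _ Ioi_subset_Ici_self
    refine ge_of_tendsto (hg.continuousAt.tendsto.mono_left (nhdsWithin_le_nhds (s := Ioi 0))) ?_
    filter_upwards [(heq.and hf0).filter_mono hle, self_mem_nhdsWithin] with u hu (hu0 : 0 < u)
    have := hu.2
    rw [hu.1] at this
    exact (mul_nonneg_iff_of_pos_left (pow_pos hu0 m)).1 this

variable (E) in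
/-- `e` is a branch at `q`, parametrized so that the squared distance is `v ^ k`. -/
structure IsBranch (q : M) (k : ℕ) (e : ℝ → M) : Prop where
  contMDiffWithinAt : ContMDiffWithinAt 𝓘(ℝ, ℝ) 𝓘(ℝ, E) ω e (Ici 0) 0
  zero : e 0 = q
  sqDist_eq : ∀ᶠ v in 𝓝[≥] 0, sqDist E q (e v) = v ^ k

-- Substituting a power of the parameter serves to give finitely many branches a common exponent.
omit [IsManifold 𝓘(ℝ, E) ω M] in
theorem IsBranch.comp_pow {q : M} {k : ℕ} {e : ℝ → M} (h : IsBranch E q k e) {m : ℕ}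
    (hm : m ≠ 0) : IsBranch E q (k * m) fun v => e (v ^ m) := by
  have h0 : (0 : ℝ) ^ m = 0 := zero_pow hm
  have hnn : ∀ᶠ v in 𝓝[≥] (0 : ℝ), v ^ m ∈ Ici (0 : ℝ) := by
    filter_upwards [self_mem_nhdsWithin] with v (hv : 0 ≤ v) using pow_nonneg hv m
  refine ⟨?_, by rw [h0, h.zero], ?_⟩
  · refine ContMDiffWithinAt.comp_of_eventually (φ := fun v => v ^ m) (u := Ici 0) ?_ ?_ hnn
    · rw [h0]; exact h.contMDiffWithinAt
    · exact (contDiff_id.pow m).contMDiff.contMDiffAt.contMDiffWithinAt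
  · have ht : Tendsto (fun v : ℝ => v ^ m) (𝓝[≥] 0) (𝓝[≥] 0) := by
      refine tendsto_nhdsWithin_iff.2 ⟨?_, hnn⟩
      have : ContinuousAt (fun v : ℝ => v ^ m) 0 := by fun_prop
      have := this.tendsto.mono_left (nhdsWithin_le_nhds (s := Ici 0))
      rwa [h0] at this
    filter_upwards [ht.eventually h.sqDist_eq] with v hv
    rw [hv, ← pow_mul, mul_comm]

/-- A one-sided analytic curve issuing from `q` is locally constant or runs in a branch. -/
theorem exists_isBranch {h : ℝ → M} {q : M}
    (hh : ContMDiffWithinAt 𝓘(ℝ, ℝ) 𝓘(ℝ, E) ω h (Ici 0) 0) (h0 : h 0 = q) :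
    (∀ᶠ u in 𝓝[≥] 0, h u = q) ∨ ∃ (k : ℕ) (e : ℝ → M), k ≠ 0 ∧ IsBranch E q k e ∧
      ∀ᶠ u in 𝓝[≥] 0, ∃ v, 0 ≤ v ∧ h u = e v ∧ sqDist E q (h u) = v ^ k := by
  have hf : ContMDiffWithinAt 𝓘(ℝ, ℝ) 𝓘(ℝ, ℝ) ω (fun u => sqDist E q (h u)) (Ici 0) 0 := by
    refine ContMDiffAt.comp_contMDiffWithinAt (g := sqDist E q) 0 ?_ hh
    rw [h0]
    exact contMDiffAt_sqDist (mem_chart_source E q)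
  rcases exists_eq_pow_mul_of_nonneg hf (.of_forall fun u => sqDist_nonneg q _) with
    hz | ⟨k, g, hg, hg0, hfg⟩
  · left
    have hsrc : ∀ᶠ u in 𝓝[≥] 0, h u ∈ (chartAt E q).source := by
      refine hh.continuousWithinAt.tendsto.eventually ?_
      rw [h0]
      exact (chartAt E q).open_source.mem_nhds (mem_chart_source E q)
    filter_upwards [hz, hsrc] with u h1 h2 using eq_of_sqDist_eq_zero h2 h1
  right
  have hk : k ≠ 0 := by
    rintro rfl
    have := hfg.self_of_nhdsWithin self_mem_Ici
    rw [h0, sqDist_self] at this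
    simp only [pow_zero, one_mul] at this
    exact hg0.ne this
  have hk' : (k : ℝ) ≠ 0 := Nat.cast_ne_zero.2 hk
  have hga : AnalyticAt ℝ (fun u => g u ^ (k⁻¹ : ℝ)) 0 := hg.rpow_const_of_pos hg0
  -- Since the squared distance is u^k g(u) with g(0) > 0, the function w = u g(u)^(1/k) is a local
  -- analytic coordinate whose k-th power is the squared distance. The branch is h in this
  -- coordinate.
  set w : ℝ → ℝ := fun u => u * g u ^ (k⁻¹ : ℝ) with hw
  have hwa : AnalyticAt ℝ w 0 := analyticAt_id.mul hga
  have hw0 : w 0 = 0 := by simp [hw]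
  have hwd : deriv w 0 ≠ 0 := by
    have : HasDerivAt w (1 * g 0 ^ (k⁻¹ : ℝ) + 0 * deriv (fun u => g u ^ (k⁻¹ : ℝ)) 0) 0 :=
      (hasDerivAt_id 0).mul hga.differentiableAt.hasDerivAt
    rw [this.deriv]
    simpa using (Real.rpow_pos_of_pos hg0 _).ne'
  have hgpos : ∀ᶠ u in 𝓝 0, 0 < g u := hg.continuousAt.eventually_const_lt hg0
  have hwk : ∀ᶠ u in 𝓝 0, w u ^ k = u ^ k * g u := by
    filter_upwards [hgpos] with u hu
    rw [hw, mul_pow, Real.rpow_inv_natCast_pow hu.le hk]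
  set ψ := hwa.hasStrictDerivAt.localInverse _ _ _ hwd with hψ
  have hψa : AnalyticAt ℝ ψ 0 := by
    have := hwa.analyticAt_localInverse hwd
    rwa [hw0] at this
  have hl : ∀ᶠ u in 𝓝 0, ψ (w u) = u := HasStrictFDerivAt.eventually_left_inverse ..
  have hr : ∀ᶠ v in 𝓝 0, w (ψ v) = v := by
    have : ∀ᶠ v in 𝓝 (w 0), w (ψ v) = v := HasStrictFDerivAt.eventually_right_inverse ..
    rwa [hw0] at this
  have hψ0 : ψ 0 = 0 := by
    have := hl.self_of_nhds
    rwa [hw0] at this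
  have hψt : Tendsto ψ (𝓝 0) (𝓝 0) := by
    have := hψa.continuousAt.tendsto
    rwa [hψ0] at this
  -- w has the sign of u, so its inverse preserves the right-hand side, where alone h is controlled.
  have hψnn : ∀ᶠ v in 𝓝[≥] 0, ψ v ∈ Ici (0 : ℝ) := by
    filter_upwards [(hr.and (hψt.eventually hgpos)).filter_mono nhdsWithin_le_nhds,
      self_mem_nhdsWithin] with v hv (hv0 : 0 ≤ v)
    have h1 := hv.1
    by_contra hneg
    have h3 : ψ v < 0 := not_le.1 hneg
    have h2 := mul_neg_of_neg_of_pos h3 (Real.rpow_pos_of_pos hv.2 (k⁻¹ : ℝ))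
    simp only [hw] at h1
    linarith
  have hψt' : Tendsto ψ (𝓝[≥] 0) (𝓝[≥] 0) :=
    tendsto_nhdsWithin_iff.2 ⟨hψt.mono_left nhdsWithin_le_nhds, hψnn⟩
  refine ⟨k, fun v => h (ψ v), hk, ⟨?_, by rw [hψ0, h0], ?_⟩, ?_⟩
  · refine ContMDiffWithinAt.comp_of_eventually (u := Ici 0) ?_
      (hψa.contMDiffWithinAt self_mem_Ici .rfl) hψnn
    rwa [hψ0]
  · filter_upwards [hψt'.eventually hfg, hr.filter_mono nhdsWithin_le_nhds,
      (hψt.eventually hwk).filter_mono nhdsWithin_le_nhds] with v h1 h2 h3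
    rw [h1, ← h3, h2]
  · filter_upwards [hfg, hl.filter_mono nhdsWithin_le_nhds, hwk.filter_mono nhdsWithin_le_nhds,
      hgpos.filter_mono nhdsWithin_le_nhds, self_mem_nhdsWithin] with u h1 h2 h3 h4 (h5 : 0 ≤ u)
    exact ⟨w u, mul_nonneg h5 (Real.rpow_nonneg h4.le _), by rw [h2], by rw [h1, h3]⟩

/-- Near `q`, a one-sided analytic curve on a compact interval runs in finitely many branches. -/
theorem exists_finite_branches [T2Space M] {γ : ℝ → M} (hγ : OneSidedAnalytic E γ) (q : M)
    (a b : ℝ) : ∃ F : Set (ℕ × (ℝ → M)), F.Finite ∧ (∀ f ∈ F, f.1 ≠ 0 ∧ IsBranch E q f.1 f.2) ∧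
      ∃ U ∈ 𝓝 q, ∀ t ∈ Icc a b, γ t ∈ U → γ t = q ∨
        ∃ f ∈ F, ∃ v, 0 ≤ v ∧ γ t = f.2 v ∧ sqDist E q (γ t) = v ^ f.1 := by
  refine isCompact_Icc.induction_on
    (p := fun s => ∃ F : Set (ℕ × (ℝ → M)), F.Finite ∧
      (∀ f ∈ F, f.1 ≠ 0 ∧ IsBranch E q f.1 f.2) ∧
      ∃ U ∈ 𝓝 q, ∀ t ∈ s, γ t ∈ U → γ t = q ∨
        ∃ f ∈ F, ∃ v, 0 ≤ v ∧ γ t = f.2 v ∧ sqDist E q (γ t) = v ^ f.1) ?_ ?_ ?_ ?_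
  · exact ⟨∅, finite_empty, by simp, univ, univ_mem, by simp⟩
  · rintro s t hst ⟨F, hF, hFb, U, hU, h⟩
    exact ⟨F, hF, hFb, U, hU, fun x hx => h x (hst hx)⟩
  · rintro s t ⟨F, hF, hFb, U, hU, h⟩ ⟨F', hF', hFb', U', hU', h'⟩
    refine ⟨F ∪ F', hF.union hF', ?_, U ∩ U', inter_mem hU hU', ?_⟩
    · rintro f (hf | hf)
      exacts [hFb f hf, hFb' f hf]
    · rintro x (hx | hx) hxU
      · exact (h x hx hxU.1).imp_right fun ⟨f, hf, h⟩ => ⟨f, .inl hf, h⟩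
      · exact (h' x hx hxU.2).imp_right fun ⟨f, hf, h⟩ => ⟨f, .inr hf, h⟩
  · intro t _
    by_cases ht : γ t = q
    -- The two halves of the curve at a time t with γ t = q are treated as curves issuing from q,
    -- with c = 1 and c = -1; they may give different branches. Times with γ t ≠ q contribute
    -- nothing near q, because M is Hausdorff.
    · have side : ∀ c : ℝ, ∃ F : Set (ℕ × (ℝ → M)), F.Finite ∧
          (∀ f ∈ F, f.1 ≠ 0 ∧ IsBranch E q f.1 f.2) ∧ ∀ᶠ u in 𝓝[≥] (0 : ℝ), γ (t + c * u) = q ∨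
          ∃ f ∈ F, ∃ v, 0 ≤ v ∧ γ (t + c * u) = f.2 v ∧ sqDist E q (γ (t + c * u)) = v ^ f.1 := by
        intro c
        have hc : OneSidedAnalytic E fun u => γ (t + c * u) :=
          hγ.comp (φ := fun u => t + c * u) (ContDiff.oneSidedAnalytic (by fun_prop))
        rcases exists_isBranch (hc 0).1 (q := q) (by simpa using ht) with h | ⟨k, e, hk, he, h⟩
        · exact ⟨∅, finite_empty, by simp, h.mono fun u hu => .inl hu⟩
        · exact ⟨{(k, e)}, finite_singleton _, by simpa using ⟨hk, he⟩,
            h.mono fun u hu => .inr ⟨_, rfl, hu⟩⟩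
      obtain ⟨F, hF, hFb, h⟩ := side 1
      obtain ⟨F', hF', hFb', h'⟩ := side (-1)
      have e1 : ∀ᶠ s in 𝓝[≥] t, γ s = q ∨
          ∃ f ∈ F, ∃ v, 0 ≤ v ∧ γ s = f.2 v ∧ sqDist E q (γ s) = v ^ f.1 := by
        have : Tendsto (fun s => s - t) (𝓝[≥] t) (𝓝[≥] 0) := by
          refine tendsto_nhdsWithin_iff.2 ⟨?_, ?_⟩
          · have : ContinuousAt (fun s => s - t) t := by fun_prop
            have := this.tendsto.mono_left (nhdsWithin_le_nhds (s := Ici t))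
            simpa using this
          · filter_upwards [self_mem_nhdsWithin] with s hs using sub_nonneg.2 (mem_Ici.1 hs)
        filter_upwards [this.eventually h] with s hs
        rwa [show t + 1 * (s - t) = s by ring] at hs
      have e2 : ∀ᶠ s in 𝓝[≤] t, γ s = q ∨
          ∃ f ∈ F', ∃ v, 0 ≤ v ∧ γ s = f.2 v ∧ sqDist E q (γ s) = v ^ f.1 := by
        have : Tendsto (fun s => t - s) (𝓝[≤] t) (𝓝[≥] 0) := by
          refine tendsto_nhdsWithin_iff.2 ⟨?_, ?_⟩
          · have : ContinuousAt (fun s => t - s) t := by fun_prop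
            have := this.tendsto.mono_left (nhdsWithin_le_nhds (s := Iic t))
            simpa using this
          · filter_upwards [self_mem_nhdsWithin] with s hs using sub_nonneg.2 (mem_Iic.1 hs)
        filter_upwards [this.eventually h'] with s hs
        rwa [show t + -1 * (t - s) = s by ring] at hs
      have e3 : ∀ᶠ s in 𝓝 t, γ s = q ∨
          ∃ f ∈ F ∪ F', ∃ v, 0 ≤ v ∧ γ s = f.2 v ∧ sqDist E q (γ s) = v ^ f.1 := by
        rw [← nhdsLE_sup_nhdsGE, eventually_sup]
        exact ⟨e2.mono fun s hs => hs.imp_right fun ⟨f, hf, h⟩ => ⟨f, .inr hf, h⟩,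
          e1.mono fun s hs => hs.imp_right fun ⟨f, hf, h⟩ => ⟨f, .inl hf, h⟩⟩
      refine ⟨_, mem_nhdsWithin_of_mem_nhds e3, F ∪ F', hF.union hF', ?_, univ, univ_mem,
        fun s hs _ => hs⟩
      rintro f (hf | hf)
      exacts [hFb f hf, hFb' f hf]
    · obtain ⟨V, U, hV, hU, htV, hqU, hVU⟩ := t2_separation ht
      refine ⟨γ ⁻¹' V, mem_nhdsWithin_of_mem_nhds
        (hγ.continuous.continuousAt.preimage_mem_nhds (hV.mem_nhds htV)), ∅, finite_empty, by simp,
        U, hU.mem_nhds hqU, fun s hs hsU => ?_⟩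
      exact absurd hsU (disjoint_left.1 hVU hs)

end

end ThinLoops

/-! ### Stars, and paths inside them -/

namespace ThinLoops

open Set Filter Topology CategoryTheory

section

variable {E : Type*} [NormedAddCommGroup E] [InnerProductSpace ℝ E]
  {M : Type*} [TopologicalSpace M] [ChartedSpace E M]

variable (E) in
/-- A finite set of arcs issuing from `q`, with a common parametrization by the distance to `q`,
any two of which coincide or meet in `q` only. -/
structure IsStar (q : M) (K : ℕ) (A : Set (ℝ → M)) (ε : ℝ) : Prop where
  ne_zero : K ≠ 0
  pos : 0 < ε
  finite : A.Finite
  analytic : ∀ e ∈ A, OneSidedAnalytic E e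
  zero : ∀ e ∈ A, e 0 = q
  sqDist_eq : ∀ e ∈ A, ∀ v ∈ Icc 0 ε, sqDist E q (e v) = v ^ K
  eq_or_ne : ∀ e ∈ A, ∀ e' ∈ A, (∀ v ∈ Icc 0 ε, e v = e' v) ∨ ∀ v ∈ Ioc 0 ε, e v ≠ e' v

variable (E) in
/-- The points on the arcs of a star. -/
def starSet (q : M) (A : Set (ℝ → M)) (ε : ℝ) : Set M :=
  {x | x ∈ (chartAt E q).source ∧ (x = q ∨ ∃ e ∈ A, ∃ v ∈ Icc 0 ε, x = e v)}

/-- Freezing an arc at its two ends turns a local arc into a curve on the whole line without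
changing it on `[0, ε]`. -/
theorem oneSidedAnalytic_comp_clamp {e : ℝ → M} {ε : ℝ} (hε : 0 < ε)
    (he : ContMDiffOn 𝓘(ℝ, ℝ) 𝓘(ℝ, E) ω e (Icc 0 ε)) :
    OneSidedAnalytic E fun v => e (max 0 (min ε v)) := by
  have hc : OneSidedAnalytic ℝ fun v => max 0 (min ε v) :=
    (oneSidedAnalytic_const 0).max ((oneSidedAnalytic_const ε).min oneSidedAnalytic_id)
  have hm : ∀ v, max 0 (min ε v) ∈ Icc 0 ε := fun v =>
    ⟨le_max_left _ _, max_le hε.le (min_le_left _ _)⟩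
  exact fun t => ⟨(he _ (hm t)).comp_of_eventually (φ := fun v => max 0 (min ε v)) (hc t).1
      (.of_forall hm),
    (he _ (hm t)).comp_of_eventually (φ := fun v => max 0 (min ε v)) (hc t).2 (.of_forall hm)⟩

theorem eventually_forall_Icc {P : ℝ → Prop} (h : ∀ᶠ v in 𝓝[≥] (0 : ℝ), P v) :
    ∀ᶠ ε in 𝓝[>] (0 : ℝ), ∀ v ∈ Icc 0 ε, P v := by
  obtain ⟨u, hu, hus⟩ := (mem_nhdsGE_iff_exists_Icc_subset).1 h
  filter_upwards [Ioo_mem_nhdsGT (show 0 < u from hu)] with ε hε v hv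
  exact hus ⟨hv.1, hv.2.trans hε.2.le⟩

theorem eventually_forall_Ioc {P : ℝ → Prop} (h : ∀ᶠ v in 𝓝[>] (0 : ℝ), P v) :
    ∀ᶠ ε in 𝓝[>] (0 : ℝ), ∀ v ∈ Ioc 0 ε, P v := by
  obtain ⟨u, hu, hus⟩ := (mem_nhdsGT_iff_exists_Ioc_subset).1 h
  filter_upwards [Ioo_mem_nhdsGT (show 0 < u from hu)] with ε hε v hv
  exact hus ⟨hv.1, hv.2.trans hε.2.le⟩

variable [IsManifold 𝓘(ℝ, E) ω M] [T2Space M]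

/-- Near each point, the union of two one-sided analytic curves is a star. -/
theorem exists_isStar [CompleteSpace E] {γ₀ γ₁ : ℝ → M} (h₀ : OneSidedAnalytic E γ₀)
    (h₁ : OneSidedAnalytic E γ₁) (q : M) (a b : ℝ) :
    ∃ K A ε, IsStar E q K A ε ∧ ∃ U ∈ 𝓝 q, ∀ x ∈ U, x ∈ γ₀ '' Icc a b ∪ γ₁ '' Icc a b →
      x ∈ starSet E q A ε := by
  obtain ⟨F₀, hF₀, hb₀, U₀, hU₀, hc₀⟩ := exists_finite_branches h₀ q a b
  obtain ⟨F₁, hF₁, hb₁, U₁, hU₁, hc₁⟩ := exists_finite_branches h₁ q a b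
  have hF := hF₀.union hF₁
  have hb : ∀ f ∈ F₀ ∪ F₁, f.1 ≠ 0 ∧ IsBranch E q f.1 f.2 := by
    rintro f (hf | hf)
    exacts [hb₀ f hf, hb₁ f hf]
  have hc : ∀ x ∈ U₀ ∩ U₁, x ∈ γ₀ '' Icc a b ∪ γ₁ '' Icc a b →
      x = q ∨ ∃ f ∈ F₀ ∪ F₁, ∃ v, 0 ≤ v ∧ x = f.2 v ∧ sqDist E q x = v ^ f.1 := by
    rintro x hx (⟨t, ht, rfl⟩ | ⟨t, ht, rfl⟩)
    · exact (hc₀ t ht hx.1).imp_right fun ⟨f, hf, h⟩ => ⟨f, .inl hf, h⟩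
    · exact (hc₁ t ht hx.2).imp_right fun ⟨f, hf, h⟩ => ⟨f, .inr hf, h⟩
  -- Any common multiple of the exponents would do. With v replaced by v ^ (K / k), a branch of
  -- exponent k has squared distance v ^ K.
  set K := ∏ f ∈ hF.toFinset, f.1 with hK
  have hK0 : K ≠ 0 := Finset.prod_ne_zero_iff.2 fun f hf => (hb f (hF.mem_toFinset.1 hf)).1
  have hdvd : ∀ f ∈ F₀ ∪ F₁, f.1 ∣ K := fun f hf =>
    Finset.dvd_prod_of_mem (fun f : ℕ × (ℝ → M) => f.1) (hF.mem_toFinset.2 hf)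
  set G : ℕ × (ℝ → M) → ℝ → M := fun f v => f.2 (v ^ (K / f.1)) with hG
  have hdiv : ∀ f ∈ F₀ ∪ F₁, K / f.1 ≠ 0 := fun f hf =>
    (Nat.div_pos (Nat.le_of_dvd (Nat.pos_of_ne_zero hK0) (hdvd f hf))
      (Nat.pos_of_ne_zero (hb f hf).1)).ne'
  have hbG : ∀ f ∈ F₀ ∪ F₁, IsBranch E q K (G f) := by
    intro f hf
    have := (hb f hf).2.comp_pow (hdiv f hf)
    rwa [Nat.mul_div_cancel' (hdvd f hf)] at this
  have ev1 : ∀ᶠ ε in 𝓝[>] (0 : ℝ), ∀ f ∈ F₀ ∪ F₁,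
      ContMDiffOn 𝓘(ℝ, ℝ) 𝓘(ℝ, E) ω (G f) (Icc 0 ε) :=
    (hF.eventually_all).2 fun f hf =>
      (hbG f hf).contMDiffWithinAt.eventually_contMDiffOn_Icc_right
  have ev2 : ∀ᶠ ε in 𝓝[>] (0 : ℝ), ∀ f ∈ F₀ ∪ F₁, ∀ v ∈ Icc 0 ε, sqDist E q (G f v) = v ^ K :=
    (hF.eventually_all).2 fun f hf => eventually_forall_Icc (hbG f hf).sqDist_eq
  -- Equal distances force equal parameters, so only coincidences G f v = G f' v at the same v
  -- matter. If they accumulate at 0, the identity theorem makes the arcs equal near 0; otherwise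
  -- they are absent for small v > 0.
  have ev3 : ∀ᶠ ε in 𝓝[>] (0 : ℝ), ∀ f ∈ F₀ ∪ F₁, ∀ f' ∈ F₀ ∪ F₁,
      (∀ v ∈ Icc 0 ε, G f v = G f' v) ∨ ∀ v ∈ Ioc 0 ε, G f v ≠ G f' v := by
    refine (hF.eventually_all).2 fun f hf => (hF.eventually_all).2 fun f' hf' => ?_
    by_cases hfr : ∃ᶠ v in 𝓝[>] (0 : ℝ), G f v = G f' v
    · exact (eventually_forall_Icc (eventually_eq_of_frequently_eq
        (hbG f hf).contMDiffWithinAt (hbG f' hf').contMDiffWithinAt hfr)).mono fun ε h => .inl h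
    · exact (eventually_forall_Ioc (not_frequently.1 hfr)).mono fun ε h => .inr h
  obtain ⟨ε, ⟨⟨e1, e2⟩, e3⟩, hε⟩ := (((ev1.and ev2).and ev3).and self_mem_nhdsWithin).exists
  have hε : 0 < ε := hε
  set C : (ℝ → M) → ℝ → M := fun e v => e (max 0 (min ε v)) with hC
  have hCeq : ∀ e, ∀ v ∈ Icc 0 ε, C e v = e v := fun e v hv => by
    simp only [hC]
    rw [min_eq_right hv.2, max_eq_right hv.1]
  refine ⟨K, (fun f => C (G f)) '' (F₀ ∪ F₁), ε, ⟨hK0, hε, hF.image _, ?_, ?_, ?_, ?_⟩, ?_⟩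
  · rintro _ ⟨f, hf, rfl⟩
    exact oneSidedAnalytic_comp_clamp hε (e1 f hf)
  · rintro _ ⟨f, hf, rfl⟩
    exact (hCeq (G f) 0 ⟨le_rfl, hε.le⟩).trans (hbG f hf).zero
  · rintro _ ⟨f, hf, rfl⟩ v hv
    exact (congrArg _ (hCeq (G f) v hv)).trans (e2 f hf v hv)
  · rintro _ ⟨f, hf, rfl⟩ _ ⟨f', hf', rfl⟩
    refine (e3 f hf f' hf').imp (fun h v hv => ?_) fun h v hv => ?_
    · exact (hCeq (G f) v hv).trans ((h v hv).trans (hCeq (G f') v hv).symm)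
    · have hv' := Ioc_subset_Icc_self hv
      exact fun heq => h v hv ((hCeq (G f) v hv').symm.trans (heq.trans (hCeq (G f') v hv')))
  · have hsmall : ∀ᶠ x in 𝓝 q, sqDist E q x < ε ^ K := by
      refine (continuousAt_sqDist q).eventually_lt_const ?_
      rw [sqDist_self]
      positivity
    refine ⟨_, inter_mem (inter_mem (inter_mem hU₀ hU₁) hsmall)
      ((chartAt E q).open_source.mem_nhds (mem_chart_source E q)), fun x hx hxγ => ⟨hx.2, ?_⟩⟩
    refine (hc x hx.1.1 hxγ).imp_right ?_
    rintro ⟨f, hf, v, hv0, hxv, hxd⟩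
    set w := v ^ ((K / f.1 : ℕ) : ℝ)⁻¹ with hw
    have hw0 : 0 ≤ w := Real.rpow_nonneg hv0 _
    have hwv : w ^ (K / f.1) = v := Real.rpow_inv_natCast_pow hv0 (hdiv f hf)
    have hwK : w ^ K = sqDist E q x := by
      rw [hxd, ← hwv, ← pow_mul, Nat.div_mul_cancel (hdvd f hf)]
    have hwε : w ∈ Icc 0 ε := by
      refine ⟨hw0, ?_⟩
      have h2 : sqDist E q x < ε ^ K := hx.1.2
      rw [← hwK] at h2
      exact (lt_of_pow_lt_pow_left₀ K hε.le h2).le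
    refine ⟨C (G f), mem_image_of_mem _ hf, w, hwε, ?_⟩
    refine Eq.trans ?_ (hCeq (G f) w hwε).symm
    rw [hxv, ← hwv]

/-- The radial paths of a star. -/
def IsRadial (q : M) (A : Set (ℝ → M)) (ε : ℝ) {x : M} (α : Path q x) : Prop :=
  (x = q ∧ ∀ t ∈ Icc (0 : ℝ) 1, α.extend t = q) ∨
    ∃ e ∈ A, ∃ v ∈ Icc 0 ε, ∀ t ∈ Icc (0 : ℝ) 1, α.extend t = e (v * t)

variable {q : M} {K : ℕ} {A : Set (ℝ → M)} {ε : ℝ}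

-- The distance of the end point from q gives the parameter v, and arcs that share a point other
-- than q coincide. This is the tree property of a star.
omit [IsManifold 𝓘(ℝ, E) ω M] [T2Space M] in
theorem IsStar.isRadial_unique (hS : IsStar E q K A ε) {x : M} {α β : Path q x}
    (hα : IsRadial q A ε α) (hβ : IsRadial q A ε β) : α = β := by
  have hconst : ∀ e ∈ A, ∀ v ∈ Icc 0 ε, e v = q → v = 0 := by
    intro e he v hv h
    have := hS.sqDist_eq e he v hv
    rw [h, sqDist_self] at this
    exact pow_eq_zero_iff hS.ne_zero |>.1 this.symm
  have hend : ∀ {α : Path q x} {e : ℝ → M} {v : ℝ},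
      (∀ t ∈ Icc (0 : ℝ) 1, α.extend t = e (v * t)) → x = e v := by
    intro α e v h
    have := h 1 (by simp)
    rwa [Path.extend_one, mul_one] at this
  refine path_ext_of_extend fun t ht => ?_
  rcases hα with ⟨hx, hα⟩ | ⟨e, he, v, hv, hα⟩ <;> rcases hβ with ⟨hx', hβ⟩ | ⟨e', he', v', hv', hβ⟩
  · rw [hα t ht, hβ t ht]
  · have := hconst e' he' v' hv' ((hend hβ).symm.trans hx)
    rw [hα t ht, hβ t ht, this, zero_mul, hS.zero e' he']
  · have := hconst e he v hv ((hend hα).symm.trans hx')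
    rw [hα t ht, hβ t ht, this, zero_mul, hS.zero e he]
  · have hee : e v = e' v' := (hend hα).symm.trans (hend hβ)
    have hvv : v = v' := by
      have := congrArg (sqDist E q) hee
      rw [hS.sqDist_eq e he v hv, hS.sqDist_eq e' he' v' hv'] at this
      exact (pow_left_inj₀ hv.1 hv'.1 hS.ne_zero).1 this
    subst hvv
    rw [hα t ht, hβ t ht]
    rcases hS.eq_or_ne e he e' he' with h | h
    · exact h _ ⟨mul_nonneg hv.1 ht.1, (mul_le_of_le_one_right hv.1 ht.2).trans hv.2⟩
    · rcases hv.1.eq_or_lt with h0 | h0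
      · rw [← h0, zero_mul, hS.zero e he, hS.zero e' he']
      · exact absurd hee (h v ⟨h0, hv.2⟩)

omit [T2Space M] [IsManifold 𝓘(ℝ, E) ω M] in
theorem IsRadial.oneSidedAnalytic (hS : IsStar E q K A ε) {x : M} {α : Path q x}
    (hα : IsRadial q A ε α) : OneSidedAnalytic E α.extend := by
  rcases hα with ⟨-, hα⟩ | ⟨e, he, v, -, hα⟩
  · exact oneSidedAnalytic_extend (oneSidedAnalytic_const q) hα
  · exact oneSidedAnalytic_extend ((hS.analytic e he).comp (oneSidedAnalytic_const_mul v)) hα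

omit [T2Space M] [IsManifold 𝓘(ℝ, E) ω M] in
theorem IsStar.exists_isRadial (hS : IsStar E q K A ε) {x : M} (hx : x ∈ starSet E q A ε) :
    ∃ α : Path q x, IsRadial q A ε α := by
  rcases hx.2 with rfl | ⟨e, he, v, hv, rfl⟩
  · exact ⟨Path.refl x, .inl ⟨rfl, fun t _ => rfl⟩⟩
  · refine ⟨((linePath 0 v).map (hS.analytic e he).continuous).cast (hS.zero e he).symm rfl,
      .inr ⟨e, he, v, hv, fun t ht => ?_⟩⟩
    rw [Path.extend_cast]
    change e ((linePath 0 v).extend t) = _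
    rw [linePath_extend ht]
    simp

variable {p : M}

/-- A one-sided analytic germ inside a star has the class of the radial path between its ends. -/
theorem IsStar.eventually_pathClass [CompleteSpace E] (hS : IsStar E q K A ε) {h : ℝ → M}
    (hh : OneSidedAnalytic E h) (hhS : ∀ u, h u ∈ starSet E q A ε) :
    ∀ᶠ b in 𝓝[>] (0 : ℝ), ∀ (x y : M) (β : Path x y) (hβ : OneSidedAnalytic E β.extend),
      (∀ t ∈ Icc (0 : ℝ) 1, β.extend t = h (b * t)) →
      ∀ (α : Path q x) (α' : Path q y) (hα : OneSidedAnalytic E α.extend)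
        (hα' : OneSidedAnalytic E α'.extend), IsRadial q A ε α → IsRadial q A ε α' →
      pathClass p α hα ≫ pathClass p β hβ = pathClass p α' hα' := by
  have hf : ContMDiffWithinAt 𝓘(ℝ, ℝ) 𝓘(ℝ, ℝ) ω (fun u => sqDist E q (h u)) (Ici 0) 0 :=
    ContMDiffAt.comp_contMDiffWithinAt (g := sqDist E q) 0 (contMDiffAt_sqDist (hhS 0).1) (hh 0).1
  -- If the distance to q vanishes on the germ, the germ is constant at q and there is nothing to
  -- compare.
  rcases exists_eq_pow_mul_of_nonneg hf (.of_forall fun u => sqDist_nonneg q _) with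
    hz | ⟨m, g, hg, hg0, hfg⟩
  · filter_upwards [eventually_forall_Icc hz, self_mem_nhdsWithin] with b hb (hb0 : 0 < b)
      x y β hβ hβh α α' hα hα' hαr hαr'
    have hconst : ∀ t ∈ Icc (0 : ℝ) 1, β.extend t = q := fun t ht => by
      rw [hβh t ht]
      exact eq_of_sqDist_eq_zero (hhS _).1
        (hb _ ⟨mul_nonneg hb0.le ht.1, mul_le_of_le_one_right hb0.le ht.2⟩)
    obtain rfl : x = q := by simpa using hconst 0 (by simp)
    obtain rfl : y = x := by simpa using hconst 1 (by simp)
    obtain rfl : β = Path.refl y := path_ext_of_extend fun t ht => by rw [hconst t ht]; rfl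
    obtain rfl := hS.isRadial_unique hαr hαr'
    rw [pathClass_refl, Category.comp_id]
  have hK := hS.ne_zero
  have h0K : (0 : ℝ) ^ K = 0 := zero_pow hK
  have hpow : OneSidedAnalytic ℝ fun w : ℝ => w ^ K := (contDiff_id.pow K).oneSidedAnalytic
  have htK : Tendsto (fun w : ℝ => w ^ K) (𝓝 0) (𝓝 0) := by
    have := (hpow.continuous.tendsto 0)
    rwa [h0K] at this
  have htK' : Tendsto (fun w : ℝ => w ^ K) (𝓝[≥] 0) (𝓝[≥] 0) := by
    refine tendsto_nhdsWithin_iff.2 ⟨htK.mono_left nhdsWithin_le_nhds, ?_⟩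
    filter_upwards [self_mem_nhdsWithin] with w (hw : 0 ≤ w) using pow_nonneg hw K
  -- The distance parameter of h(u) is the K-th root of u^m g(u), in general not analytic in u.
  -- After u = w^K it becomes w^m g(w^K)^(1/K), analytic in w because g(0) > 0.
  set f : ℝ → ℝ := fun w => w ^ m * g (w ^ K) ^ (K⁻¹ : ℝ) with hfdef
  have hfa : AnalyticAt ℝ f 0 := by
    refine (analyticAt_id.pow m).mul (AnalyticAt.rpow_const_of_pos ?_ (by rwa [h0K]))
    refine AnalyticAt.comp (g := g) (f := fun w : ℝ => w ^ K) ?_ (analyticAt_id.pow K)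
    rwa [h0K]
  have hgpos : ∀ᶠ w in 𝓝 0, 0 < g (w ^ K) := htK.eventually (hg.continuousAt.eventually_const_lt hg0)
  have hdist : ∀ᶠ w in 𝓝[≥] 0, sqDist E q (h (w ^ K)) = f w ^ K ∧ 0 ≤ f w ∧ (0 < w → 0 < f w) := by
    filter_upwards [htK'.eventually hfg, hgpos.filter_mono nhdsWithin_le_nhds,
      self_mem_nhdsWithin] with w h1 h2 (h3 : 0 ≤ w)
    refine ⟨?_, mul_nonneg (pow_nonneg h3 m) (Real.rpow_nonneg h2.le _), fun h4 =>
      mul_pos (pow_pos h4 m) (Real.rpow_pos_of_pos h2 _)⟩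
    rw [h1, hfdef]
    simp only
    rw [mul_pow, Real.rpow_inv_natCast_pow h2.le hK, ← pow_mul, ← pow_mul, mul_comm K m]
  have hle : 𝓝[>] (0 : ℝ) ≤ 𝓝[≥] 0 := nhdsWithin_mono _ Ioi_subset_Ici_self
  have hex : ∀ᶠ w in 𝓝[>] 0, ∃ e ∈ A, h (w ^ K) = e (f w) ∧ f w ∈ Icc 0 ε := by
    filter_upwards [hdist.filter_mono hle, self_mem_nhdsWithin] with w hw (hw0 : 0 < w)
    rcases (hhS (w ^ K)).2 with h1 | ⟨e, he, v, hv, h1⟩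
    · have h2 := hw.1
      rw [h1, sqDist_self] at h2
      exact absurd h2 (pow_pos (hw.2.2 hw0) K).ne
    · have h2 := hw.1
      rw [h1, hS.sqDist_eq e he v hv] at h2
      have h3 := (pow_left_inj₀ hv.1 hw.2.1 hK).1 h2
      exact ⟨e, he, h3 ▸ h1, h3 ▸ hv⟩
  -- One of the finitely many arcs e satisfies h(w^K) = e(f w) for w accumulating at 0, and the
  -- identity theorem extends this to all small w ≥ 0. So the germ factors through a single arc.
  obtain ⟨e, he, hfre⟩ : ∃ e ∈ A, ∃ᶠ w in 𝓝[>] (0 : ℝ), h (w ^ K) = e (f w) := by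
    by_contra! hcon
    have : ∀ᶠ w in 𝓝[>] (0 : ℝ), ∀ e ∈ A, h (w ^ K) ≠ e (f w) :=
      (hS.finite.eventually_all).2 fun e he => hcon e he
    obtain ⟨w, hw, e, he, hwe, -⟩ := (this.and hex).exists
    exact hw e he hwe
  have hef : ContMDiffWithinAt 𝓘(ℝ, ℝ) 𝓘(ℝ, E) ω (fun w => e (f w)) (Ici 0) 0 := by
    have hfc := hfa.contMDiffWithinAt (f := f) (self_mem_Ici (a := (0 : ℝ))) .rfl
    rcases hfa.eventually_nonneg_or_nonpos.1 with h1 | h1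
    · exact ((hS.analytic e he) (f 0)).1.comp_of_eventually hfc h1
    · exact ((hS.analytic e he) (f 0)).2.comp_of_eventually hfc h1
  have heq := eventually_eq_of_frequently_eq ((hh.comp hpow) 0).1 hef hfre
  have hmem : ∀ᶠ w in 𝓝[≥] 0, f w ∈ Icc 0 ε := by
    have h1 : ∀ᶠ w in 𝓝[>] 0, f w ∈ Icc 0 ε := hex.mono fun w ⟨e, _, _, h⟩ => h
    have h2 : f 0 ∈ Icc 0 ε := isClosed_Icc.mem_of_tendsto
      (hfa.continuousAt.tendsto.mono_left (nhdsWithin_le_nhds (s := Ioi 0))) h1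
    have h1' := eventually_nhdsWithin_iff.1 h1
    refine eventually_nhdsWithin_iff.2 (h1'.mono fun w hw hw0 => ?_)
    rcases (mem_Ici.1 hw0).eq_or_lt with h3 | h3
    · rwa [← h3]
    · exact hw h3
  obtain ⟨δ, ⟨hδ1, hδ2⟩, hδ0⟩ := (((eventually_forall_Icc (heq.and hmem)).and
    (hfa.contMDiffWithinAt (f := f) (self_mem_Ici (a := (0 : ℝ)))
      .rfl).eventually_contMDiffOn_Icc_right).and self_mem_nhdsWithin).exists
  have hδ0 : 0 < δ := hδ0
  have hF := oneSidedAnalytic_comp_clamp hδ0 hδ2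
  set F : ℝ → ℝ := fun w => f (max 0 (min δ w)) with hFdef
  have hFf : ∀ w ∈ Icc 0 δ, F w = f w := fun w hw => by
    simp only [hFdef]
    rw [min_eq_right hw.2, max_eq_right hw.1]
  have heF : ∀ w ∈ Icc 0 δ, h (w ^ K) = e (F w) ∧ F w ∈ Icc 0 ε := fun w hw => by
    rw [hFf w hw]; exact hδ1 w hw
  filter_upwards [Ioo_mem_nhdsGT (pow_pos hδ0 K)] with b hb x y β hβ hβh α α' hα hα' hαr hαr'
  set c := b ^ (K⁻¹ : ℝ) with hc
  have hc0 : 0 ≤ c := Real.rpow_nonneg hb.1.le _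
  have hcK : c ^ K = b := Real.rpow_inv_natCast_pow hb.1.le hK
  have hcδ : c ≤ δ := (lt_of_pow_lt_pow_left₀ K hδ0.le (hcK.trans_lt hb.2)).le
  have hcm : c ∈ Icc 0 δ := ⟨hc0, hcδ⟩
  have h0m : (0 : ℝ) ∈ Icc 0 δ := ⟨le_rfl, hδ0.le⟩
  obtain rfl : x = e (F 0) := by
    rw [← (heF 0 h0m).1, ← β.extend_zero, hβh 0 (by simp), h0K, mul_zero]
  obtain rfl : y = e (F c) := by
    rw [← (heF c hcm).1, ← β.extend_one, hβh 1 (by simp), hcK, mul_one]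
  have he0 := hS.zero e he
  have hea := hS.analytic e he
  let ψ : Path (F 0) (F c) :=
    { toFun := fun t => F (c * t)
      continuous_toFun := hF.continuous.comp (by fun_prop)
      source' := by simp
      target' := by simp }
  have hψe : ∀ t ∈ Icc (0 : ℝ) 1, ψ.extend t = F (c * t) := fun t ht => by
    rw [Path.extend_apply _ ht]; rfl
  have hψ : OneSidedAnalytic ℝ ψ.extend :=
    oneSidedAnalytic_extend (hF.comp (oneSidedAnalytic_const_mul c)) hψe
  -- The substitution t ↦ t^K fixes 0 and 1, hence does not change the class of β; after it, β is e
  -- composed with the real path ψ.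
  have h1 : pathClass p β hβ = pathClass p (ψ.map hea.continuous) (oneSidedAnalytic_map hea hψ) := by
    refine (pathClass_eq_iff.2 (.of_comp hβ hpow (by rw [h0K]) (by simp) fun t ht => ?_)).symm
    change e (ψ.extend t) = _
    have htK : t ^ K ∈ Icc (0 : ℝ) 1 := ⟨pow_nonneg ht.1 K, pow_le_one₀ ht.1 ht.2⟩
    rw [hψe t ht, hβh _ htK, ← hcK, ← mul_pow]
    exact ((heF (c * t) ⟨mul_nonneg hc0 ht.1,
      (mul_le_of_le_one_right hc0 ht.2).trans hcδ⟩).1).symm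
  have hl := fun a b => oneSidedAnalytic_linePath a b
  subst he0
  have hrad : ∀ w ∈ Icc 0 δ, IsRadial (e 0) A ε ((linePath 0 (F w)).map hea.continuous) :=
    fun w hw => .inr ⟨e, he, F w, (heF w hw).2, fun t ht => by
      change e ((linePath 0 (F w)).extend t) = _
      rw [linePath_extend ht]
      simp⟩
  obtain rfl := hS.isRadial_unique hαr (hrad 0 h0m)
  obtain rfl := hS.isRadial_unique hαr' (hrad c hcm)
  -- Both sides are now images under e of paths in the line from 0 to F c.
  rw [h1, ← pathClass_trans, ← pathClass_map_eq hea ((hl 0 (F 0)).trans hψ) (hl 0 (F c))]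
  congr 1
  rw [Path.map_trans]

/-- Inside a star, the class of a path is determined by its end points. -/
theorem IsStar.pathClass_eq [CompleteSpace E] (hS : IsStar E q K A ε) {x y : M} {β : Path x y}
    (hβ : OneSidedAnalytic E β.extend) (hβS : ∀ t, β.extend t ∈ starSet E q A ε)
    {α : Path q x} {α' : Path q y} (hα : OneSidedAnalytic E α.extend)
    (hα' : OneSidedAnalytic E α'.extend) (hαr : IsRadial q A ε α) (hαr' : IsRadial q A ε α') :
    pathClass p α hα ≫ pathClass p β hβ = pathClass p α' hα' := by
  set ℓ : ℝ → M := ⇑β.extend with hℓ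
  -- Adjacent intervals are joined by inserting a radial path to the intermediate point. Short
  -- intervals on the left of a point reduce to those on its right by reversing the path, which
  -- exchanges the two radial paths.
  let P : ℝ → ℝ → Prop := fun a b => ∀ (x y : M) (β : Path x y)
    (hβ : OneSidedAnalytic E β.extend), (∀ t ∈ Icc (0 : ℝ) 1, β.extend t = ℓ (a + (b - a) * t)) →
      ∀ (α : Path q x) (α' : Path q y) (hα : OneSidedAnalytic E α.extend)
        (hα' : OneSidedAnalytic E α'.extend), IsRadial q A ε α → IsRadial q A ε α' →
      pathClass p α hα ≫ pathClass p β hβ = pathClass p α' hα'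
  have key : P 0 1 := by
    refine interval_induction zero_le_one ?_ ?_ ?_ ?_
    · intro x y β hβ h α α' hα hα' hr hr'
      have hc : ∀ t ∈ Icc (0 : ℝ) 1, β.extend t = ℓ 0 := fun t ht => by rw [h t ht]; simp
      obtain rfl : x = ℓ 0 := by simpa using hc 0 (by simp)
      obtain rfl : y = ℓ 0 := by simpa using hc 1 (by simp)
      obtain rfl : β = Path.refl (ℓ 0) := path_ext_of_extend fun t ht => by rw [hc t ht]; rfl
      obtain rfl := hS.isRadial_unique hr hr'
      rw [pathClass_refl, Category.comp_id]
    · intro a b c _ _ _ _ h1 h2 x z δ hδ h α α'' hα hα'' hr hr''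
      obtain rfl : x = ℓ a := by simpa using h 0 (by simp)
      obtain rfl : z = ℓ c := by simpa using h 1 (by simp)
      obtain ⟨α', hr'⟩ := hS.exists_isRadial (hβS b)
      have hα' := hr'.oneSidedAnalytic hS
      have hl := fun a b => oneSidedAnalytic_linePath a b
      have hm : ∀ a b, ∀ t ∈ Icc (0 : ℝ) 1,
          ((linePath a b).map hβ.continuous).extend t = ℓ (a + (b - a) * t) := fun a b t ht => by
        change ℓ ((linePath a b).extend t) = _
        rw [linePath_extend ht]
      have e1 := h1 _ _ ((linePath a b).map hβ.continuous) (oneSidedAnalytic_map hβ (hl a b))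
        (hm a b) α α' hα hα' hr hr'
      have e2 := h2 _ _ ((linePath b c).map hβ.continuous) (oneSidedAnalytic_map hβ (hl b c))
        (hm b c) α' α'' hα' hα'' hr' hr''
      obtain rfl : δ = (linePath a c).map hβ.continuous :=
        path_ext_of_extend fun t ht => by rw [h t ht, hm a c t ht]
      rw [← e2, ← e1, Category.assoc, pathClass_linePath_trans hβ]
    · intro a _
      have hh : OneSidedAnalytic E fun u => ℓ (a + u) :=
        hβ.comp (φ := fun u => a + u) (ContDiff.oneSidedAnalytic (by fun_prop))
      have ht : Tendsto (fun b => b - a) (𝓝[>] a) (𝓝[>] 0) := by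
        refine tendsto_nhdsWithin_iff.2 ⟨?_, ?_⟩
        · have : ContinuousAt (fun b => b - a) a := by fun_prop
          simpa using this.tendsto.mono_left (nhdsWithin_le_nhds (s := Ioi a))
        · filter_upwards [self_mem_nhdsWithin] with b hb using sub_pos.2 (mem_Ioi.1 hb)
      exact (ht.eventually (hS.eventually_pathClass (p := p) hh fun u => hβS _)).mono
        fun b hb => hb
    · intro b _
      have hh : OneSidedAnalytic E fun u => ℓ (b - u) :=
        hβ.comp (φ := fun u => b - u) (ContDiff.oneSidedAnalytic (by fun_prop))
      have ht : Tendsto (fun a => b - a) (𝓝[<] b) (𝓝[>] 0) := by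
        refine tendsto_nhdsWithin_iff.2 ⟨?_, ?_⟩
        · have : ContinuousAt (fun a => b - a) b := by fun_prop
          simpa using this.tendsto.mono_left (nhdsWithin_le_nhds (s := Iio b))
        · filter_upwards [self_mem_nhdsWithin] with a ha using sub_pos.2 (mem_Iio.1 ha)
      filter_upwards [ht.eventually (hS.eventually_pathClass (p := p) hh fun u => hβS _)]
        with a ha x y δ hδ h α α' hα hα' hr hr'
      have := ha y x δ.symm hδ.symm (fun t ht => by
        rw [Path.extend_symm_apply, h (1 - t) ⟨by linarith [ht.2], by linarith [ht.1]⟩]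
        congr 1; ring) α' α hα' hα hr' hr
      rw [pathClass_symm hδ] at this
      rw [← this, Category.assoc, Groupoid.inv_comp, Category.comp_id]
  exact key x y β hβ (fun t _ => by rw [hℓ]; congr 1; ring) α α' hα hα' hαr hαr'

/-- Inside a star, paths with the same end points have the same class. -/
theorem IsStar.pathClass_eq_pathClass [CompleteSpace E] (hS : IsStar E q K A ε) {x y : M}
    {β β' : Path x y} (hβ : OneSidedAnalytic E β.extend) (hβ' : OneSidedAnalytic E β'.extend)
    (hβS : ∀ t, β.extend t ∈ starSet E q A ε) (hβS' : ∀ t, β'.extend t ∈ starSet E q A ε) :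
    pathClass p β hβ = pathClass p β' hβ' := by
  obtain ⟨α, hr⟩ := hS.exists_isRadial (x := x) (by simpa using hβS 0)
  obtain ⟨α', hr'⟩ := hS.exists_isRadial (x := y) (by simpa using hβS 1)
  have h1 := hS.pathClass_eq (p := p) hβ hβS (hr.oneSidedAnalytic hS) (hr'.oneSidedAnalytic hS)
    hr hr'
  have h2 := hS.pathClass_eq (p := p) hβ' hβS' (hr.oneSidedAnalytic hS) (hr'.oneSidedAnalytic hS)
    hr hr'
  exact (cancel_epi _).1 (h1.trans h2.symm)

end

end ThinLoops

/-! ### From thin homotopies to retrace equivalence -/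

namespace ThinLoops

open Set Filter Topology CategoryTheory

section

variable {E : Type*} [NormedAddCommGroup E] [InnerProductSpace ℝ E]
  {M : Type*} [TopologicalSpace M] [ChartedSpace E M] [IsManifold 𝓘(ℝ, E) ω M] {p : M}

variable (p) in
/-- The class of the restriction to `[a, b]` of a curve. -/
def segClass {f : ℝ → M} (hf : OneSidedAnalytic E f) (a b : ℝ) :
    (⟨f a⟩ : RetraceGroupoid E p) ⟶ ⟨f b⟩ :=
  pathClass p ((linePath a b).map hf.continuous)
    (oneSidedAnalytic_map hf (oneSidedAnalytic_linePath a b))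

theorem segClass_comp {f : ℝ → M} (hf : OneSidedAnalytic E f) (a b c : ℝ) :
    segClass p hf a b ≫ segClass p hf b c = segClass p hf a c :=
  pathClass_linePath_trans hf a b c

theorem segClass_self {f : ℝ → M} (hf : OneSidedAnalytic E f) (a : ℝ) :
    segClass p hf a a = 𝟙 _ := by
  have h := segClass_comp (p := p) hf a a a
  rwa [← cancel_epi (segClass p hf a a), Category.comp_id]

variable {F : ℝ × ℝ → M} (hv : ∀ s, OneSidedAnalytic E fun t => F (s, t))
  (hh : ∀ t, OneSidedAnalytic E fun s => F (s, t))

variable (p) in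
/-- The two ways along the boundary of `[a, b] × [c, d]` have the same class. -/
def SquareCommutes (a b c d : ℝ) : Prop :=
  segClass p (hv a) c d ≫ segClass p (hh d) a b = segClass p (hh c) a b ≫ segClass p (hv b) c d

theorem SquareCommutes.self_left (a c d : ℝ) : SquareCommutes p hv hh a a c d := by
  rw [SquareCommutes, segClass_self, segClass_self]
  exact (Category.comp_id _).trans (Category.id_comp _).symm

theorem SquareCommutes.self_right (a b c : ℝ) : SquareCommutes p hv hh a b c c := by
  rw [SquareCommutes, segClass_self, segClass_self]
  exact (Category.id_comp _).trans (Category.comp_id _).symm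

theorem SquareCommutes.trans_left {a b c d e : ℝ} (h₁ : SquareCommutes p hv hh a b d e)
    (h₂ : SquareCommutes p hv hh b c d e) : SquareCommutes p hv hh a c d e := by
  rw [SquareCommutes] at *
  rw [← segClass_comp (hh e) a b c, ← segClass_comp (hh d) a b c, Category.assoc, ← h₂,
    ← Category.assoc, h₁, Category.assoc]

theorem SquareCommutes.trans_right {a b c d e : ℝ} (h₁ : SquareCommutes p hv hh a b c d)
    (h₂ : SquareCommutes p hv hh a b d e) : SquareCommutes p hv hh a b c e := by
  rw [SquareCommutes] at *
  rw [← segClass_comp (hv a) c d e, ← segClass_comp (hv b) c d e, Category.assoc, h₂,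
    ← Category.assoc, h₁, Category.assoc]

/-- Interval induction is used twice: over the second variable for a fixed narrow strip, and over
the first variable for whole strips. -/
theorem SquareCommutes.of_small {δ : ℝ} (hδ : 0 < δ)
    (h : ∀ a b c d, a ≤ b → b < a + δ → c ≤ d → d < c + δ → SquareCommutes p hv hh a b c d) :
    SquareCommutes p hv hh 0 1 0 1 := by
  have right : ∀ a : ℝ, ∀ᶠ b in 𝓝[>] a, a ≤ b ∧ b < a + δ := fun a => by
    filter_upwards [Ioo_mem_nhdsGT (show a < a + δ by linarith)] with b hb using ⟨hb.1.le, hb.2⟩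
  have left : ∀ b : ℝ, ∀ᶠ a in 𝓝[<] b, a ≤ b ∧ b < a + δ := fun b => by
    filter_upwards [Ioo_mem_nhdsLT (show b - δ < b by linarith)] with a ha
      using ⟨ha.2.le, by linarith [ha.1]⟩
  have key : ∀ a b, a ≤ b → b < a + δ → SquareCommutes p hv hh a b 0 1 := fun a b hab hb =>
    interval_induction zero_le_one (SquareCommutes.self_right hv hh a b 0)
      (fun _ _ _ _ _ _ _ => SquareCommutes.trans_right hv hh)
      (fun c _ => (right c).mono fun d hd => h a b c d hab hb hd.1 hd.2)
      fun d _ => (left d).mono fun c hd => h a b c d hab hb hd.1 hd.2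
  exact interval_induction (P := fun a b => SquareCommutes p hv hh a b 0 1) zero_le_one
    (SquareCommutes.self_left hv hh 0 0 1)
    (fun _ _ _ _ _ _ _ => SquareCommutes.trans_left hv hh)
    (fun a _ => (right a).mono fun b hb => key a b hb.1 hb.2)
    fun b _ => (left b).mono fun a hb => key a b hb.1 hb.2

theorem extend_mem_of_trans {x y z : M} {α : Path x y} {β : Path y z} {S : Set M}
    (hα : ∀ t, α.extend t ∈ S) (hβ : ∀ t, β.extend t ∈ S) (t : ℝ) : (α.trans β).extend t ∈ S := by
  rcases le_total t (1 / 2) with h | h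
  · rw [Path.extend_trans_of_le_half _ _ h]; exact hα _
  · rw [Path.extend_trans_of_half_le _ _ h]; exact hβ _

theorem extend_linePath_map_mem {f : ℝ → M} (hf : Continuous f) {a b : ℝ} (hab : a ≤ b)
    {S : Set M} (h : ∀ t ∈ Icc a b, f t ∈ S) (t : ℝ) : ((linePath a b).map hf).extend t ∈ S :=
  h _ (linePath_mem (left_mem_Icc.2 hab) (right_mem_Icc.2 hab) _)

theorem squareCommutes_of_isStar [T2Space M] [CompleteSpace E] {q : M} {K : ℕ} {A : Set (ℝ → M)}
    {ε : ℝ} (hS : IsStar E q K A ε) {a b c d : ℝ} (hab : a ≤ b) (hcd : c ≤ d)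
    (h : ∀ s ∈ Icc a b, ∀ t ∈ Icc c d, F (s, t) ∈ starSet E q A ε) :
    SquareCommutes p hv hh a b c d := by
  have ha := left_mem_Icc.2 hab
  have hb := right_mem_Icc.2 hab
  have hc := left_mem_Icc.2 hcd
  have hd := right_mem_Icc.2 hcd
  have hl := fun a b => oneSidedAnalytic_linePath a b
  exact hS.pathClass_eq_pathClass (p := p)
    (β := ((linePath c d).map (hv a).continuous).trans ((linePath a b).map (hh d).continuous))
    (β' := ((linePath a b).map (hh c).continuous).trans ((linePath c d).map (hv b).continuous))
    ((oneSidedAnalytic_map (hv a) (hl c d)).trans (oneSidedAnalytic_map (hh d) (hl a b)))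
    ((oneSidedAnalytic_map (hh c) (hl a b)).trans (oneSidedAnalytic_map (hv b) (hl c d)))
    (extend_mem_of_trans (extend_linePath_map_mem _ hcd fun t ht => h a ha t ht)
      (extend_linePath_map_mem _ hab fun s hs => h s hs d hd))
    (extend_mem_of_trans (extend_linePath_map_mem _ hab fun s hs => h s hs c hc)
      (extend_linePath_map_mem _ hcd fun t ht => h b hb t ht))

/-- The corners of the square equal `p` only propositionally, so the classes live in different
hom-sets; with the corners as variables they can be substituted. The constant sides become
identities. -/
theorem pathClass_eq_of_square {x y z w : M} (hx : x = p) (hy : y = p) (hz : z = p) (hw : w = p)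
    {α : Path x y} {β : Path y w} {β' : Path x z} {α' : Path z w}
    {hα : OneSidedAnalytic E α.extend} {hβ : OneSidedAnalytic E β.extend}
    {hβ' : OneSidedAnalytic E β'.extend} {hα' : OneSidedAnalytic E α'.extend}
    (h : pathClass p α hα ≫ pathClass p β hβ = pathClass p β' hβ' ≫ pathClass p α' hα')
    (hβp : ∀ t ∈ Icc (0 : ℝ) 1, β.extend t = p) (hβp' : ∀ t ∈ Icc (0 : ℝ) 1, β'.extend t = p)
    {γ γ' : Path p p} (hγ : OneSidedAnalytic E γ.extend) (hγ' : OneSidedAnalytic E γ'.extend)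
    (hαγ : ∀ t ∈ Icc (0 : ℝ) 1, α.extend t = γ.extend t)
    (hαγ' : ∀ t ∈ Icc (0 : ℝ) 1, α'.extend t = γ'.extend t) :
    pathClass p γ hγ = pathClass p γ' hγ' := by
  subst hx hy hz hw
  obtain rfl := path_ext_of_extend hαγ
  obtain rfl := path_ext_of_extend hαγ'
  obtain rfl : β = Path.refl _ := path_ext_of_extend hβp
  obtain rfl : β' = Path.refl _ := path_ext_of_extend hβp'
  rwa [pathClass_refl, Category.comp_id, Category.id_comp] at h

/-- This is where thinness enters: every value of the homotopy lies on one of the two loops, so near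
each point the homotopy runs inside a star, where going round a small rectangle either way gives the
same class. -/
theorem ThinHomotopic.retraceEquivalent [T2Space M] [CompleteSpace E] {γ₀ γ₁ : PALoop E p}
    (h : ThinHomotopic γ₀ γ₁) : RetraceEquivalent γ₀ γ₁ := by
  obtain ⟨η, -, hη, hr⟩ := h
  set F : ℝ × ℝ → M :=
    fun x => η (projIcc 0 1 zero_le_one x.1, projIcc 0 1 zero_le_one x.2) with hF
  have hP : PolyAnalyticOn E F square := hη.polyAnalyticOn
  have hv : ∀ s, OneSidedAnalytic E fun t => F (s, t) := fun s => by
    set s' : I := projIcc 0 1 zero_le_one s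
    let γ : Path (η (s', 0)) (η (s', 1)) :=
      { toFun := fun t => η (s', t)
        continuous_toFun := by fun_prop
        source' := rfl
        target' := rfl }
    exact hP.segment (γ := γ) (a := 0) (b := s') (c := 1) (d := 0)
      (fun u hu => ⟨by simp, by simpa using hu⟩)
      fun u hu => by
        rw [Path.extend_apply _ hu]
        change η _ = η _
        simp [projIcc_of_mem zero_le_one hu]
  have hh : ∀ t, OneSidedAnalytic E fun s => F (s, t) := fun t => by
    set t' : I := projIcc 0 1 zero_le_one t
    let γ : Path (η (0, t')) (η (1, t')) :=
      { toFun := fun s => η (s, t')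
        continuous_toFun := by fun_prop
        source' := rfl
        target' := rfl }
    exact hP.segment (γ := γ) (a := 1) (b := 0) (c := 0) (d := t')
      (fun u hu => ⟨by simpa using hu, by simp⟩)
      fun u hu => by
        rw [Path.extend_apply _ hu]
        change η _ = η _
        simp [projIcc_of_mem zero_le_one hu]
  have hrange : ∀ x, η x ∈ γ₀.1.extend '' Icc 0 1 ∪ γ₁.1.extend '' Icc 0 1 := fun x => by
    rcases hr (mem_range_self x) with ⟨t, ht⟩ | ⟨t, ht⟩
    · exact .inl ⟨t, t.2, by rw [← ht, Path.extend_extends']⟩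
    · exact .inr ⟨t, t.2, by rw [← ht, Path.extend_extends']⟩
  have hstar := fun x : I × I =>
    exists_isStar γ₀.oneSidedAnalytic γ₁.oneSidedAnalytic (η x) 0 1
  choose K A ε hS U hU hUS using hstar
  -- Every rectangle with sides shorter than the Lebesgue number δ is mapped into one star.
  -- Rectangles leaving the unit square are covered too, because the projection to `[0,1]` does not
  -- increase distances.
  obtain ⟨δ, hδ, hball⟩ := lebesgue_number_lemma_of_metric (s := (univ : Set (I × I)))
    (c := fun x => interior (η ⁻¹' U x)) isCompact_univ (fun _ => isOpen_interior)
    fun x _ => mem_iUnion.2 ⟨x, mem_interior_iff_mem_nhds.2 (η.continuous.continuousAt (hU x))⟩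
  have hcomm : SquareCommutes p hv hh 0 1 0 1 := by
    refine .of_small hv hh hδ fun a b c d hab hb hcd hd => ?_
    obtain ⟨x, hx⟩ := hball (projIcc 0 1 zero_le_one a, projIcc 0 1 zero_le_one c) (mem_univ _)
    refine squareCommutes_of_isStar hv hh (hS x) hab hcd fun s hs t ht =>
      hUS x _ (mem_preimage.1 (interior_subset (s := η ⁻¹' U x) (hx ?_))) (hrange _)
    have hproj : ∀ u v : ℝ, u ≤ v → v < u + δ →
        dist (projIcc (0 : ℝ) 1 zero_le_one v) (projIcc 0 1 zero_le_one u) < δ := fun u v h h' => by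
      refine ((LipschitzWith.projIcc zero_le_one).dist_le_mul v u).trans_lt ?_
      rw [NNReal.coe_one, one_mul, Real.dist_eq, abs_of_nonneg (by linarith)]
      linarith
    exact max_lt (hproj a s hs.1 (hs.2.trans_lt hb)) (hproj c t ht.1 (ht.2.trans_lt hd))
  have hline : ∀ {f : ℝ → M} (hf : Continuous f), ∀ t ∈ Icc (0 : ℝ) 1,
      ((linePath 0 1).map hf).extend t = f t := fun {f} hf t ht => by
    change f ((linePath 0 1).extend t) = _
    rw [linePath_extend ht]
    simp
  have hcls : pathClass p γ₀.1 γ₀.oneSidedAnalytic = pathClass p γ₁.1 γ₁.oneSidedAnalytic := by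
    refine pathClass_eq_of_square ?_ ?_ ?_ ?_ hcomm (fun t ht => ?_) (fun t ht => ?_) _ _
      (fun t ht => ?_) fun t ht => ?_
    · simp [hF]
    · simp [hF]
    · simp [hF]
    · simp [hF]
    · rw [hline _ t ht]; simp [hF]
    · rw [hline _ t ht]; simp [hF]
    · rw [hline _ t ht, Path.extend_apply _ ht]
      simp [hF, projIcc_of_mem zero_le_one ht]
    · rw [hline _ t ht, Path.extend_apply _ ht]
      simp [hF, projIcc_of_mem zero_le_one ht]
  obtain ⟨_, _, h⟩ := (pathClass_eq_iff.1 hcls).loopRel γ₀.oneSidedAnalytic γ₁.oneSidedAnalytic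
  exact h

theorem ThinEquivalent.retraceEquivalent [T2Space M] [CompleteSpace E] {γ₀ γ₁ : PALoop E p}
    (h : ThinEquivalent γ₀ γ₁) : RetraceEquivalent γ₀ γ₁ := by
  induction h with
  | rel _ _ h => exact h.retraceEquivalent
  | refl _ => exact .refl _
  | symm _ _ _ ih => exact .symm _ _ ih
  | trans _ _ _ _ _ ih ih' => exact .trans _ _ _ ih ih'

end

end ThinLoops

theorem mainTheorem3 (n : ℕ) (M : Type*) [TopologicalSpace M] [T2Space M]
    [ChartedSpace (EuclideanSpace ℝ (Fin n)) M]
    [IsManifold 𝓘(ℝ, EuclideanSpace ℝ (Fin n)) ω M] (p : M)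
    (γ₀ γ₁ : ThinLoops.PALoop (EuclideanSpace ℝ (Fin n)) p) :
    ThinLoops.ThinEquivalent γ₀ γ₁ ↔ ThinLoops.RetraceEquivalent γ₀ γ₁ :=
  ⟨fun h => h.retraceEquivalent, fun h => h.thinEquivalent⟩
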